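/- Let $k$ be a field and let $X$ be a collection of generators: a set in which every $b\in X$ has an arity $\mathrm{ar}(b)\ge 1$ (for a collection $\mathcal V$ of vector spaces, $X$ is the union of fixed bases of the spaces $\mathcal V(n)$, $n\ge1$). A \emph{tree monomial} of arity $n\ge1$ is a rooted tree whose vertices are decorated by elements of $X$, a vertex decorated by $b$ having $\mathrm{ar}(b)$ inputs, and whose leaves are labelled bijectively by $\{1,\dots,n\}$; it is drawn in the plane so that at every vertex the inputs are ordered by the smallest leaf that can be reached through them. The tree without vertices (the unit) is allowed. The tree monomials form a basis of the \emph{free shuffle operad} $\mathcal F$ on $\mathcal V$; elements of $\mathcal F$ are finite $k$-linear combinations of tree monomials, and such an element is \emph{homogeneous} if all tree monomials occurring in it have the same arity. For $\alpha$ of arity $n$, $\beta$ of arity $m$, $1\le i\le n$ and an $(m-1,n-i)$-shuffle $\sigma$ of $\{i+1,\dots,m+n-1\}$ (a permutation that is increasing on $\{i+1,\dots,i+m-1\}$ and on $\{i+m,\dots,m+n-1\}$), the \emph{elementary shuffle composition} $\alpha\circ_{i,\sigma}\beta$ is $$\alpha(x_1,\dots,x_{i-1},\beta(x_i,x_{\sigma(i+1)},\dots,x_{\sigma(i+m-1)}),x_{\sigma(i+m)},\dots,x_{\sigma(m+n-1)}),$$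 extended bilinearly to linear combinations. An \emph{operadic ideal} is a subspace of $\mathcal F$ that is graded by arity and closed under shuffle compositions, on either side, with arbitrary elements of $\mathcal F$. A total ordering of the tree monomials is \emph{admissible} if tree monomials of smaller arity are smaller, and if $\alpha\le\alpha'$ (of arity $n$) and $\beta\le\beta'$ (of arity $m$) imply $\alpha\circ_{i,\sigma}\beta\le\alpha'\circ_{i,\sigma}\beta'$ for all $i$ and $\sigma$. Fix an admissible ordering that is a well-ordering. For $f\neq0$ let $\mathrm{lt}(f)$ be the largest tree monomial occurring in $f$ and $c_f$ its coefficient. A tree monomial $\alpha$ is \emph{divisible} by $\beta$ if some subtree of $\alpha$ that contains all inputs and outputs of each of its vertices becomes $\beta$ when its leaves are renumbered in the order of their smallest descendant leaves in $\alpha$; a single edge counts as a subtree without vertices. For such an occurrence, $m_{\alpha,\beta}$ is the linear operation that replaces this subtree by tree monomials of the same arity as $\beta$. If $\mathrm{lt}(f)$ is divisible by $\mathrm{lt}(g)$, with $g$ homogeneous, then $f-\frac{c_f}{c_g}m_{\mathrm{lt}(f),\mathrm{lt}(g)}(g)$ is a \emph{reduction} of $f$ modulo $g$. An element \emph{reduces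 to $0$ modulo $\mathcal G$} if a finite (possibly empty) sequence of reductions modulo elements of $\mathcal G$ leads from it to $0$. If $f,g$ are homogeneous and a tree monomial $\gamma$ is divisible by $\mathrm{lt}(f)$ and by $\mathrm{lt}(g)$ and has fewer vertices than $\mathrm{lt}(f)$ and $\mathrm{lt}(g)$ have in total, then, for each choice of an occurrence of $\mathrm{lt}(f)$ and one of $\mathrm{lt}(g)$ in $\gamma$, the element $m_{\gamma,\mathrm{lt}(f)}(f)-\frac{c_f}{c_g}m_{\gamma,\mathrm{lt}(g)}(g)$ is an \emph{S-polynomial} of $f$ and $g$. \textbf{Theorem (operadic Diamond Lemma).} Let $\mathcal M$ be an operadic ideal of $\mathcal F$ and let $\mathcal G$ be a set of homogeneous elements that generates $\mathcal M$ as an operadic ideal. The following are equivalent: (i) $\mathcal G$ is a Gröbner basis of $\mathcal M$: for every nonzero $f\in\mathcal M$, $\mathrm{lt}(f)$ is divisible by $\mathrm{lt}(g)$ for some nonzero $g\in\mathcal G$; (ii) every $f\in\mathcal M$ reduces to $0$ modulo $\mathcal G$; (iii) for all $f,g\in\mathcal G$ (including $f=g$), all S-polynomials of $f$ and $g$ reduce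 to $0$ modulo $\mathcal G$; (iv) every $f\in\mathcal M$ has an admissible $\mathcal G$-representation: $f=f_1+\dots+f_r$, where each $f_j$ is obtained from some element of $\mathcal G$ by finitely many elementary shuffle compositions, on either side, with elements of $\mathcal F$, and $\mathrm{lt}(f)=\max_j\mathrm{lt}(f_j)$ (here $\mathrm{lt}(0)$ counts as smaller than every tree monomial, and $r=0$ is allowed). -/

import Mathlib

namespace ShuffleOperad

/-- Planar rooted trees whose leaves carry natural numbers and whose vertices carry elements `b : B`;
a vertex carrying `b` has `ar b ≥ 1` inputs, listed from left to right.  `leaf l` is the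
degenerate tree (no vertex) with the label `l`. -/
inductive PTree {B : Type*} (ar : B → ℕ+)
  | leaf (l : ℕ) : PTree ar
  | node (b : B) (c : Fin (ar b : ℕ) → PTree ar) : PTree ar

namespace PTree

variable {B : Type*} {ar : B → ℕ+}

/-- The multiset of leaf labels. -/
def leaves : PTree ar → Multiset ℕ
  | leaf l => {l}
  | node _ c => ∑ i, (c i).leaves

/-- The number of vertices. -/
def numVertices : PTree ar → ℕ
  | leaf _ => 0
  | node _ c => 1 + ∑ i, (c i).numVertices

/-- The smallest leaf label (every tree has a leaf). -/
noncomputable def minLeaf (t : PTree ar) : ℕ := sInf {l : ℕ | l ∈ t.leaves}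

/-- The planar structure is the canonical one: at every vertex the inputs are ordered by the smallest
leaf that can be reached through them. -/
def IsCanonical : PTree ar → Prop
  | leaf _ => True
  | node _ c => (∀ i, (c i).IsCanonical) ∧ StrictMono fun i => (c i).minLeaf

/-- Graft the tree `s l` onto every leaf labelled `l`. -/
def bind : PTree ar → (ℕ → PTree ar) → PTree ar
  | leaf l, s => s l
  | node b c, s => node b fun i => (c i).bind s

/-- Relabel the leaves. -/
def relabel (t : PTree ar) (ρ : ℕ → ℕ) : PTree ar := t.bind fun l => leaf (ρ l)

theorem leaves_ne_zero (t : PTree ar) : t.leaves ≠ 0 := by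
  induction t with
  | leaf l => simp [leaves]
  | node b c ih =>
    intro h
    have h0 := ih ⟨0, (ar b).pos⟩
    apply h0
    have h1 : (c ⟨0, (ar b).pos⟩).leaves ≤ ∑ i, (c i).leaves :=
      Finset.single_le_sum (f := fun i => (c i).leaves) (fun i _ => Multiset.zero_le _)
        (Finset.mem_univ _)
    rw [leaves] at h
    rw [h] at h1
    exact Multiset.le_zero.mp h1

theorem minLeaf_mem (t : PTree ar) : t.minLeaf ∈ t.leaves :=
  Nat.sInf_mem (s := {l : ℕ | l ∈ t.leaves}) (Multiset.exists_mem_of_ne_zero t.leaves_ne_zero)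

theorem minLeaf_le {t : PTree ar} {l : ℕ} (h : l ∈ t.leaves) : t.minLeaf ≤ l :=
  Nat.sInf_le (s := {l : ℕ | l ∈ t.leaves}) h

theorem mem_leaves_node {b : B} {c : Fin (ar b : ℕ) → PTree ar} {l : ℕ} :
    l ∈ (node b c).leaves ↔ ∃ i, l ∈ (c i).leaves := by
  simp [leaves, Multiset.mem_sum]

theorem leaves_bind (t : PTree ar) (s : ℕ → PTree ar) :
    (t.bind s).leaves = t.leaves.bind fun l => (s l).leaves := by
  induction t with
  | leaf l => simp [bind, leaves]
  | node b c ih =>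
    simp only [bind, leaves, ih]
    exact (map_sum (⟨⟨fun m : Multiset ℕ => m.bind fun l => (s l).leaves,
      Multiset.zero_bind _⟩, fun x y => Multiset.add_bind x y _⟩ : Multiset ℕ →+ Multiset ℕ)
      (fun i => (c i).leaves) Finset.univ).symm

theorem leaves_relabel (t : PTree ar) (ρ : ℕ → ℕ) : (t.relabel ρ).leaves = t.leaves.map ρ := by
  simp [relabel, leaves_bind, leaves, Multiset.bind_singleton]

theorem minLeaf_bind (t : PTree ar) (s : ℕ → PTree ar)
    (hs : StrictMonoOn (fun l => (s l).minLeaf) {l | l ∈ t.leaves}) :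
    (t.bind s).minLeaf = (s t.minLeaf).minLeaf := by
  apply le_antisymm
  · apply minLeaf_le
    rw [leaves_bind, Multiset.mem_bind]
    exact ⟨_, t.minLeaf_mem, minLeaf_mem _⟩
  · have h := (t.bind s).minLeaf_mem
    rw [leaves_bind, Multiset.mem_bind] at h
    obtain ⟨l, hl, h⟩ := h
    exact (hs.monotoneOn t.minLeaf_mem hl (minLeaf_le hl)).trans (minLeaf_le h)

theorem IsCanonical.bind {t : PTree ar} {s : ℕ → PTree ar} (ht : t.IsCanonical)
    (hc : ∀ l ∈ t.leaves, (s l).IsCanonical)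
    (hs : StrictMonoOn (fun l => (s l).minLeaf) {l | l ∈ t.leaves}) :
    (t.bind s).IsCanonical := by
  induction t with
  | leaf l => exact hc l (by simp [leaves])
  | node b c ih =>
    have hsub : ∀ i, {l | l ∈ (c i).leaves} ⊆ {l | l ∈ (node b c).leaves} :=
      fun i l hl => mem_leaves_node.2 ⟨i, hl⟩
    refine ⟨fun i => ih i (ht.1 i) (fun l hl => hc l (hsub i hl)) (hs.mono (hsub i)), ?_⟩
    intro i j hij
    simp only [minLeaf_bind _ s (hs.mono (hsub _))]
    exact hs (hsub i (minLeaf_mem _)) (hsub j (minLeaf_mem _)) (ht.2 hij)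

theorem IsCanonical.of_bind {t : PTree ar} {s : ℕ → PTree ar} (h : (t.bind s).IsCanonical) :
    ∀ l ∈ t.leaves, (s l).IsCanonical := by
  induction t with
  | leaf l => intro l' hl'; simp only [leaves, Multiset.mem_singleton] at hl'; subst hl'; exact h
  | node b c ih =>
    intro l hl
    obtain ⟨i, hi⟩ := mem_leaves_node.1 hl
    exact ih i (h.1 i) l hi

theorem minLeaf_congr {t t' : PTree ar} (h : t.leaves = t'.leaves) : t.minLeaf = t'.minLeaf := by
  simp only [minLeaf, h]

theorem IsCanonical.bind_congr {t : PTree ar} {s s' : ℕ → PTree ar}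
    (hl : ∀ l, (s l).leaves = (s' l).leaves)
    (hc : ∀ l ∈ t.leaves, (s l).IsCanonical → (s' l).IsCanonical) (h : (t.bind s).IsCanonical) :
    (t.bind s').IsCanonical := by
  induction t with
  | leaf l => exact hc l (by simp [leaves]) h
  | node b c ih =>
    refine ⟨fun i => ih i (fun l h' => hc l (mem_leaves_node.2 ⟨i, h'⟩)) (h.1 i), ?_⟩
    have key : ∀ i, ((c i).bind s').minLeaf = ((c i).bind s).minLeaf := fun i =>
      minLeaf_congr (by simp only [leaves_bind, hl])
    intro i j hij
    simp only [key]
    exact h.2 hij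

end PTree

/-- A tree monomial: a decorated tree in its canonical planar form, with `n` leaves that are labelled
bijectively by `{1, …, n}`.  These form a basis of the free shuffle operad on the collection whose
component in arity `n` has the basis `{b : B | ar b = n}`. -/
@[ext]
structure TreeMonomial {B : Type*} (ar : B → ℕ+) where
  tree : PTree ar
  isCanonical : tree.IsCanonical
  leaves_eq : tree.leaves = (Finset.Icc 1 tree.leaves.card).val

/-- The `(m - 1, n - i)`-shuffles `σ` of `{i + 1, …, n + m - 1}`, with `1 ≤ i ≤ n`; the bijection is
extended to `ℕ` by the identity. -/
structure Shuffle (n m i : ℕ) where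
  perm : Equiv.Perm ℕ
  one_le : 1 ≤ i
  le_arity : i ≤ n
  fixed : ∀ j, j ∉ Set.Icc (i + 1) (n + m - 1) → perm j = j
  mono_inner : StrictMonoOn perm (Set.Icc (i + 1) (i + m - 1))
  mono_outer : StrictMonoOn perm (Set.Icc (i + m) (n + m - 1))

namespace Shuffle

variable {n m i : ℕ}

theorem gt_of_gt (σ : Shuffle n m i) {j : ℕ} (hj : i < j) : i < σ.perm j := by
  by_contra h
  have h1 : σ.perm (σ.perm j) = σ.perm j :=
    σ.fixed _ (by simp only [Set.mem_Icc]; omega)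
  have := σ.perm.injective h1
  omega

theorem perm_of_le (σ : Shuffle n m i) {j : ℕ} (hj : j ≤ i) : σ.perm j = j :=
  σ.fixed _ (by simp only [Set.mem_Icc]; omega)

theorem mem_Icc (σ : Shuffle n m i) {j : ℕ} (hj : j ∈ Finset.Icc 1 (n + m - 1)) :
    σ.perm j ∈ Finset.Icc 1 (n + m - 1) := by
  by_cases h : σ.perm j ∈ Set.Icc (i + 1) (n + m - 1)
  · simp only [Set.mem_Icc] at h
    simp only [Finset.mem_Icc]
    omega
  · have h1 := σ.perm.injective (σ.fixed _ h)
    rwa [h1]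

theorem strictMonoOn_inner (σ : Shuffle n m i) :
    StrictMonoOn (fun l => σ.perm (i + l - 1)) (Set.Icc 1 m) := by
  intro a ha b hb hab
  simp only [Set.mem_Icc] at ha hb
  rcases Nat.lt_or_ge 1 a with h | h
  · exact σ.mono_inner (by simp only [Set.mem_Icc]; omega) (by simp only [Set.mem_Icc]; omega)
      (by omega)
  · have h1 : a = 1 := by omega
    subst h1
    have := σ.gt_of_gt (j := i + b - 1) (by omega)
    have h2 := σ.perm_of_le (j := i + 1 - 1) (by omega)
    simp only [h2]
    omega

end Shuffle

namespace TreeMonomial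

variable {B : Type*} {ar : B → ℕ+}

/-- The number of leaves. -/
def arity (α : TreeMonomial ar) : ℕ := α.tree.leaves.card

/-- The number of vertices of the underlying tree. -/
def numVertices (α : TreeMonomial ar) : ℕ := α.tree.numVertices

theorem leaves_eq_arity (α : TreeMonomial ar) : α.tree.leaves = (Finset.Icc 1 α.arity).val :=
  α.leaves_eq

theorem mem_leaves {α : TreeMonomial ar} {l : ℕ} : l ∈ α.tree.leaves ↔ 1 ≤ l ∧ l ≤ α.arity := by
  rw [leaves_eq_arity, Finset.mem_val, Finset.mem_Icc]

theorem one_le_arity (α : TreeMonomial ar) : 1 ≤ α.arity := by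
  have h := mem_leaves.1 α.tree.minLeaf_mem
  omega

/-- What is grafted onto the leaf `j` of `α` to form `α ∘_{i,σ} β`, that is, the operation
`α(x_1, …, x_{i-1}, β(x_i, x_{σ(i+1)}, …, x_{σ(i+m-1)}), x_{σ(i+m)}, …, x_{σ(n+m-1)})`. -/
def compBranch {n m i : ℕ} (σ : Shuffle n m i) (β : PTree ar) (j : ℕ) : PTree ar :=
  if j < i then .leaf j
  else if j = i then β.relabel fun l => σ.perm (i + l - 1)
  else .leaf (σ.perm (j + m - 1))

theorem minLeaf_leaf (l : ℕ) : (PTree.leaf l : PTree ar).minLeaf = l := by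
  simp [PTree.minLeaf, PTree.leaves]

theorem strictMonoOn_relabel {n m i : ℕ} (σ : Shuffle n m i) (β : TreeMonomial ar)
    (hβ : β.arity = m) :
    StrictMonoOn (fun l => (PTree.leaf (σ.perm (i + l - 1)) : PTree ar).minLeaf)
      {l | l ∈ β.tree.leaves} := by
  simp only [minLeaf_leaf]
  exact σ.strictMonoOn_inner.mono fun l hl => by
    have := mem_leaves.1 hl
    simp only [Set.mem_Icc]
    omega

theorem minLeaf_eq_one (β : TreeMonomial ar) : β.tree.minLeaf = 1 := by
  have h1 := mem_leaves.1 β.tree.minLeaf_mem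
  have h2 := PTree.minLeaf_le (mem_leaves.2 ⟨le_rfl, β.one_le_arity⟩)
  omega

theorem compBranch_minLeaf_self {n m i : ℕ} (σ : Shuffle n m i) (β : TreeMonomial ar)
    (hβ : β.arity = m) : (compBranch σ β.tree i).minLeaf = i := by
  have h := PTree.minLeaf_bind β.tree _ (strictMonoOn_relabel σ β hβ)
  simp only [compBranch, lt_irrefl, if_false, if_true, PTree.relabel]
  rw [h, minLeaf_leaf, minLeaf_eq_one, σ.perm_of_le (by omega)]
  omega

theorem comp_isCanonical {n m i : ℕ} (σ : Shuffle n m i) (α β : TreeMonomial ar)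
    (hα : α.arity = n) (hβ : β.arity = m) :
    (α.tree.bind (compBranch σ β.tree)).IsCanonical := by
  refine α.isCanonical.bind ?_ ?_
  · intro l _
    unfold compBranch
    split_ifs
    · trivial
    · exact β.isCanonical.bind (fun _ _ => trivial) (strictMonoOn_relabel σ β hβ)
    · trivial
  · intro a ha b hb hab
    have ha := mem_leaves.1 ha
    have hb := mem_leaves.1 hb
    have hm := β.one_le_arity
    have hself := compBranch_minLeaf_self σ β hβ
    have hlt : ∀ j, j < i → (compBranch σ β.tree j).minLeaf = j := fun j hj => by
      simp [compBranch, hj, minLeaf_leaf]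
    have hgt : ∀ j, i < j → (compBranch σ β.tree j).minLeaf = σ.perm (j + m - 1) := fun j hj => by
      simp [compBranch, not_lt_of_gt hj, hj.ne', minLeaf_leaf]
    rcases lt_trichotomy b i with h | h | h
    · simp only [hlt a (hab.trans h), hlt b h]; exact hab
    · subst h; simp only [hlt a hab, hself]; exact hab
    · have hb' := σ.gt_of_gt (j := b + m - 1) (by omega)
      rcases lt_trichotomy a i with h' | h' | h'
      · simp only [hlt a h', hgt b h]; omega
      · subst h'; simp only [hself, hgt b h]; omega
      · simp only [hgt a h', hgt b h]
        exact σ.mono_outer (by simp only [Set.mem_Icc]; omega)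
          (by simp only [Set.mem_Icc]; omega) (by omega)

theorem comp_leaves {n m i : ℕ} (σ : Shuffle n m i) (α β : TreeMonomial ar)
    (hα : α.arity = n) (hβ : β.arity = m) :
    (α.tree.bind (compBranch σ β.tree)).leaves = (Finset.Icc 1 (n + m - 1)).val := by
  have hm := β.one_le_arity
  have hi := σ.one_le
  have hin := σ.le_arity
  have hleaf : ∀ j, (compBranch σ β.tree j).leaves =
      (if j < i then ({j} : Multiset ℕ) else if j = i then
        (Finset.Icc i (i + m - 1)).val else {j + m - 1}).map σ.perm := by
    intro j
    unfold compBranch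
    split_ifs with h1 h2
    · simp [PTree.leaves, σ.perm_of_le h1.le]
    · rw [PTree.leaves_relabel, leaves_eq_arity, hβ]
      have : (Finset.Icc i (i + m - 1)).val = (Finset.Icc 1 m).val.map (fun l => i + l - 1) := by
        have hinj : Set.InjOn (fun l => i + l - 1) (Finset.Icc 1 m : Finset ℕ) := by
          intro a ha b hb hab
          simp only [Finset.coe_Icc, Set.mem_Icc] at ha hb hab
          omega
        rw [← Finset.image_val_of_injOn hinj]
        congr 1
        ext x
        simp only [Finset.mem_Icc, Finset.mem_image]
        constructor
        · intro h
          exact ⟨x - i + 1, by omega, by omega⟩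
        · rintro ⟨l, h, rfl⟩
          omega
      rw [this, Multiset.map_map]
      rfl
    · simp [PTree.leaves]
  have hperm : (Finset.Icc 1 (n + m - 1)).val.map σ.perm = (Finset.Icc 1 (n + m - 1)).val := by
    rw [← Finset.image_val_of_injOn σ.perm.injective.injOn]
    congr 1
    apply Finset.eq_of_subset_of_card_le
    · intro x hx
      obtain ⟨y, hy, rfl⟩ := Finset.mem_image.1 hx
      exact σ.mem_Icc hy
    · rw [Finset.card_image_of_injective _ σ.perm.injective]
  rw [PTree.leaves_bind, leaves_eq_arity, hα]
  simp only [hleaf]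
  rw [← Multiset.map_bind, ← hperm]
  congr 1
  have hnd : ((Finset.Icc 1 n).val.bind fun j => (if j < i then ({j} : Multiset ℕ) else if j = i then
        (Finset.Icc i (i + m - 1)).val else {j + m - 1})).Nodup := by
    rw [Multiset.nodup_bind]
    constructor
    · intro a _
      split_ifs
      · exact Multiset.nodup_singleton _
      · exact (Finset.Icc i (i + m - 1)).nodup
      · exact Multiset.nodup_singleton _
    · refine Multiset.Nodup.pairwise ?_ (Finset.Icc 1 n).nodup
      intro a ha b hb hab
      simp only [Function.onFun]
      rw [Multiset.disjoint_left]
      intro x hx hx'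
      split_ifs at hx hx' <;>
        simp only [Multiset.mem_singleton, Finset.mem_val, Finset.mem_Icc] at hx hx' <;> omega
  apply (Multiset.Nodup.ext hnd (Finset.nodup _)).2
  intro x
  simp only [Multiset.mem_bind, Finset.mem_val, Finset.mem_Icc]
  constructor
  · rintro ⟨j, hj, hx⟩
    split_ifs at hx <;>
      simp only [Multiset.mem_singleton, Finset.mem_val, Finset.mem_Icc] at hx <;> omega
  · intro hx
    rcases Nat.lt_or_ge x i with h | h
    · exact ⟨x, by omega, by simp [h]⟩
    · rcases Nat.lt_or_ge (i + m - 1) x with h' | h'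
      · refine ⟨x - (m - 1), by omega, ?_⟩
        rw [if_neg (by omega), if_neg (by omega), Multiset.mem_singleton]
        omega
      · refine ⟨i, by omega, ?_⟩
        rw [if_neg (by omega), if_pos rfl, Finset.mem_val, Finset.mem_Icc]
        omega

/-- The elementary shuffle composition `α ∘_{i,σ} β` of tree monomials of arities `n` and `m`. -/
def comp {n m i : ℕ} (σ : Shuffle n m i) (α β : TreeMonomial ar)
    (hα : α.arity = n) (hβ : β.arity = m) : TreeMonomial ar where
  tree := α.tree.bind (compBranch σ β.tree)
  isCanonical := comp_isCanonical σ α β hα hβ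
  leaves_eq := by rw [comp_leaves σ α β hα hβ]; simp

/-- An occurrence of the tree monomial `β` as a subtree of `α`.  The tree `upper` is `α` with
everything above the output edge of the subtree cut off and replaced by a single leaf with the
auxiliary label `0`; the trees `branch 1, …, branch n` sit on the leaves `1, …, n` of the subtree.
The leaves of the subtree are numbered by their smallest descendants, whence the monotonicity. -/
structure Occurrence (α β : TreeMonomial ar) where
  upper : PTree ar
  count_hole : upper.leaves.count 0 = 1
  branch : ℕ → PTree ar
  mono : StrictMonoOn (fun l => (branch l).minLeaf) (Set.Icc 1 β.arity)
  eq : α.tree = upper.bind fun l => if l = 0 then β.tree.bind branch else .leaf l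

/-- `β` divides `α`. -/
def Divides (β α : TreeMonomial ar) : Prop := Nonempty (Occurrence α β)

namespace Occurrence

variable {α β : TreeMonomial ar}

theorem replace_leaves (o : Occurrence α β) (γ : TreeMonomial ar) (h : γ.arity = β.arity) (l : ℕ) :
    (if l = 0 then β.tree.bind o.branch else .leaf l : PTree ar).leaves =
      (if l = 0 then γ.tree.bind o.branch else .leaf l : PTree ar).leaves := by
  split_ifs
  · rw [PTree.leaves_bind, PTree.leaves_bind, leaves_eq_arity, leaves_eq_arity, h]
  · rfl

/-- The operation `m_{α,β}` on tree monomials `γ` of the same arity as `β`: in `α`, the given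
occurrence of `β` is replaced by `γ`. -/
def replaceMonomial (o : Occurrence α β) (γ : TreeMonomial ar) (h : γ.arity = β.arity) :
    TreeMonomial ar where
  tree := o.upper.bind fun l => if l = 0 then γ.tree.bind o.branch else .leaf l
  isCanonical := by
    refine PTree.IsCanonical.bind_congr (s := fun l => if l = 0 then β.tree.bind o.branch else .leaf l)
      (o.replace_leaves γ h) ?_ (o.eq ▸ α.isCanonical)
    intro l _ hl
    split_ifs with h0
    · simp only [h0, if_true] at hl
      refine γ.isCanonical.bind (fun j hj => hl.of_bind j ?_) (o.mono.mono fun j hj => ?_)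
      · rw [mem_leaves] at hj ⊢
        omega
      · have := mem_leaves.1 hj
        simp only [Set.mem_Icc]
        omega
    · trivial
  leaves_eq := by
    have : (o.upper.bind fun l => if l = 0 then γ.tree.bind o.branch else .leaf l).leaves =
        α.tree.leaves := by
      rw [o.eq, PTree.leaves_bind, PTree.leaves_bind]
      congr 1
      funext l
      exact (o.replace_leaves γ h l).symm
    rw [this]
    exact α.leaves_eq

end Occurrence

/-- Admissible orderings of tree monomials: tree monomials of smaller arity are smaller, and the
elementary shuffle compositions are monotone in both arguments. -/
structure IsAdmissible (ar : B → ℕ+) [LinearOrder (TreeMonomial ar)] : Prop where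
  lt_of_arity_lt : ∀ α β : TreeMonomial ar, α.arity < β.arity → α < β
  comp_le_comp : ∀ (n m i : ℕ) (σ : Shuffle n m i) (α α' β β' : TreeMonomial ar)
    (hα : α.arity = n) (hα' : α'.arity = n) (hβ : β.arity = m) (hβ' : β'.arity = m),
    α ≤ α' → β ≤ β' → comp σ α β hα hβ ≤ comp σ α' β' hα' hβ'

end TreeMonomial

/-- (The total space of) the free shuffle operad over `K`: the linear combinations of tree
monomials.  Its component of arity `n` is spanned by the tree monomials of arity `n`. -/
abbrev FreeOperad (K : Type*) [Field K] {B : Type*} (ar : B → ℕ+) := TreeMonomial ar →₀ K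

namespace FreeOperad

variable {K : Type*} [Field K] {B : Type*} {ar : B → ℕ+}

/-- All tree monomials of `f` have the same arity. -/
def IsHomogeneous (f : FreeOperad K ar) : Prop := ∃ n, ∀ α ∈ f.support, α.arity = n

open Classical in
/-- The component of arity `n` of `f`. -/
noncomputable def component (n : ℕ) (f : FreeOperad K ar) : FreeOperad K ar :=
  f.filter fun α => α.arity = n

open Classical in
/-- The elementary shuffle composition `f ∘_{i,σ} g`, bilinear in `f` of arity `n` and `g` of arity `m`
(and extended by zero to the other components). -/
noncomputable def comp {n m i : ℕ} (σ : Shuffle n m i) (f g : FreeOperad K ar) : FreeOperad K ar :=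
  Finsupp.linearCombination K (fun α => Finsupp.linearCombination K (fun β =>
    if h : α.arity = n ∧ β.arity = m then
      (Finsupp.single (TreeMonomial.comp σ α β h.1 h.2) 1 : FreeOperad K ar) else 0) g) f

open Classical in
/-- The linear extension of `m_{α,β}` to the component whose arity is that of `β`
(and by zero to the other components). -/
noncomputable def replace {α β : TreeMonomial ar} (o : α.Occurrence β) (f : FreeOperad K ar) :
    FreeOperad K ar :=
  Finsupp.linearCombination K (fun γ => if h : γ.arity = β.arity then
    (Finsupp.single (o.replaceMonomial γ h) 1 : FreeOperad K ar) else 0) f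

/-- Operadic ideals: graded subspaces that are closed under shuffle compositions, on either side, with
arbitrary elements. -/
structure IsIdeal (M : Submodule K (FreeOperad K ar)) : Prop where
  component_mem : ∀ (n : ℕ), ∀ f ∈ M, component n f ∈ M
  comp_mem_left : ∀ (n m i : ℕ) (σ : Shuffle n m i), ∀ f ∈ M, ∀ h : FreeOperad K ar, comp σ f h ∈ M
  comp_mem_right : ∀ (n m i : ℕ) (σ : Shuffle n m i), ∀ f ∈ M, ∀ h : FreeOperad K ar, comp σ h f ∈ M

/-- `M` is an operadic ideal generated by `G`: the smallest one that contains `G`. -/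
def IsGeneratedBy (M : Submodule K (FreeOperad K ar)) (G : Set (FreeOperad K ar)) : Prop :=
  IsLeast {N : Submodule K (FreeOperad K ar) | IsIdeal N ∧ G ⊆ N} M

/-- `ObtainedFrom g f`: the element `f` is obtained from `g` by finitely many elementary shuffle
compositions, on either side, with elements of the free operad. -/
inductive ObtainedFrom (g : FreeOperad K ar) : FreeOperad K ar → Prop
  | self : ObtainedFrom g g
  | comp_left {n m i : ℕ} (σ : Shuffle n m i) (f h : FreeOperad K ar) :
      ObtainedFrom g f → ObtainedFrom g (comp σ f h)
  | comp_right {n m i : ℕ} (σ : Shuffle n m i) (f h : FreeOperad K ar) :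
      ObtainedFrom g f → ObtainedFrom g (comp σ h f)

variable [LinearOrder (TreeMonomial ar)]

/-- The leading term of `f`; it is `⊥` if and only if `f = 0`. -/
def leadTerm (f : FreeOperad K ar) : WithBot (TreeMonomial ar) := f.support.max

/-- `h` is a reduction `f - (c_f / c_g) m_{lt f, lt g}(g)` of `f` modulo some `g` in `G`. -/
def IsReduction (G : Set (FreeOperad K ar)) (f h : FreeOperad K ar) : Prop :=
  ∃ g ∈ G, ∃ α β : TreeMonomial ar, leadTerm f = α ∧ leadTerm g = β ∧
    ∃ o : α.Occurrence β, h = f - (f α / g β) • replace o g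

/-- A finite (possibly empty) sequence of reductions modulo elements of `G` leads from `f` to `0`. -/
def ReducesToZero (G : Set (FreeOperad K ar)) (f : FreeOperad K ar) : Prop :=
  Relation.ReflTransGen (IsReduction G) f 0

/-- `s` is an S-polynomial of `f` and `g`: the one that belongs to a small common multiple `γ` of the
leading terms of `f` and `g` and to occurrences of these leading terms in `γ`. -/
def IsSPolynomial (f g s : FreeOperad K ar) : Prop :=
  ∃ α β γ : TreeMonomial ar, leadTerm f = α ∧ leadTerm g = β ∧
    γ.numVertices < α.numVertices + β.numVertices ∧
    ∃ (o₁ : γ.Occurrence α) (o₂ : γ.Occurrence β),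
      s = replace o₁ f - (f α / g β) • replace o₂ g

/-- The leading term of every nonzero element of `M` is divisible by the leading term of a (nonzero)
element of `G`. -/
def IsGroebnerBasis (G : Set (FreeOperad K ar)) (M : Submodule K (FreeOperad K ar)) : Prop :=
  ∀ f ∈ M, f ≠ 0 → ∃ g ∈ G, ∃ α β : TreeMonomial ar,
    leadTerm f = α ∧ leadTerm g = β ∧ β.Divides α

/-- `f = f_1 + … + f_r` with each `f_k` obtained from an element of `G` by shuffle compositions, and
`lt f` is the maximum of the `lt f_k`. -/
def HasAdmissibleRepresentation (G : Set (FreeOperad K ar)) (f : FreeOperad K ar) : Prop :=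
  ∃ (r : ℕ) (F : Fin r → FreeOperad K ar), (∀ k, ∃ g ∈ G, ObtainedFrom g (F k)) ∧
    f = ∑ k, F k ∧ leadTerm f = Finset.univ.sup fun k => leadTerm (F k)

end FreeOperad

end ShuffleOperad

/-! The implications out of (i) are division with remainder: subtracting a multiple of `m_{lt f, lt
g}(g)` lowers the leading term strictly, and the ordering is a well-ordering (`exists_reduction`).
For (ii) → (iii), S-polynomials lie in the ideal. For (iv) → (i), the maximum of the `lt f_j` is
attained, and the leading term of a nonzero element obtained from `g` by compositions is divisible
by `lt g` (`homogeneous_and_divides`).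

The core is (iii) → (i). The ideal lies in the linear span of the elements `m_{α, lt g}(g)`
(`le_replaceSpan`), because a composition of such an element with a tree monomial is zero or again
of this form. Given a nonzero `f` in the ideal, choose `α` minimal such that `f` is a combination of
such elements with leading terms at most `α`. Any two of these elements with leading term exactly
`α` are proportional modulo elements of the same kind with smaller leading terms
(`smul_sub_smul_mem_replaceSpan`). Hence `f` is a multiple of a single `m_{α, lt g}(g)` plus smaller
terms; the multiple is nonzero by minimality, so `lt f = α` is divisible by `lt g`.

Proportionality comes from a dichotomy for two occurrences in `α` (`isIndependent_or_isSmall`). If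
they share no vertex, both can be replaced at once, and the double sum over the terms of the two
elements agrees with either side up to smaller terms. If they share a vertex, their union is a small
common multiple `γ` occurring in `α`; the corresponding S-polynomial reduces to zero, and `m_{α,γ}`
carries the resulting representation from below `γ` to below `α`.

Throughout, `m_{α,β}` has to be strictly monotone, whereas admissibility only speaks of elementary
compositions and only gives `≤`. So `m_{α,β}` is written as a composite of elementary shuffle
compositions (`exists_composite`, with the shuffles supplied by `exists_shuffle`), and strictness
follows from its injectivity. -/

namespace ShuffleOperad

open Function

/-! ### Grafting and relabelling of planar trees. -/

namespace PTree

variable {B : Type*} {ar : B → ℕ+}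

theorem leaves_leaf (l : ℕ) : (leaf l : PTree ar).leaves = {l} := rfl

theorem bind_leaf (t : PTree ar) : t.bind leaf = t := by
  induction t with
  | leaf l => rfl
  | node b c ih => simp only [bind, ih]

theorem bind_bind (t : PTree ar) (s s' : ℕ → PTree ar) :
    (t.bind s).bind s' = t.bind fun l => (s l).bind s' := by
  induction t with
  | leaf l => rfl
  | node b c ih => simp only [bind, ih]

theorem bind_congr_of_mem {t : PTree ar} {s s' : ℕ → PTree ar} (h : ∀ l ∈ t.leaves, s l = s' l) :
    t.bind s = t.bind s' := by
  induction t with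
  | leaf l => exact h l (by simp [leaves])
  | node b c ih =>
    simp only [bind, node.injEq, heq_eq_eq, true_and]
    funext i
    exact ih i fun l hl => h l (mem_leaves_node.2 ⟨i, hl⟩)

theorem eq_of_bind_eq {t : PTree ar} {s s' : ℕ → PTree ar} (h : t.bind s = t.bind s') :
    ∀ l ∈ t.leaves, s l = s' l := by
  induction t with
  | leaf l => intro l' hl'; simp only [leaves, Multiset.mem_singleton] at hl'; subst hl'; exact h
  | node b c ih =>
    intro l hl
    obtain ⟨i, hi⟩ := mem_leaves_node.1 hl
    simp only [bind, node.injEq, heq_eq_eq, true_and] at h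
    exact ih i (congrFun h i) l hi

theorem mem_leaves_bind {t : PTree ar} {s : ℕ → PTree ar} {x : ℕ} :
    x ∈ (t.bind s).leaves ↔ ∃ l ∈ t.leaves, x ∈ (s l).leaves := by
  rw [leaves_bind, Multiset.mem_bind]

theorem numVertices_bind (t : PTree ar) (s : ℕ → PTree ar) :
    (t.bind s).numVertices = t.numVertices + (t.leaves.map fun l => (s l).numVertices).sum := by
  induction t with
  | leaf l => simp [bind, leaves, numVertices]
  | node b c ih =>
    simp only [bind, numVertices, leaves, ih, Finset.sum_add_distrib, add_assoc]
    congr 2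
    exact (map_sum (⟨⟨fun m : Multiset ℕ => (m.map fun l => (s l).numVertices).sum, by simp⟩,
      fun x y => by simp⟩ : Multiset ℕ →+ ℕ) (fun i => (c i).leaves) Finset.univ).symm

theorem numVertices_relabel (t : PTree ar) (ρ : ℕ → ℕ) :
    (t.relabel ρ).numVertices = t.numVertices := by
  simp [relabel, numVertices_bind, numVertices]

theorem relabel_bind (t : PTree ar) (ρ : ℕ → ℕ) (s : ℕ → PTree ar) :
    (t.relabel ρ).bind s = t.bind fun l => s (ρ l) := by
  rw [relabel, bind_bind]; rfl

theorem bind_relabel (t : PTree ar) (s : ℕ → PTree ar) (ρ : ℕ → ℕ) :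
    (t.bind s).relabel ρ = t.bind fun l => (s l).relabel ρ := by
  rw [relabel, bind_bind]; rfl

theorem relabel_relabel (t : PTree ar) (ρ ρ' : ℕ → ℕ) :
    (t.relabel ρ).relabel ρ' = t.relabel fun l => ρ' (ρ l) := by
  rw [relabel, relabel_bind]; rfl

theorem relabel_congr {t : PTree ar} {ρ ρ' : ℕ → ℕ} (h : ∀ l ∈ t.leaves, ρ l = ρ' l) :
    t.relabel ρ = t.relabel ρ' :=
  bind_congr_of_mem fun l hl => by rw [h l hl]

theorem relabel_eq_self {t : PTree ar} {ρ : ℕ → ℕ} (h : ∀ l ∈ t.leaves, ρ l = l) :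
    t.relabel ρ = t := by
  conv_rhs => rw [← bind_leaf t]
  exact bind_congr_of_mem fun l hl => by rw [h l hl]

theorem mem_leaves_relabel {t : PTree ar} {ρ : ℕ → ℕ} {x : ℕ} :
    x ∈ (t.relabel ρ).leaves ↔ ∃ l ∈ t.leaves, ρ l = x := by
  rw [leaves_relabel, Multiset.mem_map]

theorem minLeaf_leaf (l : ℕ) : (leaf l : PTree ar).minLeaf = l := by
  simp [minLeaf, leaves]

theorem minLeaf_relabel {t : PTree ar} {ρ : ℕ → ℕ} (h : StrictMonoOn ρ {l | l ∈ t.leaves}) :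
    (t.relabel ρ).minLeaf = ρ t.minLeaf := by
  rw [relabel, minLeaf_bind _ _ (by simpa only [minLeaf_leaf] using h), minLeaf_leaf]

theorem minLeaf_bind_le_of_le {t : PTree ar} {s s' : ℕ → PTree ar}
    (h : ∀ l ∈ t.leaves, (s l).minLeaf ≤ (s' l).minLeaf) :
    (t.bind s).minLeaf ≤ (t.bind s').minLeaf := by
  obtain ⟨l, hl, hx⟩ := mem_leaves_bind.1 (minLeaf_mem (t.bind s'))
  exact (minLeaf_le (mem_leaves_bind.2 ⟨l, hl, minLeaf_mem _⟩)).trans ((h l hl).trans (minLeaf_le hx))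

theorem minLeaf_bind_congr {t : PTree ar} {s s' : ℕ → PTree ar}
    (h : ∀ l ∈ t.leaves, (s l).minLeaf = (s' l).minLeaf) :
    (t.bind s).minLeaf = (t.bind s').minLeaf :=
  le_antisymm (minLeaf_bind_le_of_le fun l hl => (h l hl).le)
    (minLeaf_bind_le_of_le fun l hl => (h l hl).ge)

/-- The ordering condition at the vertices of `t` sees a branch only through its smallest leaf, so
branches may be exchanged for bare leaves and back. -/
theorem IsCanonical.bind_congr_minLeaf {t : PTree ar} {s s' : ℕ → PTree ar}
    (hm : ∀ l ∈ t.leaves, (s l).minLeaf = (s' l).minLeaf)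
    (hc : ∀ l ∈ t.leaves, (s' l).IsCanonical) (h : (t.bind s).IsCanonical) :
    (t.bind s').IsCanonical := by
  induction t with
  | leaf l => exact hc l (by simp [leaves])
  | node b c ih =>
    have hsub : ∀ i, ∀ l ∈ (c i).leaves, l ∈ (node b c).leaves :=
      fun i l hl => mem_leaves_node.2 ⟨i, hl⟩
    refine ⟨fun i => ih i (fun l hl => hm l (hsub i l hl)) (fun l hl => hc l (hsub i l hl)) (h.1 i),
      ?_⟩
    intro i j hij
    have := h.2 hij
    simp only at this ⊢
    rwa [← minLeaf_bind_congr fun l hl => hm l (hsub i l hl),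
      ← minLeaf_bind_congr fun l hl => hm l (hsub j l hl)]

theorem IsCanonical.relabel {t : PTree ar} (ht : t.IsCanonical) {ρ : ℕ → ℕ}
    (h : StrictMonoOn ρ {l | l ∈ t.leaves}) : (t.relabel ρ).IsCanonical :=
  ht.bind (fun _ _ => trivial) (by simpa only [minLeaf_leaf] using h)

/-- A label occurring twice in `t` would receive the same nonempty branch twice. -/
theorem nodup_of_bind {t : PTree ar} {s : ℕ → PTree ar} (h : (t.bind s).leaves.Nodup) :
    t.leaves.Nodup := by
  rw [Multiset.nodup_iff_count_le_one]
  intro l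
  by_contra! h2
  have hle : ({l, l} : Multiset ℕ) ≤ t.leaves := by
    rw [show ({l, l} : Multiset ℕ) = Multiset.replicate 2 l from rfl,
      ← Multiset.le_count_iff_replicate_le]
    exact h2
  obtain ⟨r, hr⟩ := Multiset.le_iff_exists_add.1 hle
  rw [leaves_bind, hr, Multiset.add_bind] at h
  have h3 := (Multiset.nodup_add.1 h).1
  simp only [Multiset.insert_eq_cons, Multiset.cons_bind, Multiset.singleton_bind] at h3
  exact Multiset.disjoint_left.1 (Multiset.nodup_add.1 h3).2.2 (minLeaf_mem (s l)) (minLeaf_mem _)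

theorem nodup_branch {t : PTree ar} {s : ℕ → PTree ar} (h : (t.bind s).leaves.Nodup) {l : ℕ}
    (hl : l ∈ t.leaves) : (s l).leaves.Nodup := by
  rw [leaves_bind, Multiset.nodup_bind] at h
  exact h.1 l hl

theorem branch_disjoint {t : PTree ar} {s : ℕ → PTree ar} (h : (t.bind s).leaves.Nodup) {l l' : ℕ}
    (hl : l ∈ t.leaves) (hl' : l' ∈ t.leaves) {x : ℕ} (hx : x ∈ (s l).leaves)
    (hx' : x ∈ (s l').leaves) : l = l' := by
  by_contra hne
  obtain ⟨r, hr⟩ := Multiset.exists_cons_of_mem hl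
  have h1 : l' ∈ r := by
    rw [hr, Multiset.mem_cons] at hl'
    exact hl'.resolve_left (Ne.symm hne)
  obtain ⟨r', hr'⟩ := Multiset.exists_cons_of_mem h1
  rw [leaves_bind, hr, hr', Multiset.cons_bind, Multiset.cons_bind] at h
  exact Multiset.disjoint_left.1 (Multiset.nodup_add.1 h).2.2 hx
    (Multiset.mem_add.2 (Or.inl hx'))

theorem nodup_child {b : B} {c : Fin (ar b : ℕ) → PTree ar} (h : (node b c).leaves.Nodup)
    (i : Fin (ar b : ℕ)) : (c i).leaves.Nodup :=
  Multiset.nodup_of_le (Finset.single_le_sum (f := fun i => (c i).leaves)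
    (fun _ _ => Multiset.zero_le _) (Finset.mem_univ i)) h

theorem child_disjoint {b : B} {c : Fin (ar b : ℕ) → PTree ar} (h : (node b c).leaves.Nodup)
    {i j : Fin (ar b : ℕ)} {x : ℕ} (hi : x ∈ (c i).leaves) (hj : x ∈ (c j).leaves) : i = j := by
  by_contra hne
  have h1 : (c i).leaves + (c j).leaves ≤ (node b c).leaves := by
    rw [leaves, ← Finset.sum_pair hne (f := fun i => (c i).leaves)]
    exact Finset.sum_le_sum_of_subset (Finset.subset_univ _)
  exact Multiset.disjoint_left.1 (Multiset.nodup_add.1 (Multiset.nodup_of_le h1 h)).2.2 hi hj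

theorem numVertices_le_bind (t : PTree ar) (s : ℕ → PTree ar) {l : ℕ} (hl : l ∈ t.leaves) :
    t.numVertices + (s l).numVertices ≤ (t.bind s).numVertices := by
  rw [numVertices_bind]
  exact Nat.add_le_add_left (Multiset.single_le_sum (fun _ _ => Nat.zero_le _) _
    (Multiset.mem_map_of_mem (fun l => (s l).numVertices) hl)) _

/-- Equality would force `l` to be a leaf of the tree with root `b`, so that the grafted tree would
contain `s l` together with at least one further vertex. -/
theorem bind_ne_branch {b : B} {c : Fin (ar b : ℕ) → PTree ar} {s : ℕ → PTree ar} {l : ℕ}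
    (h : ∀ l' ∈ (node b c).leaves, ∀ x ∈ (s l).leaves, x ∈ (s l').leaves → l = l') :
    s l ≠ (node b c).bind s := by
  intro heq
  have hm := minLeaf_mem (node b c)
  have : l = (node b c).minLeaf := by
    refine h _ hm _ ?_ (minLeaf_mem (s (node b c).minLeaf))
    rw [heq]
    exact mem_leaves_bind.2 ⟨_, hm, minLeaf_mem _⟩
  rw [← this] at hm
  have h1 := numVertices_le_bind _ s hm
  rw [← heq, numVertices] at h1
  omega

/-- Branches with disjoint leaf sets reveal where the tree ends and the branch begins;
`bind_ne_branch` excludes that one tree ends earlier than the other. -/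
theorem bind_injective {s : ℕ → PTree ar} {t t' : PTree ar}
    (hs : ∀ l ∈ t.leaves, ∀ l' ∈ t'.leaves, ∀ x ∈ (s l).leaves, x ∈ (s l').leaves → l = l')
    (h : t.bind s = t'.bind s) : t = t' := by
  induction t generalizing t' with
  | leaf l =>
    cases t' with
    | leaf l' =>
      have h : s l = s l' := h
      rw [hs l (by simp [leaves]) l' (by simp [leaves]) _ (minLeaf_mem _) (h ▸ minLeaf_mem _)]
    | node b c => exact absurd h (bind_ne_branch (hs l (by simp [leaves])))
  | node b c ih =>
    cases t' with
    | leaf l =>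
      refine absurd h.symm (bind_ne_branch fun l' hl' x hx hx' => ?_)
      exact (hs l' hl' l (by simp [leaves]) x hx' hx).symm
    | node b' c' =>
      simp only [bind, node.injEq] at h
      obtain ⟨rfl, h⟩ := h
      simp only [heq_eq_eq] at h
      congr 1
      funext i
      exact ih i (fun l hl l' hl' => hs l (mem_leaves_node.2 ⟨i, hl⟩) l'
        (mem_leaves_node.2 ⟨i, hl'⟩)) (congrFun h i)

theorem bind_injective_of_nodup {s : ℕ → PTree ar} {t t' : PTree ar}
    (hl : t.leaves = t'.leaves) (hn : (t.bind s).leaves.Nodup) (h : t.bind s = t'.bind s) :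
    t = t' :=
  bind_injective (fun _ h1 _ h2 _ h3 h4 => branch_disjoint hn h1 (hl ▸ h2) h3 h4) h

theorem exists_leaf_of_numVertices_eq_zero {t : PTree ar} (h : t.numVertices = 0) :
    ∃ l, t = leaf l := by
  cases t with
  | leaf l => exact ⟨l, rfl⟩
  | node b c => rw [numVertices] at h; omega

end PTree

namespace TreeMonomial

variable {B : Type*} {ar : B → ℕ+}

theorem leaves_nodup (α : TreeMonomial ar) : α.tree.leaves.Nodup := by
  rw [leaves_eq_arity]; exact Finset.nodup _

theorem leaves_eq_of_arity_eq {α β : TreeMonomial ar} (h : α.arity = β.arity) :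
    α.tree.leaves = β.tree.leaves := by
  rw [leaves_eq_arity, leaves_eq_arity, h]

theorem zero_notMem_leaves (α : TreeMonomial ar) : 0 ∉ α.tree.leaves := by
  rw [mem_leaves]; omega

end TreeMonomial

/-! ### Increasing enumerations and standardization of leaf labels. -/

theorem exists_enumeration (s : Finset ℕ) : ∃ e r : ℕ → ℕ,
    StrictMonoOn e (Set.Icc 1 s.card) ∧ StrictMonoOn r s ∧
    (∀ l ∈ Set.Icc 1 s.card, e l ∈ s ∧ r (e l) = l) ∧
    ∀ x ∈ s, r x ∈ Set.Icc 1 s.card ∧ e (r x) = x := by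
  let f := s.orderIsoOfFin rfl
  let e : ℕ → ℕ := fun l => if h : l - 1 < s.card then f ⟨l - 1, h⟩ else 0
  let r : ℕ → ℕ := fun x => if h : x ∈ s then (f.symm ⟨x, h⟩ : ℕ) + 1 else 0
  have he : ∀ l ∈ Set.Icc 1 s.card, ∃ h : l - 1 < s.card, e l = f ⟨l - 1, h⟩ := fun l hl => by
    have h : l - 1 < s.card := by have := hl.1; have := hl.2; omega
    exact ⟨h, by simp [e, h]⟩
  have hr : ∀ x, ∀ h : x ∈ s, r x = (f.symm ⟨x, h⟩ : ℕ) + 1 := fun x h => by simp [r, h]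
  have h1 : ∀ x ∈ s, r x ∈ Set.Icc 1 s.card := fun x hx => by
    rw [hr x hx]
    have := (f.symm ⟨x, hx⟩).2
    exact ⟨by omega, by omega⟩
  refine ⟨e, r, ?_, ?_, ?_, ?_⟩
  · intro a ha b hb hab
    obtain ⟨h, e1⟩ := he a ha
    obtain ⟨h', e2⟩ := he b hb
    rw [e1, e2]
    have := ha.1
    exact f.strictMono (by rw [Fin.mk_lt_mk]; omega)
  · intro a ha b hb hab
    rw [hr a ha, hr b hb]
    have : f.symm ⟨a, ha⟩ < f.symm ⟨b, hb⟩ := f.symm.strictMono hab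
    exact Nat.succ_lt_succ this
  · intro l hl
    obtain ⟨h, e1⟩ := he l hl
    rw [e1]
    refine ⟨(f _).2, ?_⟩
    rw [hr _ (f _).2]
    simp only [Subtype.coe_eta, OrderIso.symm_apply_apply]
    have := hl.1
    omega
  · intro x hx
    refine ⟨h1 x hx, ?_⟩
    obtain ⟨h, e1⟩ := he _ (h1 x hx)
    rw [e1]
    have : (⟨r x - 1, h⟩ : Fin s.card) = f.symm ⟨x, hx⟩ := by
      apply Fin.ext
      simp [hr x hx]
    rw [this, OrderIso.apply_symm_apply]

/-- Every canonical tree with distinct labels arises from a tree monomial by an increasing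
relabelling. -/
theorem PTree.exists_standardization {B : Type*} {ar : B → ℕ+} {t : PTree ar} (hc : t.IsCanonical)
    (hn : t.leaves.Nodup) : ∃ (γ : TreeMonomial ar) (e r : ℕ → ℕ),
      γ.tree = t.relabel r ∧ t = γ.tree.relabel e ∧ StrictMonoOn e (Set.Icc 1 γ.arity) ∧
      StrictMonoOn r {x | x ∈ t.leaves} ∧
      (∀ l ∈ Set.Icc 1 γ.arity, e l ∈ t.leaves ∧ r (e l) = l) ∧
      ∀ x ∈ t.leaves, r x ∈ Set.Icc 1 γ.arity ∧ e (r x) = x := by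
  obtain ⟨e, r, he, hr, h1, h2⟩ := exists_enumeration ⟨t.leaves, hn⟩
  simp only [Finset.card_mk, Finset.mem_mk] at he h1 h2
  have hr' : StrictMonoOn r {x | x ∈ t.leaves} := hr
  have hl : (t.relabel r).leaves = (Finset.Icc 1 t.leaves.card).val := by
    rw [PTree.leaves_relabel]
    refine (Multiset.Nodup.ext (hn.map_on fun x hx y hy hxy => hr'.injOn hx hy hxy)
      (Finset.nodup _)).2 fun x => ?_
    simp only [Multiset.mem_map, Finset.mem_val, Finset.mem_Icc]
    constructor
    · rintro ⟨y, hy, rfl⟩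
      exact (h2 y hy).1
    · intro hx
      exact ⟨e x, h1 x hx⟩
  have hcard : (t.relabel r).leaves.card = t.leaves.card := by simp [hl]
  refine ⟨⟨t.relabel r, hc.relabel hr', by rw [hcard, hl]⟩, e, r, rfl, ?_, ?_, hr', ?_, ?_⟩
  · rw [relabel_relabel]
    exact (relabel_eq_self fun x hx => (h2 x hx).2).symm
  · simpa only [TreeMonomial.arity, hcard] using he
  · simpa only [TreeMonomial.arity, hcard] using h1
  · simpa only [TreeMonomial.arity, hcard] using h2

end ShuffleOperad

/-! ### Shuffles determined by two increasing labellings. -/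

namespace ShuffleOperad

open Function

/-- Two trees whose leaves are labelled by `eA` and `eB`, with one common label that is the smallest
of the second tree, can be grafted. Ranking the `n + m - 1` labels in their union yields the
shuffle, and `e` enumerates this union. The labels of `eB` are at least `eA i`, so the first `i`
ranks go to `eA 1, …, eA i`, as a shuffle requires. -/
theorem exists_shuffle {n m i : ℕ} (hi : 1 ≤ i) (hin : i ≤ n) (hm : 1 ≤ m) {eA eB : ℕ → ℕ}
    (hA : StrictMonoOn eA (Set.Icc 1 n)) (hB : StrictMonoOn eB (Set.Icc 1 m))
    (h0 : eA i = eB 1)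
    (hAB : ∀ j ∈ Set.Icc 1 n, ∀ l ∈ Set.Icc 1 m, eA j = eB l → j = i) :
    ∃ (σ : Shuffle n m i) (e : ℕ → ℕ), StrictMonoOn e (Set.Icc 1 (n + m - 1)) ∧
      (∀ l ∈ Set.Icc 1 m, e (σ.perm (i + l - 1)) = eB l) ∧
      (∀ j ∈ Set.Ioc i n, e (σ.perm (j + m - 1)) = eA j) ∧
      ∀ j, 1 ≤ j → j < i → e j = eA j := by
  classical
  let A := (Finset.Icc 1 n).image eA
  -- The index starts at 2 because `eB 1 = eA i` is already counted in `A`.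
  let D := (Finset.Icc 2 m).image eB
  let C := A ∪ D
  have hmA : ∀ {j}, 1 ≤ j → j ≤ n → eA j ∈ C := fun h1 h2 =>
    Finset.mem_union_left _ (Finset.mem_image_of_mem _ (Finset.mem_Icc.2 ⟨h1, h2⟩))
  have hmB : ∀ {j}, 1 ≤ j → j ≤ m → eB j ∈ C := fun {j} h1 h2 => by
    rcases Nat.lt_or_ge 1 j with h | h
    · exact Finset.mem_union_right _ (Finset.mem_image_of_mem _ (Finset.mem_Icc.2 ⟨h, h2⟩))
    · rw [show j = 1 by omega, ← h0]; exact hmA hi hin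
  have hBmono : ∀ {j k}, 1 ≤ j → k ≤ m → j < k → eB j < eB k := fun h1 h2 h =>
    hB ⟨h1, by omega⟩ ⟨by omega, h2⟩ h
  have hAmono : ∀ {j k}, 1 ≤ j → k ≤ n → j < k → eA j < eA k := fun h1 h2 h =>
    hA ⟨h1, by omega⟩ ⟨by omega, h2⟩ h
  have hcard : C.card = n + m - 1 := by
    rw [Finset.card_union_of_disjoint, Finset.card_image_of_injOn, Finset.card_image_of_injOn]
    · simp only [Nat.card_Icc]; omega
    · intro x hx y hy hxy
      simp only [Finset.coe_Icc, Set.mem_Icc] at hx hy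
      exact hB.injOn ⟨by omega, hx.2⟩ ⟨by omega, hy.2⟩ hxy
    · simpa using hA.injOn
    · rw [Finset.disjoint_left]
      intro x hx hx'
      obtain ⟨j, hj, rfl⟩ := Finset.mem_image.1 hx
      obtain ⟨l, hl, hjl⟩ := Finset.mem_image.1 hx'
      rw [Finset.mem_Icc] at hj hl
      have := hAB j hj l ⟨by omega, hl.2⟩ hjl.symm
      subst this
      have := hBmono le_rfl hl.2 (show 1 < l by omega)
      omega
  obtain ⟨e, r, he, hr, h1, h2⟩ := exists_enumeration C
  rw [hcard] at he h1 h2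
  -- The elements of `C` below or equal to `eA j` are counted twice: by rank, and as `eA 1, …, eA
  -- j`.
  have hrank : ∀ j, 1 ≤ j → j ≤ i → r (eA j) = j := by
    intro j hj hji
    have hx : eA j ∈ C := hmA hj (by omega)
    have e1 : C.filter (· ≤ eA j) = (Finset.Icc 1 (r (eA j))).image e := by
      ext y
      simp only [Finset.mem_filter, Finset.mem_image, Finset.mem_Icc]
      constructor
      · rintro ⟨hy, hle⟩
        exact ⟨r y, ⟨(h2 y hy).1.1, hr.monotoneOn hy hx hle⟩, (h2 y hy).2⟩
      · rintro ⟨k, hk, rfl⟩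
        have hk' : k ∈ Set.Icc 1 (n + m - 1) := ⟨hk.1, hk.2.trans (h2 _ hx).1.2⟩
        refine ⟨(h1 k hk').1, ?_⟩
        have := he.monotoneOn hk' (h2 _ hx).1 hk.2
        rwa [(h2 _ hx).2] at this
    have e2 : C.filter (· ≤ eA j) = (Finset.Icc 1 j).image eA := by
      ext y
      simp only [Finset.mem_filter, Finset.mem_image, Finset.mem_Icc]
      constructor
      · rintro ⟨hy, hle⟩
        rcases Finset.mem_union.1 hy with hy | hy
        · obtain ⟨k, hk, rfl⟩ := Finset.mem_image.1 hy
          rw [Finset.mem_Icc] at hk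
          exact ⟨k, ⟨hk.1, (hA.le_iff_le hk ⟨hj, by omega⟩).1 hle⟩, rfl⟩
        · obtain ⟨l, hl, rfl⟩ := Finset.mem_image.1 hy
          rw [Finset.mem_Icc] at hl
          have := hBmono le_rfl hl.2 (show 1 < l by omega)
          have := hA.monotoneOn (⟨hj, by omega⟩ : j ∈ Set.Icc 1 n) ⟨hi, hin⟩ hji
          omega
      · rintro ⟨k, hk, rfl⟩
        exact ⟨hmA hk.1 (by omega), hA.monotoneOn ⟨hk.1, by omega⟩ ⟨hj, by omega⟩ hk.2⟩
    have e3 := congrArg Finset.card (e1.symm.trans e2)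
    rw [Finset.card_image_of_injOn, Finset.card_image_of_injOn] at e3
    · simpa using e3
    · exact hA.injOn.mono fun x hx => by
        simp only [Finset.coe_Icc, Set.mem_Icc] at hx ⊢; omega
    · have := (h2 _ hx).1.2
      exact he.injOn.mono fun x hx => by
        simp only [Finset.coe_Icc, Set.mem_Icc] at hx ⊢; omega
  have hri : r (eA i) = i := hrank i hi le_rfl
  -- The inner block lists the ranks of `eB 2, …, eB m`, the outer block those of `eA (i + 1), …, eA
  -- n`.
  let f : ℕ → ℕ := fun j => if i + 1 ≤ j ∧ j ≤ i + m - 1 then r (eB (j - i + 1))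
    else if i + m ≤ j ∧ j ≤ n + m - 1 then r (eA (j - m + 1)) else j
  have f1 : ∀ j, i + 1 ≤ j → j ≤ i + m - 1 → f j = r (eB (j - i + 1)) := fun j h h' => by
    simp only [f]; rw [if_pos ⟨h, h'⟩]
  have f2 : ∀ j, i + m ≤ j → j ≤ n + m - 1 → f j = r (eA (j - m + 1)) := fun j h h' => by
    simp only [f]; rw [if_neg (by omega), if_pos ⟨h, h'⟩]
  have f3 : ∀ j, j ∉ Set.Icc (i + 1) (n + m - 1) → f j = j := fun j h => by
    rw [Set.mem_Icc] at h
    simp only [f]; rw [if_neg (by omega), if_neg (by omega)]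
  have m1 : StrictMonoOn f (Set.Icc (i + 1) (i + m - 1)) := by
    intro a ha b hb hab
    rw [Set.mem_Icc] at ha hb
    rw [f1 a ha.1 ha.2, f1 b hb.1 hb.2]
    exact hr (hmB (by omega) (by omega)) (hmB (by omega) (by omega))
      (hBmono (by omega) (by omega) (by omega))
  have m2 : StrictMonoOn f (Set.Icc (i + m) (n + m - 1)) := by
    intro a ha b hb hab
    rw [Set.mem_Icc] at ha hb
    rw [f2 a ha.1 ha.2, f2 b hb.1 hb.2]
    exact hr (hmA (by omega) (by omega)) (hmA (by omega) (by omega))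
      (hAmono (by omega) (by omega) (by omega))
  have hmaps : ∀ j ∈ Set.Icc (i + 1) (n + m - 1), f j ∈ Set.Icc (i + 1) (n + m - 1) := by
    intro j hj
    rw [Set.mem_Icc] at hj
    rcases Nat.lt_or_ge (i + m - 1) j with h | h
    · rw [f2 j (by omega) hj.2]
      have hx : eA (j - m + 1) ∈ C := hmA (by omega) (by omega)
      have := hr (hmA hi hin) hx (hAmono hi (by omega) (by omega))
      rw [hri] at this
      exact ⟨this, (h2 _ hx).1.2⟩
    · rw [f1 j hj.1 h]
      have hx : eB (j - i + 1) ∈ C := hmB (by omega) (by omega)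
      have := hr (hmA hi hin) hx (h0 ▸ hBmono le_rfl (by omega) (by omega))
      rw [hri] at this
      exact ⟨this, (h2 _ hx).1.2⟩
  have hne : ∀ j k, i + 1 ≤ j → j ≤ i + m - 1 → i + m ≤ k → k ≤ n + m - 1 → f j ≠ f k := by
    intro j k hj hj' hk hk' h
    rw [f1 j hj hj', f2 k hk hk'] at h
    have h := hr.injOn (hmB (by omega) (by omega)) (hmA (by omega) (by omega)) h
    have := hAB _ ⟨by omega, by omega⟩ _ ⟨by omega, by omega⟩ h.symm
    omega
  have hinj : Set.InjOn f (Set.Icc (i + 1) (n + m - 1)) := by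
    intro a ha b hb hab
    rw [Set.mem_Icc] at ha hb
    rcases Nat.lt_or_ge (i + m - 1) a with h | h <;> rcases Nat.lt_or_ge (i + m - 1) b with h' | h'
    · exact m2.injOn ⟨by omega, ha.2⟩ ⟨by omega, hb.2⟩ hab
    · exact absurd hab.symm (hne b a hb.1 h' (by omega) ha.2)
    · exact absurd hab (hne a b ha.1 h (by omega) hb.2)
    · exact m1.injOn ⟨ha.1, h⟩ ⟨hb.1, h'⟩ hab
  have hbij : Bijective f := by
    constructor
    · intro a b hab
      by_cases ha : a ∈ Set.Icc (i + 1) (n + m - 1) <;> by_cases hb : b ∈ Set.Icc (i + 1) (n + m - 1)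
      · exact hinj ha hb hab
      · exact absurd (f3 b hb ▸ hab ▸ hmaps a ha) hb
      · exact absurd (f3 a ha ▸ hab ▸ hmaps b hb) ha
      · rwa [f3 a ha, f3 b hb] at hab
    · intro y
      by_cases hy : y ∈ Set.Icc (i + 1) (n + m - 1)
      · have := Finset.surjOn_of_injOn_of_card_le (s := Finset.Icc (i + 1) (n + m - 1))
          (t := Finset.Icc (i + 1) (n + m - 1)) f (by rw [Finset.coe_Icc]; exact hmaps)
          (by simpa using hinj) le_rfl
        obtain ⟨x, -, hx⟩ := this (by simpa using hy)
        exact ⟨x, hx⟩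
      · exact ⟨y, f3 y hy⟩
  refine ⟨⟨Equiv.ofBijective f hbij, hi, hin, f3, m1, m2⟩, e, he, ?_, ?_, ?_⟩
  · intro l hl
    rw [Set.mem_Icc] at hl
    simp only [Equiv.ofBijective_apply]
    rcases Nat.lt_or_ge 1 l with h | h
    · rw [f1 _ (by omega) (by omega), show i + l - 1 - i + 1 = l by omega]
      exact (h2 _ (hmB hl.1 hl.2)).2
    · rw [show l = 1 by omega, f3 _ (by rw [Set.mem_Icc]; omega), ← h0]
      have := (h2 _ (hmA hi hin)).2
      rwa [hri] at this
  · intro j hj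
    rw [Set.mem_Ioc] at hj
    simp only [Equiv.ofBijective_apply]
    rw [f2 _ (by omega) (by omega), show j + m - 1 - m + 1 = j by omega]
    exact (h2 _ (hmA (by omega) hj.2)).2
  · intro j hj hji
    have := (h2 _ (hmA hj (by omega))).2
    rwa [hrank j hj hji.le] at this

end ShuffleOperad

/-! ### Replacement of a subtree as a composite of elementary shuffle compositions. -/

namespace ShuffleOperad

open Function

namespace TreeMonomial

variable {B : Type*} {ar : B → ℕ+}

theorem arity_comp {n m i : ℕ} (σ : Shuffle n m i) (α β : TreeMonomial ar)
    (hα : α.arity = n) (hβ : β.arity = m) : (comp σ α β hα hβ).arity = n + m - 1 := by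
  have := comp_leaves σ α β hα hβ
  simp [arity, comp, this]

/-- Up to relabelling, a shuffle composition is a plain grafting of trees with arbitrary labels. The
three hypotheses on `e` are what `exists_shuffle` provides. -/
theorem comp_relabel {n m i : ℕ} (σ : Shuffle n m i) (α β : TreeMonomial ar)
    (hα : α.arity = n) (hβ : β.arity = m) {e eA eB : ℕ → ℕ} (hA : Set.InjOn eA (Set.Icc 1 n))
    (h1 : ∀ l ∈ Set.Icc 1 m, e (σ.perm (i + l - 1)) = eB l)
    (h2 : ∀ j ∈ Set.Ioc i n, e (σ.perm (j + m - 1)) = eA j)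
    (h3 : ∀ j, 1 ≤ j → j < i → e j = eA j) :
    (comp σ α β hα hβ).tree.relabel e =
      (α.tree.relabel eA).bind (update PTree.leaf (eA i) (β.tree.relabel eB)) := by
  have hi : i ∈ Set.Icc 1 n := ⟨σ.one_le, σ.le_arity⟩
  rw [comp, PTree.bind_relabel, PTree.relabel_bind]
  refine PTree.bind_congr_of_mem fun j hj => ?_
  rw [mem_leaves, hα] at hj
  rcases lt_trichotomy j i with h | rfl | h
  · have : eA j ≠ eA i := fun h' => h.ne (hA hj hi h')
    rw [update_of_ne this, compBranch, if_pos h, ← h3 j hj.1 h]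
    rfl
  · rw [update_self, compBranch, if_neg (lt_irrefl _), if_pos rfl, PTree.relabel_relabel]
    refine PTree.relabel_congr fun l hl => h1 l ?_
    rwa [mem_leaves, hβ] at hl
  · have : eA j ≠ eA i := fun h' => h.ne' (hA hj hi h')
    rw [update_of_ne this, compBranch, if_neg (by omega), if_neg (by omega), ← h2 j ⟨h, hj.2⟩]
    rfl

/-- `Composite n m ψ`: on tree monomials of arity `n`, the operation `ψ` is a composite of elementary
shuffle compositions with fixed tree monomials, and it takes values of arity `m`. -/
inductive Composite (n : ℕ) : ℕ → (TreeMonomial ar → TreeMonomial ar) → Prop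
  | id : Composite n n id
  | left {p m i : ℕ} (σ : Shuffle p m i) (ψ ψ' : TreeMonomial ar → TreeMonomial ar)
      (δ : TreeMonomial ar) (hδ : δ.arity = m) : Composite n p ψ →
      (∀ γ, γ.arity = n → ∃ h : (ψ γ).arity = p, ψ' γ = comp σ (ψ γ) δ h hδ) →
      Composite n (p + m - 1) ψ'
  | right {p m i : ℕ} (σ : Shuffle m p i) (ψ ψ' : TreeMonomial ar → TreeMonomial ar)
      (δ : TreeMonomial ar) (hδ : δ.arity = m) : Composite n p ψ →
      (∀ γ, γ.arity = n → ∃ h : (ψ γ).arity = p, ψ' γ = comp σ δ (ψ γ) hδ h) →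
      Composite n (m + p - 1) ψ'

namespace Composite

variable {n m : ℕ} {ψ : TreeMonomial ar → TreeMonomial ar}

theorem arity_eq (hψ : Composite n m ψ) {γ : TreeMonomial ar} (hγ : γ.arity = n) :
    (ψ γ).arity = m := by
  induction hψ with
  | id => exact hγ
  | left σ ψ ψ' δ hδ _ h _ => obtain ⟨h1, h2⟩ := h γ hγ; rw [h2, arity_comp]
  | right σ ψ ψ' δ hδ _ h _ => obtain ⟨h1, h2⟩ := h γ hγ; rw [h2, arity_comp]

theorem monotone [LinearOrder (TreeMonomial ar)] (hord : IsAdmissible ar)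
    (hψ : Composite n m ψ) {γ γ' : TreeMonomial ar} (hγ : γ.arity = n) (hγ' : γ'.arity = n)
    (hle : γ ≤ γ') : ψ γ ≤ ψ γ' := by
  induction hψ with
  | id => exact hle
  | left σ ψ ψ' δ hδ _ h ih =>
    obtain ⟨h1, h2⟩ := h γ hγ
    obtain ⟨h1', h2'⟩ := h γ' hγ'
    rw [h2, h2']
    exact hord.comp_le_comp _ _ _ σ _ _ _ _ h1 h1' hδ hδ ih le_rfl
  | right σ ψ ψ' δ hδ _ h ih =>
    obtain ⟨h1, h2⟩ := h γ hγ
    obtain ⟨h1', h2'⟩ := h γ' hγ'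
    rw [h2, h2']
    exact hord.comp_le_comp _ _ _ σ _ _ _ _ hδ hδ h1 h1' le_rfl ih

end Composite

/-- Up to an increasing relabelling, `Θ` is a composite of elementary shuffle compositions on tree
monomials of arity `n`. -/
def IsRelabelledComposite (n : ℕ) (Θ : TreeMonomial ar → PTree ar) : Prop :=
  ∃ (m : ℕ) (ψ : TreeMonomial ar → TreeMonomial ar) (e : ℕ → ℕ), Composite n m ψ ∧
    StrictMonoOn e (Set.Icc 1 m) ∧ ∀ γ, γ.arity = n → Θ γ = (ψ γ).tree.relabel e

namespace IsRelabelledComposite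

variable {n : ℕ} {Θ : TreeMonomial ar → PTree ar}

theorem relabel {e : ℕ → ℕ} (he : StrictMonoOn e (Set.Icc 1 n)) :
    IsRelabelledComposite n fun γ : TreeMonomial ar => γ.tree.relabel e :=
  ⟨n, id, e, .id, he, fun _ _ => rfl⟩

/-- After standardizing `S`, `exists_shuffle` turns the grafting into one elementary composition
with a fixed right factor. All `Θ γ` with `γ` of arity `n` have the same leaf labels, so conditions
on the sample `γ₀` suffice. -/
theorem graft (hΘ : IsRelabelledComposite n Θ) {γ₀ : TreeMonomial ar} (h₀ : γ₀.arity = n)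
    {S : PTree ar} (hS : S.IsCanonical) (hnS : S.leaves.Nodup) (ha : S.minLeaf ∈ (Θ γ₀).leaves)
    (hd : ∀ x ∈ (Θ γ₀).leaves, x ∈ S.leaves → x = S.minLeaf) :
    IsRelabelledComposite n fun γ => (Θ γ).bind (update PTree.leaf S.minLeaf S) := by
  classical
  obtain ⟨m, ψ, e, hψ, he, hΘ⟩ := hΘ
  obtain ⟨δ, eB, r, -, rfl, hB, -⟩ := PTree.exists_standardization hS hnS
  have hB' : StrictMonoOn eB {l | l ∈ δ.tree.leaves} := hB.mono fun l hl => mem_leaves.1 hl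
  have hmin : (δ.tree.relabel eB).minLeaf = eB 1 := by
    rw [PTree.minLeaf_relabel hB', minLeaf_eq_one]
  rw [hmin] at ha hd ⊢
  rw [hΘ γ₀ h₀, PTree.mem_leaves_relabel] at ha
  obtain ⟨i, hi, hi'⟩ := ha
  rw [mem_leaves, hψ.arity_eq h₀] at hi
  obtain ⟨σ, e', he', h1, h2, h3⟩ := exists_shuffle hi.1 hi.2 δ.one_le_arity he hB hi'
    fun j hj l hl hjl => he.injOn hj hi (by
      rw [hi']
      refine hd _ ?_ ?_
      · rw [hΘ γ₀ h₀, PTree.mem_leaves_relabel]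
        exact ⟨j, mem_leaves.2 (by rwa [hψ.arity_eq h₀]), rfl⟩
      · rw [hjl, PTree.mem_leaves_relabel]
        exact ⟨l, mem_leaves.2 hl, rfl⟩)
  let ψ' : TreeMonomial ar → TreeMonomial ar := fun γ =>
    if h : (ψ γ).arity = m then comp σ (ψ γ) δ h rfl else γ
  have hψ' : ∀ γ, γ.arity = n → ∃ h : (ψ γ).arity = m, ψ' γ = comp σ (ψ γ) δ h rfl :=
    fun γ hγ => ⟨hψ.arity_eq hγ, by simp only [ψ']; rw [dif_pos (hψ.arity_eq hγ)]⟩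
  refine ⟨_, ψ', e', .left σ ψ ψ' δ rfl hψ hψ', he', fun γ hγ => ?_⟩
  obtain ⟨h, h'⟩ := hψ' γ hγ
  beta_reduce
  rw [h', comp_relabel σ _ δ h rfl he.injOn h1 h2 h3, hΘ γ hγ, hi']

/-- The counterpart of `graft` in which the fixed tree is the left factor and the variable one is
grafted onto its leaf `a`. -/
theorem graft_under (hΘ : IsRelabelledComposite n Θ) {γ₀ : TreeMonomial ar} (h₀ : γ₀.arity = n)
    {T : PTree ar} (hT : T.IsCanonical) (hnT : T.leaves.Nodup) {a : ℕ} (haT : a ∈ T.leaves)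
    (ha : (Θ γ₀).minLeaf = a) (hd : ∀ x ∈ T.leaves, x ∈ (Θ γ₀).leaves → x = a) :
    IsRelabelledComposite n fun γ => T.bind (update PTree.leaf a (Θ γ)) := by
  classical
  obtain ⟨m, ψ, e, hψ, he, hΘ⟩ := hΘ
  obtain ⟨δ, eA, r, -, rfl, hA, -⟩ := PTree.exists_standardization hT hnT
  have harity := hψ.arity_eq h₀
  have he1 : StrictMonoOn e {l | l ∈ (ψ γ₀).tree.leaves} :=
    he.mono fun l hl => harity ▸ mem_leaves.1 hl
  rw [hΘ γ₀ h₀, PTree.minLeaf_relabel he1, minLeaf_eq_one] at ha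
  obtain ⟨i, hi, hi'⟩ := PTree.mem_leaves_relabel.1 haT
  rw [mem_leaves] at hi
  obtain ⟨σ, e', he', h1, h2, h3⟩ := exists_shuffle hi.1 hi.2 (harity ▸ (ψ γ₀).one_le_arity) hA he
    (hi'.trans ha.symm) fun j hj l hl hjl => hA.injOn hj hi (by
      rw [hi']
      refine hd _ ?_ ?_
      · exact PTree.mem_leaves_relabel.2 ⟨j, mem_leaves.2 hj, rfl⟩
      · rw [hΘ γ₀ h₀, hjl, PTree.mem_leaves_relabel]
        exact ⟨l, mem_leaves.2 (by rwa [harity]), rfl⟩)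
  let ψ' : TreeMonomial ar → TreeMonomial ar := fun γ =>
    if h : (ψ γ).arity = m then comp σ δ (ψ γ) rfl h else γ
  have hψ' : ∀ γ, γ.arity = n → ∃ h : (ψ γ).arity = m, ψ' γ = comp σ δ (ψ γ) rfl h :=
    fun γ hγ => ⟨hψ.arity_eq hγ, by simp only [ψ']; rw [dif_pos (hψ.arity_eq hγ)]⟩
  refine ⟨_, ψ', e', .right σ ψ ψ' δ rfl hψ hψ', he', fun γ hγ => ?_⟩
  obtain ⟨h, h'⟩ := hψ' γ hγ
  beta_reduce
  rw [h', comp_relabel σ δ _ rfl h hA.injOn h1 h2 h3, hΘ γ hγ, hi']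

end IsRelabelledComposite

theorem eq_self_of_strictMonoOn_of_mapsTo {m : ℕ} {e : ℕ → ℕ} (he : StrictMonoOn e (Set.Icc 1 m))
    (hmem : ∀ l ∈ Set.Icc 1 m, e l ∈ Set.Icc 1 m) : ∀ l ∈ Set.Icc 1 m, e l = l := by
  have h1 : ∀ l, l ∈ Set.Icc 1 m → l ≤ e l := by
    intro l
    induction l with
    | zero => intro _; omega
    | succ l ih =>
      intro hl
      rcases Nat.eq_zero_or_pos l with rfl | h0
      · exact (hmem 1 hl).1
      · have hl' : l ∈ Set.Icc 1 m := ⟨h0, by have := hl.2; omega⟩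
        have := he hl' hl (Nat.lt_succ_self l)
        have := ih hl'
        omega
  have h2 : ∀ k l, l ∈ Set.Icc 1 m → m = l + k → e l ≤ l := by
    intro k
    induction k with
    | zero => intro l hl h; have := (hmem l hl).2; omega
    | succ k ih =>
      intro l hl h
      have hl' : l + 1 ∈ Set.Icc 1 m := ⟨by omega, by omega⟩
      have := he hl hl' (Nat.lt_succ_self l)
      have := ih (l + 1) hl' (by omega)
      omega
  intro l hl
  exact le_antisymm (h2 (m - l) l hl (by have := hl.2; omega)) (h1 l hl)

namespace Occurrence

variable {α β : TreeMonomial ar}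

theorem hole_mem (o : Occurrence α β) : 0 ∈ o.upper.leaves := by
  rw [← Multiset.one_le_count_iff_mem, o.count_hole]

theorem inner_mem_leaves (o : Occurrence α β) {x : ℕ} (hx : x ∈ (β.tree.bind o.branch).leaves) :
    x ∈ α.tree.leaves := by
  rw [o.eq, PTree.mem_leaves_bind]
  exact ⟨0, o.hole_mem, by rwa [if_pos rfl]⟩

theorem inner_nodup (o : Occurrence α β) : (β.tree.bind o.branch).leaves.Nodup := by
  have h := α.leaves_nodup
  rw [o.eq] at h
  simpa using PTree.nodup_branch h o.hole_mem

theorem inner_isCanonical (o : Occurrence α β) : (β.tree.bind o.branch).IsCanonical := by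
  have h := α.isCanonical
  rw [o.eq] at h
  simpa using h.of_bind 0 o.hole_mem

theorem outer_disjoint (o : Occurrence α β) {x : ℕ} (hx : x ∈ (β.tree.bind o.branch).leaves)
    (hx' : x ∈ o.upper.leaves) : x = 0 := by
  by_contra h0
  have h := α.leaves_nodup
  rw [o.eq] at h
  exact h0 (PTree.branch_disjoint h (l := x) (l' := 0) hx' o.hole_mem (x := x)
    (by simp [h0, PTree.leaves_leaf]) (by simpa using hx))

theorem replaceMonomial_leaves (o : Occurrence α β) (γ : TreeMonomial ar) (h : γ.arity = β.arity) :
    (o.replaceMonomial γ h).tree.leaves = α.tree.leaves := by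
  rw [replaceMonomial, o.eq, PTree.leaves_bind, PTree.leaves_bind]
  congr 1
  funext l
  exact (o.replace_leaves γ h l).symm

theorem arity_replaceMonomial (o : Occurrence α β) (γ : TreeMonomial ar) (h : γ.arity = β.arity) :
    (o.replaceMonomial γ h).arity = α.arity := by
  rw [arity, replaceMonomial_leaves, arity]

theorem replaceMonomial_self (o : Occurrence α β) : o.replaceMonomial β rfl = α :=
  TreeMonomial.ext o.eq.symm

theorem replaceMonomial_injective (o : Occurrence α β) {γ γ' : TreeMonomial ar}
    (h : γ.arity = β.arity) (h' : γ'.arity = β.arity)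
    (heq : o.replaceMonomial γ h = o.replaceMonomial γ' h') : γ = γ' := by
  have h1 := PTree.eq_of_bind_eq (congrArg TreeMonomial.tree heq) 0 o.hole_mem
  simp only [if_pos] at h1
  refine TreeMonomial.ext (PTree.bind_injective_of_nodup (leaves_eq_of_arity_eq (h.trans h'.symm))
    ?_ h1)
  rw [PTree.leaves_bind, leaves_eq_of_arity_eq h, ← PTree.leaves_bind]
  exact o.inner_nodup

/-- The branches are grafted one at a time. Each branch still missing is represented by a leaf
carrying its smallest label; by `o.mono` the initial relabelling is increasing. -/
theorem isRelabelledComposite_bind (o : Occurrence α β) (k : ℕ) (hk : k ≤ β.arity) :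
    IsRelabelledComposite β.arity fun γ => γ.tree.bind fun l =>
      if l ≤ k then o.branch l else .leaf (o.branch l).minLeaf := by
  induction k with
  | zero =>
    obtain ⟨m, ψ, e, h1, h2, h3⟩ := IsRelabelledComposite.relabel (ar := ar) o.mono
    refine ⟨m, ψ, e, h1, h2, fun γ hγ => ?_⟩
    rw [← h3 γ hγ]
    refine PTree.bind_congr_of_mem fun l hl => ?_
    rw [leaves_eq_of_arity_eq hγ, mem_leaves] at hl
    rw [if_neg (by omega)]
  | succ k ih =>
    have hk1 : k + 1 ∈ β.tree.leaves := mem_leaves.2 ⟨by omega, hk⟩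
    have hdis : ∀ l ∈ β.tree.leaves, ∀ x ∈ (o.branch l).leaves,
        x ∈ (o.branch (k + 1)).leaves → l = k + 1 := fun l hl x hx hx' =>
      PTree.branch_disjoint o.inner_nodup hl hk1 hx hx'
    obtain ⟨m, ψ, e, h1, h2, h3⟩ := (ih (by omega)).graft (γ₀ := β) rfl
      (o.inner_isCanonical.of_bind _ hk1) (PTree.nodup_branch o.inner_nodup hk1)
      (PTree.mem_leaves_bind.2 ⟨k + 1, hk1, by
        rw [if_neg (by omega), PTree.leaves_leaf, Multiset.mem_singleton]⟩) (fun x hx hx' => by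
        obtain ⟨l, hl, hx⟩ := PTree.mem_leaves_bind.1 hx
        split_ifs at hx with hlk
        · have := hdis l hl x hx hx'
          omega
        · rw [PTree.leaves_leaf, Multiset.mem_singleton] at hx
          subst hx
          rw [hdis l hl _ (PTree.minLeaf_mem _) hx'])
    refine ⟨m, ψ, e, h1, h2, fun γ hγ => ?_⟩
    rw [← h3 γ hγ]
    beta_reduce
    rw [PTree.bind_bind]
    refine PTree.bind_congr_of_mem fun l hl => ?_
    rw [leaves_eq_of_arity_eq hγ] at hl
    rcases lt_trichotomy l (k + 1) with h | rfl | h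
    · rw [if_pos h.le, if_pos (by omega)]
      conv_lhs => rw [← PTree.bind_leaf (o.branch l)]
      refine PTree.bind_congr_of_mem fun x hx => ?_
      rw [update_of_ne]
      rintro rfl
      have := hdis l hl _ hx (PTree.minLeaf_mem _)
      omega
    · rw [if_pos le_rfl, if_neg (by omega), PTree.bind, update_self]
    · rw [if_neg (by omega), if_neg (by omega), PTree.bind, update_of_ne]
      intro h'
      have := hdis l hl _ (PTree.minLeaf_mem _) (h' ▸ PTree.minLeaf_mem _)
      omega

/-- Replacing an occurrence is a composite of elementary shuffle compositions. -/
theorem exists_composite (o : Occurrence α β) : ∃ ψ : TreeMonomial ar → TreeMonomial ar,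
    Composite β.arity α.arity ψ ∧
      ∀ γ, ∀ h : γ.arity = β.arity, ψ γ = o.replaceMonomial γ h := by
  have hcomp := o.isRelabelledComposite_bind β.arity le_rfl
  have hbind : ∀ γ : TreeMonomial ar, γ.arity = β.arity → (γ.tree.bind fun l =>
      if l ≤ β.arity then o.branch l else .leaf (o.branch l).minLeaf) = γ.tree.bind o.branch :=
    fun γ hγ => PTree.bind_congr_of_mem fun l hl => by
      rw [mem_leaves] at hl
      rw [if_pos (by omega)]
  -- The hole of `o.upper` carries the auxiliary label 0, which is in the wrong position for a
  -- canonical tree. Renaming it to the smallest leaf of the inserted subtree makes `T` canonical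
  -- and allows `graft_under`.
  let a := (β.tree.bind o.branch).minLeaf
  have ha : a ∈ (β.tree.bind o.branch).leaves := PTree.minLeaf_mem _
  have ha0 : a ≠ 0 := fun h => α.zero_notMem_leaves (h ▸ o.inner_mem_leaves ha)
  let T := o.upper.relabel (update id 0 a)
  have haU : a ∉ o.upper.leaves := fun h => ha0 (o.outer_disjoint ha h)
  have hnU : (o.upper.bind fun l => if l = 0 then β.tree.bind o.branch else .leaf l).leaves.Nodup :=
    o.eq ▸ α.leaves_nodup
  have hcU : (o.upper.bind fun l => if l = 0 then β.tree.bind o.branch else .leaf l).IsCanonical :=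
    o.eq ▸ α.isCanonical
  have hT : T.IsCanonical := hcU.bind_congr_minLeaf (fun l _ => by
    by_cases h : l = 0
    · subst h; simp only [if_pos, update_self, PTree.minLeaf_leaf]; rfl
    · simp only [if_neg h, update_of_ne h, id]) (fun _ _ => trivial)
  have hnT : T.leaves.Nodup := by
    rw [PTree.leaves_relabel]
    refine (PTree.nodup_of_bind hnU).map_on fun x hx y hy hxy => ?_
    by_cases h : x = 0 <;> by_cases h' : y = 0
    · rw [h, h']
    · subst h
      rw [update_self, update_of_ne h', id] at hxy
      exact absurd (hxy ▸ hy) haU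
    · subst h'
      rw [update_self, update_of_ne h, id] at hxy
      exact absurd (hxy ▸ hx) haU
    · rwa [update_of_ne h, update_of_ne h'] at hxy
  obtain ⟨m, ψ, e, h1, h2, h3⟩ := hcomp.graft_under (γ₀ := β) rfl hT hnT (a := a)
    (PTree.mem_leaves_relabel.2 ⟨0, o.hole_mem, update_self _ _ _⟩)
    (by rw [hbind β rfl]) (fun x hx hx' => by
      rw [hbind β rfl] at hx'
      obtain ⟨l, hl, rfl⟩ := PTree.mem_leaves_relabel.1 hx
      by_cases h : l = 0
      · rw [h, update_self]
      · rw [update_of_ne h, id] at hx'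
        exact absurd (o.outer_disjoint hx' hl) h)
  have h3' : ∀ γ, ∀ h : γ.arity = β.arity,
      (o.replaceMonomial γ h).tree = (ψ γ).tree.relabel e := by
    intro γ hγ
    rw [← h3 γ hγ]
    beta_reduce
    rw [hbind γ hγ, PTree.relabel_bind]
    refine PTree.bind_congr_of_mem fun l hl => ?_
    by_cases h : l = 0
    · rw [if_pos h, h, update_self, update_self]
    · rw [if_neg h, update_of_ne h, id, update_of_ne]
      rintro rfl
      exact haU hl
  have hm : m = α.arity := by
    have := congrArg (fun t => t.leaves.card) (h3' β rfl)
    simp only [PTree.leaves_relabel, Multiset.card_map] at this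
    rw [← h1.arity_eq rfl]
    exact this.symm.trans (o.arity_replaceMonomial β rfl)
  subst hm
  refine ⟨ψ, h1, fun γ hγ => TreeMonomial.ext ?_⟩
  rw [h3' γ hγ]
  -- The remaining relabelling is an increasing map of `{1, …, α.arity}` into itself, hence the
  -- identity there.
  refine (PTree.relabel_eq_self fun l hl => eq_self_of_strictMonoOn_of_mapsTo h2 ?_ l ?_).symm
  · intro l hl
    have : e l ∈ (o.replaceMonomial γ hγ).tree.leaves := by
      rw [h3' γ hγ, PTree.mem_leaves_relabel]
      exact ⟨l, mem_leaves.2 (by rwa [h1.arity_eq hγ]), rfl⟩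
    rwa [mem_leaves, arity_replaceMonomial] at this
  · rwa [mem_leaves, h1.arity_eq hγ] at hl

/-- Admissibility, applied along the composite, gives `≤`; injectivity of the replacement makes it
strict. -/
theorem replaceMonomial_strictMono [LinearOrder (TreeMonomial ar)] (hord : IsAdmissible ar)
    (o : Occurrence α β) {γ γ' : TreeMonomial ar} (h : γ.arity = β.arity) (h' : γ'.arity = β.arity)
    (hlt : γ < γ') : o.replaceMonomial γ h < o.replaceMonomial γ' h' := by
  obtain ⟨ψ, h1, h2⟩ := o.exists_composite
  refine lt_of_le_of_ne ?_ fun heq => hlt.ne (o.replaceMonomial_injective h h' heq)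
  rw [← h2, ← h2]
  exact h1.monotone hord h h' hlt.le

end Occurrence

end TreeMonomial

end ShuffleOperad

/-! ### Two subtrees of one tree: contexts, unions and disjointness. -/

namespace ShuffleOperad

open Function

theorem exists_glue {ι X : Type*} [Nonempty X] (A : ι → Set ℕ) (f : ι → ℕ → X)
    (hA : ∀ i j x, x ∈ A i → x ∈ A j → i = j) : ∃ g : ℕ → X, ∀ i, ∀ x ∈ A i, g x = f i x := by
  classical
  refine ⟨fun x => if h : ∃ i, x ∈ A i then f h.choose x else Classical.arbitrary X, ?_⟩
  intro i x hx
  have h : ∃ i, x ∈ A i := ⟨i, hx⟩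
  simp only [dif_pos h]
  rw [hA _ _ x h.choose_spec hx]

namespace PTree

variable {B : Type*} {ar : B → ℕ+}

instance : Nonempty (PTree ar) := ⟨leaf 0⟩

/-- Trees with a hole; the label `0` does not occur outside the hole. -/
inductive IsContext : (PTree ar → PTree ar) → Prop
  | id : IsContext fun x => x
  | node (b : B) (c : Fin (ar b : ℕ) → PTree ar) (i : Fin (ar b : ℕ)) (φ : PTree ar → PTree ar) :
      (∀ j, j ≠ i → 0 ∉ (c j).leaves) → IsContext φ →
      IsContext fun x => PTree.node b (update c i (φ x))

namespace IsContext

variable {φ ψ : PTree ar → PTree ar}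

theorem comp (hφ : IsContext φ) (hψ : IsContext ψ) : IsContext fun x => φ (ψ x) := by
  induction hφ with
  | id => exact hψ
  | node b c i φ hc _ ih => exact .node b c i _ hc ih

theorem leaves_congr (hφ : IsContext φ) {x y : PTree ar} (h : x.leaves = y.leaves) :
    (φ x).leaves = (φ y).leaves := by
  induction hφ with
  | id => exact h
  | node b c i φ hc _ ih =>
    simp only [leaves]
    refine Finset.sum_congr rfl fun j _ => ?_
    by_cases hj : j = i
    · subst hj; simpa only [update_self] using ih
    · simp only [update_of_ne hj]

theorem mem_leaves (hφ : IsContext φ) {x : PTree ar} {l : ℕ} (h : l ∈ x.leaves) :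
    l ∈ (φ x).leaves := by
  induction hφ with
  | id => exact h
  | node b c i φ hc _ ih => exact mem_leaves_node.2 ⟨i, by rwa [update_self]⟩

/-- The translation back to the form used in `Occurrence`; contexts as functions are better suited
to induction along the path from the root to the hole. -/
theorem exists_upper (hφ : IsContext φ) : ∃ U : PTree ar, U.leaves.count 0 = 1 ∧
    ∀ x, φ x = U.bind fun l => if l = 0 then x else leaf l := by
  induction hφ with
  | id => exact ⟨leaf 0, by simp [leaves], fun x => by simp [bind]⟩
  | node b c i φ hc _ ih =>
    obtain ⟨U, hU, h⟩ := ih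
    refine ⟨.node b (update c i U), ?_, fun x => ?_⟩
    · rw [leaves, Multiset.count_sum', Finset.sum_eq_single i]
      · rwa [update_self]
      · intro j _ hj
        rw [update_of_ne hj]
        exact Multiset.count_eq_zero.2 (hc j hj)
      · simp
    · simp only [bind, node.injEq, heq_eq_eq, true_and]
      funext j
      by_cases hj : j = i
      · subst hj; simp only [update_self, h]
      · simp only [update_of_ne hj]
        conv_lhs => rw [← bind_leaf (c j)]
        refine bind_congr_of_mem fun l hl => ?_
        rw [if_neg]
        rintro rfl
        exact hc j hj hl

theorem of_bind {t : PTree ar} {s : ℕ → PTree ar} {a : ℕ} (ha : t.leaves.count a = 1)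
    (hs : ∀ l ∈ t.leaves, l ≠ a → 0 ∉ (s l).leaves) :
    IsContext fun x => t.bind (update s a x) := by
  induction t with
  | leaf l =>
    have : l = a := by
      by_contra h
      rw [leaves, Multiset.count_singleton, if_neg (Ne.symm h)] at ha
      omega
    subst this
    simpa only [bind, update_self] using IsContext.id
  | node b c ih =>
    have hmem : a ∈ (PTree.node b c).leaves := by
      rw [← Multiset.one_le_count_iff_mem, ha]
    obtain ⟨i, hi⟩ := mem_leaves_node.1 hmem
    rw [leaves, Multiset.count_sum', ← Finset.add_sum_erase _ _ (Finset.mem_univ i)] at ha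
    have h1 := Multiset.one_le_count_iff_mem.2 hi
    have h2 : ∀ j, j ≠ i → a ∉ (c j).leaves := by
      intro j hj hmem
      have h5 : Multiset.count a (c j).leaves ≤ _ :=
        Finset.single_le_sum (f := fun j => Multiset.count a (c j).leaves)
          (fun _ _ => Nat.zero_le _) (Finset.mem_erase.2 ⟨hj, Finset.mem_univ j⟩)
      have := Multiset.one_le_count_iff_mem.2 hmem
      omega
    have h3 := ih i (by omega) fun l hl => hs l (mem_leaves_node.2 ⟨i, hl⟩)
    have h4 := IsContext.node b (fun j => (c j).bind s) i _ (fun j hj hx => by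
      obtain ⟨l, hl, hx⟩ := mem_leaves_bind.1 hx
      exact hs l (mem_leaves_node.2 ⟨j, hl⟩) (fun h => h2 j hj (h ▸ hl)) hx) h3
    convert h4 using 2 with x
    rw [bind]
    congr 1
    funext j
    by_cases hj : j = i
    · subst hj; rw [update_self]
    · rw [update_of_ne hj]
      refine bind_congr_of_mem fun l hl => ?_
      rw [update_of_ne]
      rintro rfl
      exact h2 j hj hl

theorem exists_relabel (hφ : IsContext φ) {r : ℕ → ℕ} {y : PTree ar}
    (hr : ∀ l ∈ (φ y).leaves, r l ≠ 0) :
    ∃ φ' : PTree ar → PTree ar, IsContext φ' ∧ ∀ x, (φ x).relabel r = φ' (x.relabel r) := by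
  induction hφ with
  | id => exact ⟨_, .id, fun _ => rfl⟩
  | node b c i φ hc _ ih =>
    obtain ⟨φ', h1, h2⟩ := ih fun l hl => hr l (mem_leaves_node.2 ⟨i, by rwa [update_self]⟩)
    refine ⟨_, .node b (fun j => (c j).relabel r) i φ' (fun j hj h0 => ?_) h1, fun x => ?_⟩
    · obtain ⟨l, hl, h0⟩ := mem_leaves_relabel.1 h0
      exact hr l (mem_leaves_node.2 ⟨j, by rwa [update_of_ne hj]⟩) h0
    · rw [relabel, bind]
      congr 1
      funext j
      by_cases hj : j = i
      · subst hj; rw [update_self, update_self, ← h2]; rfl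
      · rw [update_of_ne hj, update_of_ne hj]; rfl

end IsContext

/-- The branches `s` of `F` factor through the branches `u`, and each leaf label in the latter is the
smallest leaf of what `v` puts on it. -/
def Factors (F : PTree ar) (s u v : ℕ → PTree ar) : Prop :=
  ∀ l ∈ F.leaves, (u l).bind v = s l ∧ ∀ x ∈ (u l).leaves, (v x).minLeaf = x

namespace Factors

variable {F : PTree ar} {s u v : ℕ → PTree ar}

theorem bind_bind (h : Factors F s u v) {ν : PTree ar} (hν : ν.leaves = F.leaves) :
    (ν.bind u).bind v = ν.bind s := by
  rw [PTree.bind_bind]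
  exact bind_congr_of_mem fun l hl => (h l (hν ▸ hl)).1

theorem mem_branch (h : Factors F s u v) {l : ℕ} (hl : l ∈ F.leaves) {x : ℕ}
    (hx : x ∈ (u l).leaves) : x ∈ (s l).leaves := by
  have hmem := minLeaf_mem (v x)
  rw [(h l hl).2 x hx] at hmem
  rw [← (h l hl).1, mem_leaves_bind]
  exact ⟨x, hx, hmem⟩

theorem mem_leaves (h : Factors F s u v) {x : ℕ} (hx : x ∈ (F.bind u).leaves) :
    x ∈ (F.bind s).leaves := by
  obtain ⟨l, hl, hx⟩ := mem_leaves_bind.1 hx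
  exact mem_leaves_bind.2 ⟨l, hl, h.mem_branch hl hx⟩

theorem minLeaf_eq (h : Factors F s u v) {x : ℕ} (hx : x ∈ (F.bind u).leaves) :
    (v x).minLeaf = x := by
  obtain ⟨l, hl, hx⟩ := mem_leaves_bind.1 hx
  exact (h l hl).2 x hx

theorem minLeaf_branch (h : Factors F s u v) {l : ℕ} (hl : l ∈ F.leaves) :
    (u l).minLeaf = (s l).minLeaf := by
  conv_lhs => rw [← bind_leaf (u l)]
  rw [← (h l hl).1]
  exact minLeaf_bind_congr fun x hx => by rw [minLeaf_leaf, (h l hl).2 x hx]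

theorem congr (h : Factors F s u v) {u' v' : ℕ → PTree ar} (hu : ∀ l ∈ F.leaves, u' l = u l)
    (hv : ∀ x ∈ (F.bind s).leaves, v' x = v x) : Factors F s u' v' := by
  intro l hl
  have hx : ∀ x ∈ (u l).leaves, v' x = v x := fun x hx =>
    hv x (mem_leaves_bind.2 ⟨l, hl, h.mem_branch hl hx⟩)
  rw [hu l hl]
  refine ⟨?_, fun x h' => ?_⟩
  · rw [← (h l hl).1]
    exact bind_congr_of_mem hx
  · rw [hx x h']
    exact (h l hl).2 x h'

theorem node {b : B} {c : Fin (ar b : ℕ) → PTree ar} (h : ∀ i, Factors (c i) s u v) :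
    Factors (PTree.node b c) s u v := fun l hl => by
  obtain ⟨i, hi⟩ := mem_leaves_node.1 hl
  exact h i l hi

/-- The coarsest factorization: each branch shrinks to its smallest leaf, and `v` puts the whole
branch back. Disjointness of the branches makes `v` well defined. -/
theorem exists_minLeaf (hn : (F.bind s).leaves.Nodup) :
    ∃ v, Factors F s (fun l => leaf (s l).minLeaf) v := by
  obtain ⟨v, hv⟩ := exists_glue (fun l : F.leaves.toFinset => {(s l).minLeaf}) (fun l _ => s l)
    (fun i j x hi hj => by
      rw [Set.mem_singleton_iff] at hi hj
      exact Subtype.ext (branch_disjoint hn (Multiset.mem_toFinset.1 i.2)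
        (Multiset.mem_toFinset.1 j.2) (x := x) (hi ▸ minLeaf_mem _) (hj ▸ minLeaf_mem _)))
  refine ⟨v, fun l hl => ?_⟩
  have := hv ⟨l, Multiset.mem_toFinset.2 hl⟩ _ rfl
  refine ⟨this, fun x hx => ?_⟩
  rw [leaves_leaf, Multiset.mem_singleton] at hx
  subst hx
  rw [this]

end Factors

theorem numVertices_leaf (l : ℕ) : (leaf l : PTree ar).numVertices = 0 := rfl

theorem numVertices_bind_minLeaf (t : PTree ar) (f : ℕ → ℕ) :
    (t.bind fun l => leaf (f l)).numVertices = t.numVertices := numVertices_relabel t f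

/-- Two subtrees with the same root have a union. -/
theorem exists_merge {F G : PTree ar} {s t : ℕ → PTree ar} (hn : (F.bind s).leaves.Nodup)
    (h : F.bind s = G.bind t) : ∃ u w v, Factors F s u v ∧ Factors G t w v ∧ F.bind u = G.bind w ∧
      (F.bind u).numVertices ≤ F.numVertices + G.numVertices ∧
      (1 ≤ F.numVertices → 1 ≤ G.numVertices →
        (F.bind u).numVertices < F.numVertices + G.numVertices) := by
  induction F generalizing G with
  -- A subtree without vertices adds nothing: the union is `G`, with each of its branches shrunk to
  -- the smallest leaf.
  | leaf l =>
    obtain ⟨v, hv⟩ := Factors.exists_minLeaf (F := G) (s := t) (h ▸ hn)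
    refine ⟨fun _ => G.bind fun l => leaf (t l).minLeaf, _, v, fun l' hl' => ?_, hv, rfl, ?_, ?_⟩
    · rw [leaves_leaf, Multiset.mem_singleton] at hl'
      subst hl'
      exact ⟨(hv.bind_bind rfl).trans h.symm, fun x hx => hv.minLeaf_eq hx⟩
    · rw [bind, numVertices_bind_minLeaf, numVertices_leaf, zero_add]
    · intro h1
      rw [numVertices_leaf] at h1
      omega
  | node b c ih =>
    cases G with
    | leaf l =>
      obtain ⟨v, hv⟩ := Factors.exists_minLeaf hn
      refine ⟨_, fun _ => (PTree.node b c).bind fun l => leaf (s l).minLeaf, v, hv,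
        fun l' hl' => ?_, rfl, ?_, ?_⟩
      · rw [leaves_leaf, Multiset.mem_singleton] at hl'
        subst hl'
        exact ⟨(hv.bind_bind rfl).trans h, fun x hx => hv.minLeaf_eq hx⟩
      · rw [numVertices_bind_minLeaf, numVertices_leaf, add_zero]
      · intro _ h1
        rw [numVertices_leaf] at h1
        omega
    | node b' c' =>
      have h' := h
      simp only [bind, node.injEq] at h'
      obtain ⟨rfl, h'⟩ := h'
      simp only [heq_eq_eq] at h'
      have hnc : ∀ i, ((c i).bind s).leaves.Nodup := fun i => nodup_child hn i
      choose u w v hu hw huw hle _ using fun i => ih i (hnc i) (congrFun h' i)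
      obtain ⟨u', hu'⟩ := exists_glue (fun i => {l | l ∈ (c i).leaves}) u
        fun i j x => child_disjoint (nodup_of_bind hn)
      obtain ⟨w', hw'⟩ := exists_glue (fun i => {l | l ∈ (c' i).leaves}) w
        fun i j x => child_disjoint (nodup_of_bind (h ▸ hn))
      obtain ⟨v', hv'⟩ := exists_glue (fun i => {x | x ∈ ((c i).bind s).leaves}) v
        fun i j x => child_disjoint (c := fun i => (c i).bind s) hn
      have e1 : ∀ i, (c i).bind u' = (c i).bind (u i) := fun i => bind_congr_of_mem (hu' i)
      have e2 : ∀ i, (c' i).bind w' = (c' i).bind (w i) := fun i => bind_congr_of_mem (hw' i)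
      -- The common root counts once on the left and twice on the right, which makes the inequality
      -- strict.
      have hlt : ((PTree.node b c).bind u').numVertices <
          (PTree.node b c).numVertices + (PTree.node b c').numVertices := by
        simp only [bind, numVertices, e1]
        have := Finset.sum_le_sum (s := Finset.univ) fun i _ => hle i
        rw [Finset.sum_add_distrib] at this
        omega
      refine ⟨u', w', v', .node fun i => (hu i).congr (hu' i) (hv' i),
        .node fun i => (hw i).congr (hw' i) fun x hx => hv' i x ?_, ?_, hlt.le, fun _ _ => hlt⟩
      · exact (congrFun h' i).symm ▸ hx
      · simp only [bind, e1, e2, huw]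

/-- Two subtrees share a vertex, and the root of the second one, `G`, belongs to the first one, `F`:
their union `F.bind u` is a small common multiple. -/
def Overlap (φ₁ : PTree ar → PTree ar) (F : PTree ar) (s : ℕ → PTree ar) (φ₂ : PTree ar → PTree ar)
    (G : PTree ar) (t : ℕ → PTree ar) : Prop :=
  ∃ u v w P, Factors F s u v ∧ Factors G t w v ∧ IsContext P ∧ F.bind u = P (G.bind w) ∧
    (∀ μ : PTree ar, μ.leaves = G.leaves → φ₁ ((P (μ.bind w)).bind v) = φ₂ (μ.bind t)) ∧
    (F.bind u).numVertices < F.numVertices + G.numVertices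

/-- Two subtrees without common vertex; `Φ ν μ` is the result of replacing them by `ν` and `μ`. -/
def Apart (φ₁ : PTree ar → PTree ar) (F : PTree ar) (s : ℕ → PTree ar) (φ₂ : PTree ar → PTree ar)
    (G : PTree ar) (t : ℕ → PTree ar) : Prop :=
  ∃ Φ : PTree ar → PTree ar → PTree ar, (∀ ν, Φ ν G = φ₁ (ν.bind s)) ∧
    (∀ μ, Φ F μ = φ₂ (μ.bind t)) ∧
    (∀ μ, μ.leaves = G.leaves → ∃ φ s', IsContext φ ∧
      (∀ l ∈ F.leaves, (s' l).leaves = (s l).leaves) ∧ ∀ ν, Φ ν μ = φ (ν.bind s')) ∧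
    ∀ ν, ν.leaves = F.leaves → ∃ φ t', IsContext φ ∧
      (∀ l ∈ G.leaves, (t' l).leaves = (t l).leaves) ∧ ∀ μ, Φ ν μ = φ (μ.bind t')

theorem Apart.symm {φ₁ φ₂ : PTree ar → PTree ar} {F G : PTree ar} {s t : ℕ → PTree ar}
    (h : Apart φ₁ F s φ₂ G t) : Apart φ₂ G t φ₁ F s := by
  obtain ⟨Φ, h1, h2, h3, h4⟩ := h
  exact ⟨fun ν μ => Φ μ ν, h2, h1, h4, h3⟩

/-- Follow the path from the root of `F` to the hole of `ψ`. Either it leaves `F` through a leaf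
`l`, and `G` lies inside the branch `s l`; or it ends at a vertex of `F`, which is then the root of
`G` and at which `exists_merge` forms the union. -/
theorem exists_branch_or_overlap {F G : PTree ar} {s t : ℕ → PTree ar}
    (hn : (F.bind s).leaves.Nodup) (h0 : 0 ∉ (F.bind s).leaves) (hG : 1 ≤ G.numVertices)
    {ψ : PTree ar → PTree ar} (hψ : IsContext ψ) (h : F.bind s = ψ (G.bind t)) :
    (∃ l ∈ F.leaves, ∃ ψ', IsContext ψ' ∧ s l = ψ' (G.bind t) ∧
      ∀ x, ψ x = F.bind (update s l (ψ' x))) ∨ Overlap (fun x => x) F s ψ G t := by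
  induction F generalizing ψ with
  | leaf l =>
    exact Or.inl ⟨l, by simp [leaves], ψ, hψ, h, fun x => by rw [bind, update_self]⟩
  | node b c ih =>
    cases hψ with
    | id =>
      obtain ⟨u, w, v, hu, hw, huw, -, hlt⟩ := exists_merge hn h
      refine Or.inr ⟨u, v, w, _, hu, hw, .id, huw, fun μ hμ => hw.bind_bind hμ, hlt ?_ hG⟩
      rw [numVertices]
      omega
    | node b' c' i ψ hc hψ =>
      have h' := h
      simp only [bind, node.injEq] at h'
      obtain ⟨rfl, h'⟩ := h'
      simp only [heq_eq_eq] at h'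
      have hi : (c i).bind s = ψ (G.bind t) := by
        have := congrFun h' i
        rwa [update_self] at this
      have hj : ∀ j, j ≠ i → (c j).bind s = c' j := fun j hj => by
        have := congrFun h' j
        rwa [update_of_ne hj] at this
      have hnc : ∀ i, ((c i).bind s).leaves.Nodup := fun i => nodup_child hn i
      have h0c : ∀ i, 0 ∉ ((c i).bind s).leaves := fun i hx => h0 (mem_leaves_node.2 ⟨i, hx⟩)
      have hF := nodup_of_bind hn
      rcases ih i (hnc i) (h0c i) hψ hi with
        ⟨l, hl, ψ', hψ', hsl, hx⟩ | ⟨u, v, w, P, hu, hw, hP, huw, hμ, hlt⟩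
      · refine Or.inl ⟨l, mem_leaves_node.2 ⟨i, hl⟩, ψ', hψ', hsl, fun x => ?_⟩
        beta_reduce
        rw [bind]
        congr 1
        funext j
        by_cases hji : j = i
        · subst hji; rw [update_self, hx]
        · rw [update_of_ne hji, ← hj j hji]
          refine bind_congr_of_mem fun l' hl' => ?_
          rw [update_of_ne]
          rintro rfl
          exact hji (child_disjoint hF hl' hl)
      · right
        choose vt hvt using fun j => Factors.exists_minLeaf (hnc j)
        -- `G` is contained in child `i`. In the other children the union coincides with `F`, so
        -- their branches are shrunk to leaves and the vertex count does not grow there.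
        have hfam : ∀ j, Factors (c j) s (if j = i then u else fun l => leaf (s l).minLeaf)
            (if j = i then v else vt j) := fun j => by
          split_ifs with hji
          · exact hji ▸ hu
          · exact hvt j
        obtain ⟨u', hu'⟩ := exists_glue (fun i => {l | l ∈ (c i).leaves})
          (fun j => if j = i then u else fun l => leaf (s l).minLeaf) fun i j x => child_disjoint hF
        obtain ⟨v', hv'⟩ := exists_glue (fun i => {x | x ∈ ((c i).bind s).leaves})
          (fun j => if j = i then v else vt j)
          fun i j x => child_disjoint (c := fun i => (c i).bind s) hn
        have hfac : ∀ j, Factors (c j) s u' v' := fun j => (hfam j).congr (hu' j) (hv' j)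
        have hui : (c i).bind u' = (c i).bind u :=
          bind_congr_of_mem fun l hl => by rw [hu' i l hl, if_pos rfl]
        have hvi : ∀ x ∈ ((c i).bind s).leaves, v' x = v x := fun x hx => by
          rw [hv' i x hx, if_pos rfl]
        refine ⟨u', v', w, fun x => PTree.node b (update (fun j => (c j).bind u') i (P x)),
          .node hfac, hw.congr (fun _ _ => rfl) fun x hx => hvi x (hi ▸ hψ.mem_leaves hx),
          .node b _ i P (fun j _ hx => h0c j ((hfac j).mem_leaves hx)) hP, ?_, fun μ hμ' => ?_, ?_⟩
        · rw [bind]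
          congr 1
          funext j
          by_cases hji : j = i
          · subst hji; rw [update_self, hui, huw]
          · rw [update_of_ne hji]
        · simp only [bind]
          congr 1
          funext j
          by_cases hji : j = i
          · subst hji
            rw [update_self, update_self, ← hμ μ hμ']
            refine bind_congr_of_mem fun x hx => hvi x (hu.mem_leaves ?_)
            rw [huw]
            have : (μ.bind w).leaves = (G.bind w).leaves := by
              rw [leaves_bind, leaves_bind, hμ']
            rwa [← hP.leaves_congr this]
          · rw [update_of_ne hji, update_of_ne hji, (hfac j).bind_bind rfl, hj j hji]
        · simp only [bind, numVertices]
          rw [← Finset.add_sum_erase _ _ (Finset.mem_univ i), hui,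
            ← Finset.add_sum_erase _ (fun j => (c j).numVertices) (Finset.mem_univ i)]
          have : ∑ j ∈ Finset.univ.erase i, ((c j).bind u').numVertices =
              ∑ j ∈ Finset.univ.erase i, (c j).numVertices := by
            refine Finset.sum_congr rfl fun j hji => ?_
            rw [← numVertices_bind_minLeaf (c j) fun l => (s l).minLeaf]
            congr 1
            refine bind_congr_of_mem fun l hl => ?_
            rw [hu' j l hl, if_neg (Finset.ne_of_mem_erase hji)]
          omega

/-- If `G` lies inside the branch `s l`, replacing `G` changes only this branch, and replacing `F`
only what is below the branches. The label `l` occurs exactly once in every replacement of `F`, so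
`G` keeps a single place. -/
theorem apart_or_overlap_of_context {F G : PTree ar} {s t : ℕ → PTree ar}
    (hn : (F.bind s).leaves.Nodup) (h0 : 0 ∉ (F.bind s).leaves) (hG : 1 ≤ G.numVertices)
    {ψ : PTree ar → PTree ar} (hψ : IsContext ψ) (h : F.bind s = ψ (G.bind t)) :
    Apart (fun x => x) F s ψ G t ∨ Overlap (fun x => x) F s ψ G t := by
  refine (exists_branch_or_overlap hn h0 hG hψ h).imp_left ?_
  rintro ⟨l, hl, ψ', hψ', hsl, hx⟩
  refine ⟨fun ν μ => ν.bind (update s l (ψ' (μ.bind t))), fun ν => ?_, fun μ => (hx _).symm,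
    fun μ hμ => ⟨_, update s l (ψ' (μ.bind t)), .id, fun l' _ => ?_, fun _ => rfl⟩, fun ν hν => ?_⟩
  · beta_reduce
    rw [← hsl, update_eq_self]
  · by_cases hl' : l' = l
    · subst hl'
      rw [update_self, hsl]
      exact hψ'.leaves_congr (by rw [leaves_bind, leaves_bind, hμ])
    · rw [update_of_ne hl']
  · refine ⟨_, t, (IsContext.of_bind (t := ν) (s := s) (a := l) ?_ ?_).comp hψ', fun _ _ => rfl,
      fun _ => rfl⟩
    · rw [hν]
      exact Multiset.count_eq_one_of_mem (nodup_of_bind hn) hl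
    · intro l' hl' _ hx
      exact h0 (mem_leaves_bind.2 ⟨l', hν ▸ hl', hx⟩)

/-- Two subtrees of a tree either have no vertex in common or the root of one of them belongs to the
other one. -/
theorem apart_or_overlap {F G : PTree ar} {s t : ℕ → PTree ar} (hF : 1 ≤ F.numVertices)
    (hG : 1 ≤ G.numVertices) {φ₁ φ₂ : PTree ar → PTree ar} (hφ₁ : IsContext φ₁)
    (hφ₂ : IsContext φ₂) (hn : (φ₁ (F.bind s)).leaves.Nodup) (h0 : 0 ∉ (φ₁ (F.bind s)).leaves)
    (h : φ₁ (F.bind s) = φ₂ (G.bind t)) :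
    Apart φ₁ F s φ₂ G t ∨ Overlap φ₁ F s φ₂ G t ∨ Overlap φ₂ G t φ₁ F s := by
  induction hφ₁ generalizing φ₂ with
  | id => exact (apart_or_overlap_of_context hn h0 hG hφ₂ h).imp_right Or.inl
  | node b c i φ₁ hc hφ₁ ih =>
    cases hφ₂ with
    | id =>
      rw [h] at hn h0
      rcases apart_or_overlap_of_context hn h0 hF (.node b c i φ₁ hc hφ₁) h.symm with
        h' | h'
      · exact Or.inl h'.symm
      · exact Or.inr (Or.inr h')
    | node b' c' i' φ₂ hc' hφ₂ =>
      simp only [node.injEq] at h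
      obtain ⟨rfl, h⟩ := h
      simp only [heq_eq_eq] at h
      -- Holes in the same child are handled by recursion. Holes in different children give
      -- vertex-disjoint subtrees, and the two child updates commute.
      by_cases hii : i = i'
      · subst hii
        have hcc : ∀ x, update c' i x = update c i x := fun x => by
          have := congrArg (fun f => update f i x) h
          simpa using this.symm
        have hi : φ₁ (F.bind s) = φ₂ (G.bind t) := by simpa using congrFun h i
        rcases ih hφ₂ (by simpa using nodup_child hn i)
          (fun hx => h0 (mem_leaves_node.2 ⟨i, by simpa using hx⟩)) hi with
          ⟨Φ, h1, h2, h3, h4⟩ | ⟨u, v, w, P, hu, hw, hP, huw, hμ, hlt⟩ |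
          ⟨u, v, w, P, hu, hw, hP, huw, hμ, hlt⟩
        · refine Or.inl ⟨fun ν μ => node b (update c i (Φ ν μ)), fun ν => by beta_reduce; rw [h1],
            fun μ => by beta_reduce; rw [h2, hcc], fun μ hμ => ?_, fun ν hν => ?_⟩
          · obtain ⟨φ, s', hφ, hs', h⟩ := h3 μ hμ
            exact ⟨_, s', .node b c i φ hc hφ, hs', fun ν => by beta_reduce; rw [h]⟩
          · obtain ⟨φ, s', hφ, hs', h⟩ := h4 ν hν
            exact ⟨_, s', .node b c i φ hc hφ, hs', fun ν => by beta_reduce; rw [h]⟩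
        · exact Or.inr (Or.inl ⟨u, v, w, P, hu, hw, hP, huw, fun μ h => by
            beta_reduce; rw [hμ μ h, hcc], hlt⟩)
        · exact Or.inr (Or.inr ⟨u, v, w, P, hu, hw, hP, huw, fun μ h => by
            beta_reduce; rw [hμ μ h, hcc], hlt⟩)
      · left
        have hci' : c i' = φ₂ (G.bind t) := by
          have := congrFun h i'
          rwa [update_of_ne (Ne.symm hii), update_self] at this
        have hci : c' i = φ₁ (F.bind s) := by
          have := congrFun h i
          rw [update_of_ne hii, update_self] at this
          exact this.symm
        have hcj : ∀ j, j ≠ i → j ≠ i' → c j = c' j := fun j hj hj' => by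
          have := congrFun h j
          rwa [update_of_ne hj, update_of_ne hj'] at this
        have key : ∀ x y, node b (update (update c i x) i' y) = node b (update (update c' i' y) i x) :=
          fun x y => by
            congr 1
            funext j
            by_cases hj : j = i
            · subst hj; rw [update_of_ne hii, update_self, update_self]
            · by_cases hj' : j = i'
              · subst hj'; rw [update_self, update_of_ne hj, update_self]
              · rw [update_of_ne hj', update_of_ne hj, update_of_ne hj, update_of_ne hj',
                  hcj j hj hj']
        refine ⟨fun ν μ => node b (update (update c i (φ₁ (ν.bind s))) i' (φ₂ (μ.bind t))),
          fun ν => ?_, fun μ => ?_, fun μ hμ => ?_, fun ν hν => ?_⟩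
        · beta_reduce
          rw [← hci', update_comm hii, update_eq_self]
        · beta_reduce
          rw [key, ← hci, update_comm (Ne.symm hii), update_eq_self]
        · refine ⟨_, s, .node b (update c' i' (φ₂ (μ.bind t))) i φ₁ ?_ hφ₁, fun _ _ => rfl,
            fun ν => key _ _⟩
          intro j hj
          by_cases hj' : j = i'
          · subst hj'
            rw [update_self, hφ₂.leaves_congr (y := G.bind t) (by rw [leaves_bind, leaves_bind, hμ]),
              ← hci']
            exact hc j hj
          · rw [update_of_ne hj']
            exact hc' j hj'
        · refine ⟨_, t, .node b (update c i (φ₁ (ν.bind s))) i' φ₂ ?_ hφ₂, fun _ _ => rfl,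
            fun μ => rfl⟩
          intro j hj'
          by_cases hj : j = i
          · subst hj
            rw [update_self, hφ₁.leaves_congr (y := F.bind s) (by rw [leaves_bind, leaves_bind, hν]),
              ← hci]
            exact hc' j hj'
          · rw [update_of_ne hj]
            exact hc j hj

end PTree

end ShuffleOperad

/-! ### Transport of occurrences, and the dichotomy for two occurrences. -/

namespace ShuffleOperad

open Function

namespace TreeMonomial

variable {B : Type*} {ar : B → ℕ+}

theorem strictMonoOn_compBranch {n m i : ℕ} (σ : Shuffle n m i) (β : TreeMonomial ar)
    (hβ : β.arity = m) :
    StrictMonoOn (fun j => (compBranch σ β.tree j).minLeaf) (Set.Icc 1 n) := by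
  intro a ha b hb hab
  rw [Set.mem_Icc] at ha hb
  have hm := β.one_le_arity
  have hself := compBranch_minLeaf_self σ β hβ
  have hlt : ∀ j, j < i → (compBranch σ β.tree j).minLeaf = j := fun j hj => by
    simp [compBranch, hj, minLeaf_leaf]
  have hgt : ∀ j, i < j → (compBranch σ β.tree j).minLeaf = σ.perm (j + m - 1) := fun j hj => by
    simp [compBranch, not_lt_of_gt hj, hj.ne', minLeaf_leaf]
  rcases lt_trichotomy b i with h | h | h
  · simp only [hlt a (hab.trans h), hlt b h]; exact hab
  · subst h; simp only [hlt a hab, hself]; exact hab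
  · have hb' := σ.gt_of_gt (j := b + m - 1) (by omega)
    rcases lt_trichotomy a i with h' | h' | h'
    · simp only [hlt a h', hgt b h]; omega
    · subst h'; simp only [hself, hgt b h]; omega
    · simp only [hgt a h', hgt b h]
      exact σ.mono_outer (by simp only [Set.mem_Icc]; omega)
        (by simp only [Set.mem_Icc]; omega) (by omega)

theorem comp_left_injective {n m i : ℕ} (σ : Shuffle n m i) {α α' β : TreeMonomial ar}
    {hα : α.arity = n} {hα' : α'.arity = n} {hβ : β.arity = m}
    (h : comp σ α β hα hβ = comp σ α' β hα' hβ) : α = α' :=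
  TreeMonomial.ext (PTree.bind_injective_of_nodup (leaves_eq_of_arity_eq (hα.trans hα'.symm))
    (comp σ α β hα hβ).leaves_nodup (congrArg tree h))

theorem shuffle_index_mem {n m i : ℕ} (σ : Shuffle n m i) {α : TreeMonomial ar}
    (hα : α.arity = n) : i ∈ α.tree.leaves :=
  mem_leaves.2 ⟨σ.one_le, hα ▸ σ.le_arity⟩

theorem compBranch_self {n m i : ℕ} (σ : Shuffle n m i) (β : PTree ar) :
    compBranch σ β i = β.relabel fun l => σ.perm (i + l - 1) := by
  rw [compBranch, if_neg (lt_irrefl _), if_pos rfl]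

theorem comp_right_injective {n m i : ℕ} (σ : Shuffle n m i) {α β β' : TreeMonomial ar}
    {hα : α.arity = n} {hβ : β.arity = m} {hβ' : β'.arity = m}
    (h : comp σ α β hα hβ = comp σ α β' hα hβ') : β = β' := by
  have hi := shuffle_index_mem σ hα
  have h1 := PTree.eq_of_bind_eq (congrArg tree h) i hi
  have h2 := PTree.nodup_branch (comp σ α β hα hβ).leaves_nodup hi
  rw [compBranch_self] at h2
  rw [compBranch_self, compBranch_self] at h1
  exact TreeMonomial.ext
    (PTree.bind_injective_of_nodup (leaves_eq_of_arity_eq (hβ.trans hβ'.symm)) h2 h1)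

namespace Occurrence

variable {α β γ : TreeMonomial ar}

theorem exists_of_context {φ : PTree ar → PTree ar} (hφ : PTree.IsContext φ) {s : ℕ → PTree ar}
    (hs : StrictMonoOn (fun l => (s l).minLeaf) (Set.Icc 1 β.arity))
    (h : α.tree = φ (β.tree.bind s)) :
    ∃ o : Occurrence α β, ∀ ν, ∀ hν : ν.arity = β.arity,
      (o.replaceMonomial ν hν).tree = φ (ν.tree.bind s) := by
  obtain ⟨U, hU, hUφ⟩ := hφ.exists_upper
  exact ⟨⟨U, hU, s, hs, by rw [h, hUφ]⟩, fun ν hν => (hUφ _).symm⟩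

theorem isContext (o : Occurrence α β) :
    PTree.IsContext fun x => o.upper.bind fun l => if l = 0 then x else .leaf l := by
  have := PTree.IsContext.of_bind (s := PTree.leaf) o.count_hole fun l _ hl h => by
    rw [PTree.leaves_leaf, Multiset.mem_singleton] at h
    exact hl h.symm
  convert this using 3 with x
  funext l
  rw [update_apply]

theorem tree_eq (o : Occurrence α β) (ν : TreeMonomial ar) (hν : ν.arity = β.arity) :
    (o.replaceMonomial ν hν).tree =
      o.upper.bind fun l => if l = 0 then ν.tree.bind o.branch else .leaf l := rfl

theorem branch_leaves_subset (o : Occurrence α β) {l x : ℕ} (hl : l ∈ β.tree.leaves)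
    (hx : x ∈ (o.branch l).leaves) : x ∈ α.tree.leaves :=
  o.inner_mem_leaves (PTree.mem_leaves_bind.2 ⟨l, hl, hx⟩)

theorem upper_leaves_subset (o : Occurrence α β) {l : ℕ} (hl : l ∈ o.upper.leaves) (h0 : l ≠ 0) :
    l ∈ α.tree.leaves := by
  rw [o.eq, PTree.mem_leaves_bind]
  exact ⟨l, hl, by rw [if_neg h0, PTree.leaves_leaf, Multiset.mem_singleton]⟩

/-- Grafting onto the leaves of `α`, with smallest leaves in increasing order, extends the branches
of the occurrence without disturbing their order. This is the common source of transitivity of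
occurrences and of their survival under composition on either side. -/
theorem exists_context_bind (o : Occurrence α β) {c : ℕ → PTree ar}
    (hc : StrictMonoOn (fun l => (c l).minLeaf) {l | l ∈ α.tree.leaves})
    (h0 : ∀ l ∈ α.tree.leaves, 0 ∉ (c l).leaves) :
    ∃ φ s, PTree.IsContext φ ∧ StrictMonoOn (fun l => (s l).minLeaf) (Set.Icc 1 β.arity) ∧
      ∀ ν, ∀ hν : ν.arity = β.arity, (o.replaceMonomial ν hν).tree.bind c = φ (ν.tree.bind s) := by
  refine ⟨_, fun l => (o.branch l).bind c, PTree.IsContext.of_bind (s := c) o.count_hole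
    fun l hl hl0 => h0 l (o.upper_leaves_subset hl hl0), ?_, fun ν hν => ?_⟩
  · have hsub : ∀ l ∈ Set.Icc 1 β.arity, {x | x ∈ (o.branch l).leaves} ⊆ {l | l ∈ α.tree.leaves} :=
      fun l hl x hx => o.branch_leaves_subset (mem_leaves.2 hl) hx
    intro a ha b hb hab
    simp only [PTree.minLeaf_bind _ c (hc.mono (hsub a ha)),
      PTree.minLeaf_bind _ c (hc.mono (hsub b hb))]
    exact hc (hsub a ha (PTree.minLeaf_mem _)) (hsub b hb (PTree.minLeaf_mem _)) (o.mono ha hb hab)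
  · rw [tree_eq, PTree.bind_bind]
    refine PTree.bind_congr_of_mem fun l _ => ?_
    by_cases hl : l = 0
    · subst hl; rw [if_pos rfl, update_self, PTree.bind_bind]
    · rw [if_neg hl, update_of_ne hl, PTree.bind]

theorem exists_trans (o : Occurrence α γ) {γ' : TreeMonomial ar} (h : γ'.arity = γ.arity)
    (o' : Occurrence γ' β) : ∃ o'' : Occurrence (o.replaceMonomial γ' h) β,
      ∀ ν, ∀ hν : ν.arity = β.arity, o''.replaceMonomial ν hν =
        o.replaceMonomial (o'.replaceMonomial ν hν) ((o'.arity_replaceMonomial ν hν).trans h) := by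
  have hl := leaves_eq_of_arity_eq h
  obtain ⟨φ, s, hφ, hs, he⟩ := o'.exists_context_bind (c := o.branch)
    (o.mono.mono fun l hl' => mem_leaves.1 (hl ▸ hl')) fun l hl' h0 =>
      α.zero_notMem_leaves (o.branch_leaves_subset (hl ▸ hl') h0)
  obtain ⟨o'', ho⟩ := exists_of_context (α := o.replaceMonomial γ' h) (o.isContext.comp hφ) hs (by
    rw [← he β rfl, replaceMonomial_self]; rfl)
  exact ⟨o'', fun ν hν => TreeMonomial.ext (by rw [ho ν hν, ← he ν hν]; rfl)⟩

theorem exists_comp_left (o : Occurrence α β) {n m i : ℕ} (σ : Shuffle n m i)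
    {δ : TreeMonomial ar} (hα : α.arity = n) (hδ : δ.arity = m) :
    ∃ o' : Occurrence (comp σ α δ hα hδ) β, ∀ ν, ∀ hν : ν.arity = β.arity,
      o'.replaceMonomial ν hν =
        comp σ (o.replaceMonomial ν hν) δ ((o.arity_replaceMonomial ν hν).trans hα) hδ := by
  obtain ⟨φ, s, hφ, hs, he⟩ := o.exists_context_bind (c := compBranch σ δ.tree)
    ((strictMonoOn_compBranch σ δ hδ).mono fun l hl => hα ▸ mem_leaves.1 hl) fun l hl h0 =>
      (comp σ α δ hα hδ).zero_notMem_leaves (PTree.mem_leaves_bind.2 ⟨l, hl, h0⟩)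
  obtain ⟨o', ho⟩ := exists_of_context (α := comp σ α δ hα hδ) hφ hs (by
    rw [← he β rfl, replaceMonomial_self]; rfl)
  exact ⟨o', fun ν hν => TreeMonomial.ext (by rw [ho ν hν, ← he ν hν]; rfl)⟩

theorem exists_comp_right (o : Occurrence α β) {n m i : ℕ} (σ : Shuffle n m i)
    {δ : TreeMonomial ar} (hδ : δ.arity = n) (hα : α.arity = m) :
    ∃ o' : Occurrence (comp σ δ α hδ hα) β, ∀ ν, ∀ hν : ν.arity = β.arity,
      o'.replaceMonomial ν hν =
        comp σ δ (o.replaceMonomial ν hν) hδ ((o.arity_replaceMonomial ν hν).trans hα) := by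
  have hi := shuffle_index_mem σ hδ
  have h0 := (comp σ δ α hδ hα).zero_notMem_leaves
  obtain ⟨φ, s, hφ, hs, he⟩ := o.exists_context_bind (c := fun l => .leaf (σ.perm (i + l - 1)))
    (strictMonoOn_relabel σ α hα) fun l hl hz => h0 (PTree.mem_leaves_bind.2 ⟨i, hi, by
      rw [compBranch_self, PTree.relabel]
      exact PTree.mem_leaves_bind.2 ⟨l, hl, hz⟩⟩)
  have hψ := PTree.IsContext.of_bind (t := δ.tree) (s := compBranch σ α.tree) (a := i)
    (Multiset.count_eq_one_of_mem δ.leaves_nodup hi) fun l hl _ hz =>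
      h0 (PTree.mem_leaves_bind.2 ⟨l, hl, hz⟩)
  have key : ∀ β' : PTree ar, δ.tree.bind (compBranch σ β') = δ.tree.bind
      (update (compBranch σ α.tree) i (β'.bind fun l => .leaf (σ.perm (i + l - 1)))) := by
    intro β'
    refine PTree.bind_congr_of_mem fun l _ => ?_
    by_cases hl : l = i
    · subst hl; rw [update_self, compBranch_self]; rfl
    · rw [update_of_ne hl, compBranch, compBranch]
      split_ifs
      · rfl
      · rfl
  obtain ⟨o', ho⟩ := exists_of_context (α := comp σ δ α hδ hα) (hψ.comp hφ) hs (by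
    rw [← he β rfl, replaceMonomial_self]; exact key _)
  exact ⟨o', fun ν hν => TreeMonomial.ext (by rw [ho ν hν, ← he ν hν]; exact (key _).symm)⟩

/-- The two occurrences are occurrences in a small common multiple that occurs in `α`. -/
def IsSmall {F G : TreeMonomial ar} (o₁ : Occurrence α F) (o₂ : Occurrence α G) : Prop :=
  ∃ (γ : TreeMonomial ar) (o : Occurrence α γ) (p₁ : Occurrence γ F) (p₂ : Occurrence γ G),
    γ.numVertices < F.numVertices + G.numVertices ∧
    (∀ ν, ∀ hν : ν.arity = F.arity, o.replaceMonomial (p₁.replaceMonomial ν hν)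
      (p₁.arity_replaceMonomial ν hν) = o₁.replaceMonomial ν hν) ∧
    ∀ μ, ∀ hμ : μ.arity = G.arity, o.replaceMonomial (p₂.replaceMonomial μ hμ)
      (p₂.arity_replaceMonomial μ hμ) = o₂.replaceMonomial μ hμ

/-- The two occurrences can be replaced independently of each other. -/
def IsIndependent {F G : TreeMonomial ar} (o₁ : Occurrence α F) (o₂ : Occurrence α G) : Prop :=
  ∃ Φ : TreeMonomial ar → TreeMonomial ar → TreeMonomial ar,
    (∀ ν, ∀ hν : ν.arity = F.arity, Φ ν G = o₁.replaceMonomial ν hν) ∧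
    (∀ μ, ∀ hμ : μ.arity = G.arity, Φ F μ = o₂.replaceMonomial μ hμ) ∧
    (∀ μ, μ.arity = G.arity → ∃ o : Occurrence (Φ F μ) F,
      ∀ ν, ∀ hν : ν.arity = F.arity, o.replaceMonomial ν hν = Φ ν μ) ∧
    ∀ ν, ν.arity = F.arity → ∃ o : Occurrence (Φ ν G) G,
      ∀ μ, ∀ hμ : μ.arity = G.arity, o.replaceMonomial μ hμ = Φ ν μ

theorem IsSmall.symm {F G : TreeMonomial ar} {o₁ : Occurrence α F} {o₂ : Occurrence α G}
    (h : o₁.IsSmall o₂) : o₂.IsSmall o₁ := by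
  obtain ⟨γ, o, p₁, p₂, hlt, h1, h2⟩ := h
  exact ⟨γ, o, p₂, p₁, by rwa [add_comm], h2, h1⟩

/-- The union `F.tree.bind u` is labelled by the smallest descendants of its leaves in `α`. Its
standardization is `γ`, and since ranking is increasing, the branches of `F` and `G` inside `γ` keep
the order they have in `α`. -/
theorem isSmall_of_overlap {F G : TreeMonomial ar} (o₁ : Occurrence α F) (o₂ : Occurrence α G)
    (h : PTree.Overlap (fun x => o₁.upper.bind fun l => if l = 0 then x else .leaf l) F.tree
      o₁.branch (fun x => o₂.upper.bind fun l => if l = 0 then x else .leaf l) G.tree o₂.branch) :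
    o₁.IsSmall o₂ := by
  obtain ⟨u, v, w, P, hu, hw, hP, huw, hμ, hlt⟩ := h
  have hWv := hu.bind_bind rfl
  have hn : (F.tree.bind u).leaves.Nodup := PTree.nodup_of_bind (s := v) (hWv ▸ o₁.inner_nodup)
  -- With `v` grafted on, the union is a subtree of the canonical tree `α`; each `v x` has smallest
  -- leaf `x`, so it may be cut back to the leaf `x`.
  have hcan : (F.tree.bind u).IsCanonical := by
    have h1 : ((F.tree.bind u).bind v).IsCanonical := hWv ▸ o₁.inner_isCanonical
    have h2 := h1.bind_congr_minLeaf (s' := PTree.leaf)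
      (fun x hx => by rw [hu.minLeaf_eq hx, PTree.minLeaf_leaf]) fun _ _ => trivial
    rwa [PTree.bind_leaf] at h2
  obtain ⟨γ, e, r, hγ, hγe, he, hr, h1, h2⟩ := PTree.exists_standardization hcan hn
  have hver : ∀ {x : PTree ar}, x.leaves = (F.tree.bind u).leaves →
      (x.relabel r).bind (fun l => v (e l)) = x.bind v := fun {x} hx => by
    rw [PTree.relabel_bind]
    exact PTree.bind_congr_of_mem fun l hl => by rw [(h2 l (hx ▸ hl)).2]
  obtain ⟨o, ho⟩ := exists_of_context (α := α) (β := γ) o₁.isContext (s := fun l => v (e l))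
    (fun a ha b hb hab => by
      simp only [hu.minLeaf_eq (h1 a ha).1, hu.minLeaf_eq (h1 b hb).1]
      exact he ha hb hab)
    (by rw [hγ, hver rfl, hWv]; exact o₁.eq)
  have hmono : ∀ {H : TreeMonomial ar} {q t : ℕ → PTree ar}, PTree.Factors H.tree t q v →
      (∀ l ∈ H.tree.leaves, ∀ x ∈ (q l).leaves, x ∈ (F.tree.bind u).leaves) →
      StrictMonoOn (fun l => (t l).minLeaf) (Set.Icc 1 H.arity) →
      StrictMonoOn (fun l => ((q l).relabel r).minLeaf) (Set.Icc 1 H.arity) := by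
    intro H q t hq hsub ht a ha b hb hab
    have ha' := mem_leaves.2 ha
    have hb' := mem_leaves.2 hb
    simp only [PTree.minLeaf_relabel (hr.mono (hsub a ha')),
      PTree.minLeaf_relabel (hr.mono (hsub b hb'))]
    refine hr (hsub a ha' _ (PTree.minLeaf_mem _)) (hsub b hb' _ (PTree.minLeaf_mem _)) ?_
    rw [hq.minLeaf_branch ha', hq.minLeaf_branch hb']
    exact ht ha hb hab
  obtain ⟨p₁, hp₁⟩ := exists_of_context (α := γ) (β := F) .id
    (hmono hu (fun l hl x hx => PTree.mem_leaves_bind.2 ⟨l, hl, hx⟩) o₁.mono)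
    (by rw [hγ, PTree.bind_relabel])
  -- Ranks start at 1, so relabelling never produces the reserved hole label 0.
  obtain ⟨P', hP', hPr⟩ := hP.exists_relabel (r := r) (y := G.tree.bind w) fun l hl => by
    rw [← huw] at hl
    have := (h2 l hl).1.1
    omega
  obtain ⟨p₂, hp₂⟩ := exists_of_context (α := γ) (β := G) hP'
    (hmono hw (fun l hl x hx => huw ▸ hP.mem_leaves (PTree.mem_leaves_bind.2 ⟨l, hl, hx⟩)) o₂.mono)
    (by rw [hγ, huw, hPr, PTree.bind_relabel])
  refine ⟨γ, o, p₁, p₂, ?_, fun ν hν => TreeMonomial.ext ?_, fun μ hμ' => TreeMonomial.ext ?_⟩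
  · rw [numVertices, hγ, PTree.numVertices_relabel]
    exact hlt
  · have hl := leaves_eq_of_arity_eq hν
    rw [ho, hp₁, ← PTree.bind_relabel, hver (by rw [PTree.leaves_bind, PTree.leaves_bind, hl]),
      hu.bind_bind hl]
    rfl
  · have hl := leaves_eq_of_arity_eq hμ'
    rw [ho, hp₂, ← PTree.bind_relabel, ← hPr, hver]
    · exact hμ _ hl
    · rw [huw]
      exact hP.leaves_congr (by rw [PTree.leaves_bind, PTree.leaves_bind, hl])

theorem isIndependent_of_apart {F G : TreeMonomial ar} (o₁ : Occurrence α F) (o₂ : Occurrence α G)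
    (h : PTree.Apart (fun x => o₁.upper.bind fun l => if l = 0 then x else .leaf l) F.tree
      o₁.branch (fun x => o₂.upper.bind fun l => if l = 0 then x else .leaf l) G.tree o₂.branch) :
    o₁.IsIndependent o₂ := by
  classical
  obtain ⟨Φ, h1, h2, h3, h4⟩ := h
  -- `Φ` acts on bare trees. The default value `ν` is never reached when the arities are those of
  -- `F` and `G`, because the result is then a replacement in a tree monomial.
  let Ψ : TreeMonomial ar → TreeMonomial ar → TreeMonomial ar := fun ν μ =>
    if h : ∃ γ : TreeMonomial ar, γ.tree = Φ ν.tree μ.tree then h.choose else ν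
  have hΨ : ∀ ν μ : TreeMonomial ar, (∃ γ : TreeMonomial ar, γ.tree = Φ ν.tree μ.tree) →
      (Ψ ν μ).tree = Φ ν.tree μ.tree := fun ν μ h => by
    simp only [Ψ]
    rw [dif_pos h]
    exact h.choose_spec
  have e1 : ∀ ν, ∀ hν : ν.arity = F.arity, Ψ ν G = o₁.replaceMonomial ν hν := fun ν hν =>
    TreeMonomial.ext ((hΨ ν G ⟨o₁.replaceMonomial ν hν, (h1 _).symm⟩).trans (h1 _))
  have e2 : ∀ μ, ∀ hμ : μ.arity = G.arity, Ψ F μ = o₂.replaceMonomial μ hμ := fun μ hμ =>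
    TreeMonomial.ext ((hΨ F μ ⟨o₂.replaceMonomial μ hμ, (h2 _).symm⟩).trans (h2 _))
  refine ⟨Ψ, e1, e2, fun μ hμ => ?_, fun ν hν => ?_⟩
  · obtain ⟨φ, s, hφ, hs, h⟩ := h3 μ.tree (leaves_eq_of_arity_eq hμ)
    obtain ⟨o, ho⟩ := exists_of_context (α := Ψ F μ) (β := F) hφ (s := s) (by
      refine o₁.mono.congr fun l hl => (PTree.minLeaf_congr (hs l (mem_leaves.2 hl))).symm) (by
      rw [hΨ F μ ⟨o₂.replaceMonomial μ hμ, (h2 _).symm⟩, h])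
    refine ⟨o, fun ν hν => TreeMonomial.ext ?_⟩
    have := (ho ν hν).trans (h _).symm
    rw [this, hΨ ν μ ⟨_, this⟩]
  · obtain ⟨φ, s, hφ, hs, h⟩ := h4 ν.tree (leaves_eq_of_arity_eq hν)
    obtain ⟨o, ho⟩ := exists_of_context (α := Ψ ν G) (β := G) hφ (s := s) (by
      refine o₂.mono.congr fun l hl => (PTree.minLeaf_congr (hs l (mem_leaves.2 hl))).symm) (by
      rw [hΨ ν G ⟨o₁.replaceMonomial ν hν, (h1 _).symm⟩, h])
    refine ⟨o, fun μ hμ => TreeMonomial.ext ?_⟩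
    have := (ho μ hμ).trans (h _).symm
    rw [this, hΨ ν μ ⟨_, this⟩]

/-- The combinatorial heart of the theorem: occurrences sharing no vertex are harmless, and those
sharing a vertex are controlled by an S-polynomial. -/
theorem isIndependent_or_isSmall {F G : TreeMonomial ar} (o₁ : Occurrence α F)
    (o₂ : Occurrence α G) (hF : 1 ≤ F.numVertices) (hG : 1 ≤ G.numVertices) :
    o₁.IsIndependent o₂ ∨ o₁.IsSmall o₂ := by
  rcases PTree.apart_or_overlap (F := F.tree) (G := G.tree) (s := o₁.branch) (t := o₂.branch) hF hG
    o₁.isContext o₂.isContext (o₁.eq ▸ α.leaves_nodup) (o₁.eq ▸ α.zero_notMem_leaves)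
    (o₁.eq.symm.trans o₂.eq) with h | h | h
  · exact Or.inl (o₁.isIndependent_of_apart o₂ h)
  · exact Or.inr (o₁.isSmall_of_overlap o₂ h)
  · exact Or.inr (o₂.isSmall_of_overlap o₁ h).symm

end Occurrence

end TreeMonomial

end ShuffleOperad

/-! ### Linear extension of replacements and compositions. -/

namespace ShuffleOperad

open TreeMonomial

variable {K : Type*} [Field K] {B : Type*} {ar : B → ℕ+}

theorem mapDomain_eq_linearCombination (ψ : TreeMonomial ar → TreeMonomial ar)
    (f : FreeOperad K ar) : f.mapDomain ψ =
      Finsupp.linearCombination K (fun γ => (Finsupp.single (ψ γ) 1 : FreeOperad K ar)) f := by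
  rw [Finsupp.linearCombination_apply, Finsupp.mapDomain]
  refine Finsupp.sum_congr fun γ _ => ?_
  rw [Finsupp.smul_single_one]

theorem linearCombination_congr_on {v w : TreeMonomial ar → FreeOperad K ar} {f : FreeOperad K ar}
    (h : ∀ γ ∈ f.support, v γ = w γ) :
    Finsupp.linearCombination K v f = Finsupp.linearCombination K w f := by
  rw [Finsupp.linearCombination_apply, Finsupp.linearCombination_apply]
  exact Finsupp.sum_congr fun γ hγ => by rw [h γ hγ]

namespace FreeOperad

/-- All tree monomials of `f` belong to `S`. -/
def SupportedOn (S : Set (TreeMonomial ar)) (f : FreeOperad K ar) : Prop :=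
  f ∈ Finsupp.supported K K S

theorem SupportedOn.mono {f : FreeOperad K ar} {S T : Set (TreeMonomial ar)}
    (hf : SupportedOn S f) (h : S ⊆ T) : SupportedOn T f := fun _ hμ => h (hf hμ)

theorem SupportedOn.mapDomain {S T : Set (TreeMonomial ar)} {f : FreeOperad K ar}
    (hf : SupportedOn S f) {ψ : TreeMonomial ar → TreeMonomial ar} (h : ∀ μ ∈ S, ψ μ ∈ T) :
    SupportedOn T (f.mapDomain ψ) := by
  classical
  intro μ hμ
  obtain ⟨ν, hν, rfl⟩ := Finset.mem_image.1 (Finsupp.mapDomain_support hμ)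
  exact h ν (hf hν)

/-- On elements of the correct arity the case distinction disappears, and any total extension `ψ` of
the partial operation on monomials may be used. -/
theorem replace_eq_mapDomain {α β : TreeMonomial ar} (o : α.Occurrence β)
    {ψ : TreeMonomial ar → TreeMonomial ar}
    (hψ : ∀ γ, ∀ h : γ.arity = β.arity, ψ γ = o.replaceMonomial γ h) {f : FreeOperad K ar}
    (hf : ∀ γ ∈ f.support, γ.arity = β.arity) : replace o f = f.mapDomain ψ := by
  rw [mapDomain_eq_linearCombination, replace]
  exact linearCombination_congr_on fun γ hγ => by rw [dif_pos (hf γ hγ), hψ γ (hf γ hγ)]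

theorem replace_eq_zero {α β : TreeMonomial ar} (o : α.Occurrence β) {f : FreeOperad K ar}
    (hf : ∀ γ ∈ f.support, γ.arity ≠ β.arity) : replace o f = 0 := by
  rw [replace, linearCombination_congr_on (w := fun _ => 0) fun γ hγ => by rw [dif_neg (hf γ hγ)],
    Finsupp.linearCombination_apply]
  simp

theorem replace_sub {α β : TreeMonomial ar} (o : α.Occurrence β) (f g : FreeOperad K ar) :
    replace o (f - g) = replace o f - replace o g := map_sub _ _ _

theorem replace_smul {α β : TreeMonomial ar} (o : α.Occurrence β) (a : K) (f : FreeOperad K ar) :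
    replace o (a • f) = a • replace o f := map_smul _ _ _

theorem exists_replacement {α β : TreeMonomial ar} (o : α.Occurrence β) :
    ∃ ψ : TreeMonomial ar → TreeMonomial ar,
      ∀ γ, ∀ h : γ.arity = β.arity, ψ γ = o.replaceMonomial γ h :=
  let ⟨ψ, _, h⟩ := o.exists_composite
  ⟨ψ, h⟩

section comp

variable {n m i : ℕ}

open Classical in
/-- The composition of a tree monomial with an element. -/
noncomputable def compMonomial (σ : Shuffle n m i) (g : FreeOperad K ar) (α : TreeMonomial ar) :
    FreeOperad K ar :=
  Finsupp.linearCombination K (fun β => if h : α.arity = n ∧ β.arity = m then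
    (Finsupp.single (TreeMonomial.comp σ α β h.1 h.2) 1 : FreeOperad K ar) else 0) g

theorem comp_eq (σ : Shuffle n m i) (f g : FreeOperad K ar) :
    comp σ f g = Finsupp.linearCombination K (compMonomial σ g) f := rfl

theorem compMonomial_of_arity_ne (σ : Shuffle n m i) (g : FreeOperad K ar) {α : TreeMonomial ar}
    (h : α.arity ≠ n) : compMonomial σ g α = 0 := by
  rw [compMonomial, linearCombination_congr_on (w := fun _ => 0) fun γ _ => by
    rw [dif_neg fun h' => h h'.1], Finsupp.linearCombination_apply]
  simp

theorem exists_comp_monomial (σ : Shuffle n m i) {α : TreeMonomial ar} (hα : α.arity = n) :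
    ∃ θ : TreeMonomial ar → TreeMonomial ar,
      ∀ β, ∀ hβ : β.arity = m, θ β = TreeMonomial.comp σ α β hα hβ := by
  classical
  exact ⟨fun β => if hβ : β.arity = m then TreeMonomial.comp σ α β hα hβ else β,
    fun β hβ => dif_pos hβ⟩

theorem component_apply_mem {f : FreeOperad K ar} {k : ℕ} {μ : TreeMonomial ar}
    (h : μ ∈ (component k f).support) : μ.arity = k := by
  classical
  rw [component, Finsupp.support_filter, Finset.mem_filter] at h
  exact h.2

theorem linearCombination_component {v : TreeMonomial ar → FreeOperad K ar} {k : ℕ}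
    (hv : ∀ γ : TreeMonomial ar, γ.arity ≠ k → v γ = 0) (f : FreeOperad K ar) :
    Finsupp.linearCombination K v f = Finsupp.linearCombination K v (component k f) := by
  classical
  have h := Finsupp.filter_add_filter_not f (fun γ : TreeMonomial ar => γ.arity = k)
  conv_lhs => rw [← h]
  rw [map_add]
  have h0 : Finsupp.linearCombination K v (f.filter fun γ => ¬ γ.arity = k) = 0 := by
    rw [linearCombination_congr_on (w := fun _ => 0) fun γ hγ => ?_,
      Finsupp.linearCombination_apply]
    · simp
    · rw [Finsupp.support_filter, Finset.mem_filter] at hγ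
      exact hv γ hγ.2
  rw [h0, add_zero, component]

theorem compMonomial_eq_mapDomain (σ : Shuffle n m i) (g : FreeOperad K ar) {α : TreeMonomial ar}
    (hα : α.arity = n) {θ : TreeMonomial ar → TreeMonomial ar}
    (hθ : ∀ β, ∀ hβ : β.arity = m, θ β = TreeMonomial.comp σ α β hα hβ) :
    compMonomial σ g α = (component m g).mapDomain θ := by
  rw [mapDomain_eq_linearCombination, compMonomial, linearCombination_component (k := m)]
  · refine linearCombination_congr_on fun γ hγ => ?_
    have := component_apply_mem hγ
    rw [dif_pos ⟨hα, this⟩, hθ γ this]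
  · intro γ hγ
    rw [dif_neg fun h => hγ h.2]

theorem comp_add_left (σ : Shuffle n m i) (f f' g : FreeOperad K ar) :
    comp σ (f + f') g = comp σ f g + comp σ f' g := map_add _ _ _

theorem comp_smul_left (σ : Shuffle n m i) (a : K) (f g : FreeOperad K ar) :
    comp σ (a • f) g = a • comp σ f g := map_smul _ _ _

theorem comp_zero_left (σ : Shuffle n m i) (g : FreeOperad K ar) : comp σ 0 g = 0 := map_zero _

theorem comp_add_right (σ : Shuffle n m i) (f g g' : FreeOperad K ar) :
    comp σ f (g + g') = comp σ f g + comp σ f g' := by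
  simp only [comp_eq, Finsupp.linearCombination_apply, compMonomial, map_add, smul_add,
    Finsupp.sum_add]

theorem comp_smul_right (σ : Shuffle n m i) (a : K) (f g : FreeOperad K ar) :
    comp σ f (a • g) = a • comp σ f g := by
  simp only [comp_eq, Finsupp.linearCombination_apply, compMonomial, map_smul, Finsupp.smul_sum,
    smul_comm a]

theorem comp_zero_right (σ : Shuffle n m i) (f : FreeOperad K ar) : comp σ f 0 = 0 := by
  have := comp_smul_right σ 0 f 0
  rwa [zero_smul, zero_smul] at this

theorem comp_component_left (σ : Shuffle n m i) (f g : FreeOperad K ar) :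
    comp σ f g = comp σ (component n f) g :=
  linearCombination_component (fun _ h => compMonomial_of_arity_ne σ g h) f

theorem comp_eq_zero_left (σ : Shuffle n m i) {f : FreeOperad K ar} (g : FreeOperad K ar)
    (h : component n f = 0) : comp σ f g = 0 := by
  rw [comp_component_left, h]
  exact map_zero _

theorem comp_eq_zero_right (σ : Shuffle n m i) (f : FreeOperad K ar) {g : FreeOperad K ar}
    (h : component m g = 0) : comp σ f g = 0 := by
  rw [comp_eq, linearCombination_congr_on (w := fun _ => 0), Finsupp.linearCombination_apply]
  · simp
  · intro α _
    by_cases hα : α.arity = n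
    · obtain ⟨θ, hθ⟩ := exists_comp_monomial (ar := ar) σ hα
      rw [compMonomial_eq_mapDomain σ g hα hθ, h, Finsupp.mapDomain_zero]
    · exact compMonomial_of_arity_ne σ g hα

theorem component_eq_self {f : FreeOperad K ar} {k : ℕ} (h : ∀ γ ∈ f.support, γ.arity = k) :
    component k f = f := by
  classical
  rw [component, Finsupp.filter_eq_self_iff]
  exact fun γ hγ => h γ (Finsupp.mem_support_iff.2 hγ)

theorem component_eq_zero {f : FreeOperad K ar} {k : ℕ} (h : ∀ γ ∈ f.support, γ.arity ≠ k) :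
    component k f = 0 := by
  classical
  rw [component, Finsupp.filter_eq_zero_iff]
  intro γ hγ
  by_contra h0
  exact h γ (Finsupp.mem_support_iff.2 h0) hγ

theorem comp_homogeneous (σ : Shuffle n m i) (f g : FreeOperad K ar) :
    ∀ γ ∈ (comp σ f g).support, γ.arity = n + m - 1 := by
  suffices h : SupportedOn {γ | γ.arity = n + m - 1} (comp σ f g) from h
  rw [SupportedOn, comp_eq, Finsupp.linearCombination_apply]
  refine Submodule.sum_mem _ fun α _ => Submodule.smul_mem _ _ ?_
  by_cases hα : α.arity = n
  · obtain ⟨θ, hθ⟩ := exists_comp_monomial (ar := ar) σ hα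
    rw [compMonomial_eq_mapDomain σ g hα hθ]
    refine SupportedOn.mapDomain (S := {γ | γ.arity = m}) (fun γ hγ => component_apply_mem hγ) ?_
    intro β hβ
    rw [hθ β hβ]
    exact arity_comp _ _ _ _ _
  · rw [compMonomial_of_arity_ne σ g hα]
    exact Submodule.zero_mem _

theorem comp_mapDomain_single (σ : Shuffle n m i) {f : FreeOperad K ar}
    {ψ ψ' : TreeMonomial ar → TreeMonomial ar} {δ : TreeMonomial ar} (hδ : δ.arity = m)
    (h : ∀ γ ∈ f.support, ∃ h : (ψ γ).arity = n, ψ' γ = TreeMonomial.comp σ (ψ γ) δ h hδ) :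
    comp σ (f.mapDomain ψ) (Finsupp.single δ 1) = f.mapDomain ψ' := by
  rw [comp_eq, Finsupp.linearCombination_mapDomain, mapDomain_eq_linearCombination]
  refine linearCombination_congr_on fun γ hγ => ?_
  obtain ⟨h1, h2⟩ := h γ hγ
  simp only [Function.comp_apply, compMonomial]
  rw [Finsupp.linearCombination_single, one_smul, dif_pos ⟨h1, hδ⟩, h2]

theorem comp_single_mapDomain (σ : Shuffle n m i) {f : FreeOperad K ar}
    {ψ ψ' : TreeMonomial ar → TreeMonomial ar} {δ : TreeMonomial ar} (hδ : δ.arity = n) (a : K)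
    (h : ∀ γ ∈ f.support, ∃ h : (ψ γ).arity = m, ψ' γ = TreeMonomial.comp σ δ (ψ γ) hδ h) :
    comp σ (Finsupp.single δ a) (f.mapDomain ψ) = a • f.mapDomain ψ' := by
  rw [comp_eq, Finsupp.linearCombination_single, compMonomial, Finsupp.linearCombination_mapDomain,
    mapDomain_eq_linearCombination]
  congr 1
  refine linearCombination_congr_on fun γ hγ => ?_
  obtain ⟨h1, h2⟩ := h γ hγ
  simp only [Function.comp_apply]
  rw [dif_pos ⟨hδ, h1⟩, h2]

end comp

/-- The unit of the free operad. -/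
def _root_.ShuffleOperad.TreeMonomial.unit : TreeMonomial ar where
  tree := .leaf 1
  isCanonical := trivial
  leaves_eq := by simp [PTree.leaves]

theorem _root_.ShuffleOperad.TreeMonomial.arity_unit :
    (TreeMonomial.unit : TreeMonomial ar).arity = 1 := rfl

/-- The trivial shuffle. -/
def _root_.ShuffleOperad.Shuffle.refl (m : ℕ) : Shuffle 1 m 1 where
  perm := Equiv.refl ℕ
  one_le := le_rfl
  le_arity := le_rfl
  fixed := fun _ _ => rfl
  mono_inner := fun _ _ _ _ h => h
  mono_outer := fun _ _ _ _ h => h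

theorem unit_comp {β : TreeMonomial ar} {m : ℕ} (hβ : β.arity = m) :
    TreeMonomial.comp (Shuffle.refl m) .unit β arity_unit hβ = β := by
  refine TreeMonomial.ext ?_
  have : (TreeMonomial.comp (Shuffle.refl m) .unit β arity_unit hβ).tree =
    compBranch (Shuffle.refl m) β.tree 1 := rfl
  rw [this, compBranch_self]
  exact PTree.relabel_eq_self fun l _ => by simp [Shuffle.refl]

/-- Scalars are absorbed by composing with a multiple of the unit. Homogeneity matters because a
composition discards the components of other arities. -/
theorem ObtainedFrom.smul {g f : FreeOperad K ar} (h : ObtainedFrom g f) (hf : IsHomogeneous f)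
    (a : K) : ObtainedFrom g (a • f) := by
  obtain ⟨m, hm⟩ := hf
  have h1 := comp_single_mapDomain (Shuffle.refl m) (f := f) (ψ := id) (ψ' := id) arity_unit a
    fun γ hγ => ⟨hm γ hγ, (unit_comp (hm γ hγ)).symm⟩
  rw [Finsupp.mapDomain_id] at h1
  rw [← h1]
  exact h.comp_right _ _ _

theorem ObtainedFrom.mapDomain {n m : ℕ} {ψ : TreeMonomial ar → TreeMonomial ar}
    (hψ : Composite n m ψ) {g : FreeOperad K ar} (hg : ∀ γ ∈ g.support, γ.arity = n) :
    ObtainedFrom g (g.mapDomain ψ) := by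
  induction hψ with
  | id => rw [Finsupp.mapDomain_id]; exact .self
  | left σ ψ ψ' δ hδ _ h ih =>
    rw [← comp_mapDomain_single σ hδ fun γ hγ => h γ (hg γ hγ)]
    exact ih.comp_left _ _ _
  | right σ ψ ψ' δ hδ _ h ih =>
    have := comp_single_mapDomain (f := g) σ hδ (1 : K) fun γ hγ => h γ (hg γ hγ)
    rw [one_smul] at this
    rw [← this]
    exact ih.comp_right _ _ _

theorem ObtainedFrom.replace {α β : TreeMonomial ar} (o : α.Occurrence β) {g : FreeOperad K ar}
    (hg : ∀ γ ∈ g.support, γ.arity = β.arity) : ObtainedFrom g (replace o g) := by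
  obtain ⟨ψ, h1, h2⟩ := o.exists_composite
  rw [replace_eq_mapDomain o h2 hg]
  exact .mapDomain h1 hg

theorem replace_homogeneous {α β : TreeMonomial ar} (o : α.Occurrence β) {g : FreeOperad K ar}
    (hg : ∀ γ ∈ g.support, γ.arity = β.arity) : ∀ γ ∈ (replace o g).support, γ.arity = α.arity := by
  obtain ⟨ψ, hψ⟩ := exists_replacement o
  rw [replace_eq_mapDomain o hψ hg]
  refine SupportedOn.mapDomain (S := {γ | γ.arity = β.arity}) (T := {γ | γ.arity = α.arity}) hg ?_
  intro γ hγ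
  rw [hψ γ hγ]
  exact o.arity_replaceMonomial γ hγ

theorem IsIdeal.obtainedFrom_mem {M : Submodule K (FreeOperad K ar)} (hM : IsIdeal M)
    {g f : FreeOperad K ar} (hg : g ∈ M) (h : ObtainedFrom g f) : f ∈ M := by
  induction h with
  | self => exact hg
  | comp_left σ f h _ ih => exact hM.comp_mem_left _ _ _ σ f ih h
  | comp_right σ f h _ ih => exact hM.comp_mem_right _ _ _ σ f ih h

/-! ### Leading terms of replacements and compositions. -/

section order

variable [LinearOrder (TreeMonomial ar)]

open Set

theorem leadTerm_eq_coe {f : FreeOperad K ar} {α : TreeMonomial ar} :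
    leadTerm f = α ↔ f α ≠ 0 ∧ SupportedOn (Iic α) f := by
  rw [← Finsupp.mem_support_iff, leadTerm]
  constructor
  · intro h
    exact ⟨Finset.mem_of_max h, fun μ hμ => Finset.le_max_of_eq hμ h⟩
  · rintro ⟨h1, h2⟩
    refine le_antisymm (Finset.max_le fun μ hμ => WithBot.coe_le_coe.2 (h2 hμ)) (Finset.le_max h1)

theorem leadTerm_zero : leadTerm (0 : FreeOperad K ar) = ⊥ := rfl

theorem exists_leadTerm {f : FreeOperad K ar} (hf : f ≠ 0) :
    ∃ α : TreeMonomial ar, leadTerm f = α := by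
  obtain ⟨α, h⟩ := Finset.max_of_nonempty (Finsupp.support_nonempty_iff.2 hf)
  exact ⟨α, h⟩

theorem ne_zero_of_leadTerm {f : FreeOperad K ar} {α : TreeMonomial ar} (h : leadTerm f = α) :
    f ≠ 0 := by
  rintro rfl
  exact (leadTerm_eq_coe.1 h).1 rfl

theorem IsHomogeneous.arity_eq {f : FreeOperad K ar} (hf : IsHomogeneous f) {α : TreeMonomial ar}
    (h : leadTerm f = α) : ∀ γ ∈ f.support, γ.arity = α.arity := by
  obtain ⟨n, hn⟩ := hf
  intro γ hγ
  rw [hn γ hγ, hn α (Finsupp.mem_support_iff.2 (leadTerm_eq_coe.1 h).1)]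

theorem SupportedOn.Iio_of_Iic {f : FreeOperad K ar} {α : TreeMonomial ar}
    (hf : SupportedOn (Iic α) f) (h : f α = 0) : SupportedOn (Iio α) f := fun _ hμ =>
  lt_of_le_of_ne (hf hμ) fun heq =>
    Finsupp.mem_support_iff.1 hμ (heq ▸ h)

theorem SupportedOn.apply_eq_zero {f : FreeOperad K ar} {α : TreeMonomial ar}
    (hf : SupportedOn (Iio α) f) : f α = 0 := by
  by_contra h
  exact lt_irrefl _ (hf (Finsupp.mem_support_iff.2 h))

theorem leadTerm_lt {f : FreeOperad K ar} {α : TreeMonomial ar} (hf : SupportedOn (Iio α) f) :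
    leadTerm f < α := by
  by_cases h : f = 0
  · rw [h, leadTerm_zero]
    exact WithBot.bot_lt_coe α
  · obtain ⟨μ, hμ⟩ := exists_leadTerm h
    rw [hμ, WithBot.coe_lt_coe]
    exact hf (Finsupp.mem_support_iff.2 (leadTerm_eq_coe.1 hμ).1)

theorem leadTerm_smul {f : FreeOperad K ar} {α : TreeMonomial ar} (h : leadTerm f = α) {a : K}
    (ha : a ≠ 0) : leadTerm (a • f) = α := by
  rw [leadTerm_eq_coe] at h ⊢
  exact ⟨by simpa using ⟨ha, h.1⟩, Submodule.smul_mem _ _ h.2⟩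

theorem leadTerm_add {f g : FreeOperad K ar} {α : TreeMonomial ar} (h : leadTerm f = α)
    (hg : SupportedOn (Iio α) g) : leadTerm (f + g) = α := by
  rw [leadTerm_eq_coe] at h ⊢
  exact ⟨by rw [Finsupp.add_apply, hg.apply_eq_zero, add_zero]; exact h.1,
    Submodule.add_mem _ h.2 (hg.mono Iio_subset_Iic_self)⟩

/-- No two terms merge under a map that is strictly increasing on the support, so the largest term
keeps its coefficient and stays largest. -/
theorem mapDomain_leadTerm {f : FreeOperad K ar} {α : TreeMonomial ar} (h : leadTerm f = α)
    {ψ : TreeMonomial ar → TreeMonomial ar} (hψ : StrictMonoOn ψ f.support) :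
    f.mapDomain ψ (ψ α) = f α ∧ leadTerm (f.mapDomain ψ) = ψ α := by
  have h' := leadTerm_eq_coe.1 h
  have hα := Finsupp.mem_support_iff.2 h'.1
  have h1 : f.mapDomain ψ (ψ α) = f α :=
    Finsupp.mapDomain_apply' f.support f (le_refl _) hψ.injOn hα
  refine ⟨h1, leadTerm_eq_coe.2 ⟨h1 ▸ h'.1, SupportedOn.mapDomain (S := f.support)
    (fun _ h => h) fun μ hμ => hψ.monotoneOn hμ hα (h'.2 hμ)⟩⟩

theorem replace_leadTerm (hord : IsAdmissible ar) {α β : TreeMonomial ar} (o : α.Occurrence β)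
    {g : FreeOperad K ar} (hg : IsHomogeneous g) (h : leadTerm g = β) :
    replace o g α = g β ∧ leadTerm (replace o g) = α := by
  obtain ⟨ψ, hψ⟩ := exists_replacement o
  have harity := hg.arity_eq h
  have hα : ψ β = α := by rw [hψ β rfl, o.replaceMonomial_self]
  rw [replace_eq_mapDomain o hψ harity]
  have := mapDomain_leadTerm h (ψ := ψ) fun γ hγ γ' hγ' hlt => by
    rw [hψ γ (harity γ hγ), hψ γ' (harity γ' hγ')]
    exact o.replaceMonomial_strictMono hord _ _ hlt
  rwa [hα] at this

/-- Composition is injective in each argument, so the monotonicity of an admissible ordering is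
strict and the product of the leading terms cannot cancel. Only the components of arities `n` and
`m` contribute. -/
theorem comp_leadTerm (hord : IsAdmissible ar) {n m i : ℕ} (σ : Shuffle n m i)
    {f g : FreeOperad K ar} {α β : TreeMonomial ar} (hα : α.arity = n) (hβ : β.arity = m)
    (hf : leadTerm (component n f) = α) (hg : leadTerm (component m g) = β) :
    leadTerm (comp σ f g) = TreeMonomial.comp σ α β hα hβ := by
  have key : ∀ α', ∀ hα' : α'.arity = n,
      leadTerm (compMonomial σ g α') = TreeMonomial.comp σ α' β hα' hβ := fun α' hα' => by
    obtain ⟨θ, hθ⟩ := exists_comp_monomial (ar := ar) σ hα'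
    rw [compMonomial_eq_mapDomain σ g hα' hθ, ← hθ β hβ]
    refine (mapDomain_leadTerm hg fun γ hγ γ' hγ' hlt => ?_).2
    have h1 := component_apply_mem hγ
    have h2 := component_apply_mem hγ'
    rw [hθ γ h1, hθ γ' h2]
    exact lt_of_le_of_ne (hord.comp_le_comp _ _ _ σ _ _ _ _ hα' hα' h1 h2 le_rfl hlt.le)
      fun heq => hlt.ne (comp_right_injective σ heq)
  have hf' := leadTerm_eq_coe.1 hf
  rw [comp_component_left, comp_eq, Finsupp.linearCombination_apply, Finsupp.sum,
    ← Finset.add_sum_erase _ _ (Finsupp.mem_support_iff.2 hf'.1)]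
  refine leadTerm_add (leadTerm_smul (key α hα) hf'.1) ?_
  refine Submodule.sum_mem _ fun α' hα'' => Submodule.smul_mem _ _ ?_
  have hmem := Finset.mem_of_mem_erase hα''
  have hα' := component_apply_mem hmem
  have hlt : α' < α := lt_of_le_of_ne (hf'.2 hmem) (Finset.ne_of_mem_erase hα'')
  refine SupportedOn.mono (leadTerm_eq_coe.1 (key α' hα')).2 (Iic_subset_Iio.2 ?_)
  exact lt_of_le_of_ne (hord.comp_le_comp _ _ _ σ _ _ _ _ hα' hα hβ hβ hlt.le le_rfl)
      fun heq => hlt.ne (comp_left_injective σ heq)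

end order

end FreeOperad

end ShuffleOperad

/-! ### The ideal as a span of replacements, and the diamond argument. -/

namespace ShuffleOperad

open TreeMonomial Set

variable {K : Type*} [Field K] {B : Type*} {ar : B → ℕ+}

namespace TreeMonomial.Occurrence

theorem exists_self (β : TreeMonomial ar) : ∃ o : Occurrence β β,
    ∀ ν, ∀ hν : ν.arity = β.arity, o.replaceMonomial ν hν = ν := by
  obtain ⟨o, ho⟩ := exists_of_context (α := β) (β := β) .id (s := .leaf)
    (fun a _ b _ h => by simpa only [PTree.minLeaf_leaf] using h) (PTree.bind_leaf _).symm
  exact ⟨o, fun ν hν => TreeMonomial.ext ((ho ν hν).trans (PTree.bind_leaf _))⟩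

/-- The entire tree `α` is the branch on the only leaf of `β`. This settles leading terms without
vertices, to which the dichotomy for occurrences does not apply. -/
theorem nonempty_of_numVertices_eq_zero {α β : TreeMonomial ar} (h : β.numVertices = 0) :
    Nonempty (Occurrence α β) := by
  obtain ⟨l, hl⟩ := PTree.exists_leaf_of_numVertices_eq_zero h
  have h1 : β.arity = 1 := by rw [arity, hl]; simp [PTree.leaves]
  obtain ⟨o, -⟩ := exists_of_context (α := α) (β := β) .id (s := fun _ => α.tree)
    (fun a ha b hb h => by
      rw [h1, Set.mem_Icc] at ha hb
      omega) (by rw [hl]; rfl)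
  exact ⟨o⟩

end TreeMonomial.Occurrence

namespace FreeOperad

theorem component_add (k : ℕ) (f g : FreeOperad K ar) :
    component k (f + g) = component k f + component k g := Finsupp.filter_add

theorem component_smul (k : ℕ) (a : K) (f : FreeOperad K ar) :
    component k (a • f) = a • component k f := Finsupp.filter_smul

theorem replace_replace {α α' β γ γ' : TreeMonomial ar} (o : Occurrence α γ) (p : Occurrence γ' β)
    (hγ : γ'.arity = γ.arity) (q : Occurrence α' β) (h : ∀ ν, ∀ hν : ν.arity = β.arity,
      o.replaceMonomial (p.replaceMonomial ν hν) ((p.arity_replaceMonomial ν hν).trans hγ) =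
        q.replaceMonomial ν hν) {f : FreeOperad K ar} (hf : ∀ γ ∈ f.support, γ.arity = β.arity) :
    replace o (replace p f) = replace q f := by
  obtain ⟨ψ, hψ⟩ := exists_replacement o
  obtain ⟨θ, hθ⟩ := exists_replacement p
  rw [replace_eq_mapDomain o hψ fun μ hμ => (replace_homogeneous p hf μ hμ).trans hγ,
    replace_eq_mapDomain p hθ hf, ← Finsupp.mapDomain_comp,
    replace_eq_mapDomain q (fun ν hν => ?_) hf]
  rw [Function.comp_apply, hθ ν hν, hψ _ ((p.arity_replaceMonomial ν hν).trans hγ), h]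

variable [LinearOrder (TreeMonomial ar)]

/-- The span of the elements `m_{α, lt g}(g)` with `g` in `G` and `α` in `S`. -/
noncomputable def replaceSpan (G : Set (FreeOperad K ar)) (S : Set (TreeMonomial ar)) :
    Submodule K (FreeOperad K ar) :=
  Submodule.span K {f | ∃ g ∈ G, ∃ β : TreeMonomial ar, leadTerm g = β ∧
    ∃ α ∈ S, ∃ o : Occurrence α β, f = replace o g}

variable {G : Set (FreeOperad K ar)}

theorem replaceSpan_mono {S T : Set (TreeMonomial ar)} (h : S ⊆ T) :
    replaceSpan G S ≤ replaceSpan G T :=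
  Submodule.span_mono fun _ ⟨g, hg, β, hβ, α, hα, o⟩ => ⟨g, hg, β, hβ, α, h hα, o⟩

theorem replace_mem_replaceSpan {S : Set (TreeMonomial ar)} {g : FreeOperad K ar} (hg : g ∈ G)
    {α β : TreeMonomial ar} (hβ : leadTerm g = β) (hα : α ∈ S) (o : Occurrence α β) :
    replace o g ∈ replaceSpan G S :=
  Submodule.subset_span ⟨g, hg, β, hβ, α, hα, o, rfl⟩

theorem supportedOn_of_mem_replaceSpan (hord : IsAdmissible ar) (hG : ∀ g ∈ G, IsHomogeneous g)
    {S T : Set (TreeMonomial ar)} (h : ∀ α ∈ S, Iic α ⊆ T) {f : FreeOperad K ar}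
    (hf : f ∈ replaceSpan G S) : SupportedOn T f := by
  refine Submodule.span_le.2 ?_ hf
  rintro _ ⟨g, hg, β, hβ, α, hα, o, rfl⟩
  exact (leadTerm_eq_coe.1 (replace_leadTerm hord o (hG g hg) hβ).2).2.mono (h α hα)

/-- A linear combination involves finitely many `α`, and the largest of them bounds the others. -/
theorem exists_mem_replaceSpan_Iic {S : Set (TreeMonomial ar)} {f : FreeOperad K ar}
    (hf : f ∈ replaceSpan G S) : f = 0 ∨ ∃ α ∈ S, f ∈ replaceSpan G (Iic α) := by
  induction hf using Submodule.span_induction with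
  | mem x hx =>
    obtain ⟨g, hg, β, hβ, α, hα, o, rfl⟩ := hx
    exact Or.inr ⟨α, hα, replace_mem_replaceSpan hg hβ self_mem_Iic o⟩
  | zero => exact Or.inl rfl
  | add x y _ _ hx hy =>
    rcases hx with rfl | ⟨α, hα, hx⟩
    · rwa [zero_add]
    · rcases hy with rfl | ⟨α', hα', hy⟩
      · rw [add_zero]; exact Or.inr ⟨α, hα, hx⟩
      · rcases le_total α α' with h | h
        · exact Or.inr ⟨α', hα', Submodule.add_mem _
            (replaceSpan_mono (Iic_subset_Iic.2 h) hx) hy⟩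
        · exact Or.inr ⟨α, hα, Submodule.add_mem _ hx
            (replaceSpan_mono (Iic_subset_Iic.2 h) hy)⟩
  | smul a x _ hx =>
    rcases hx with rfl | ⟨α, hα, hx⟩
    · left; rw [smul_zero]
    · exact Or.inr ⟨α, hα, Submodule.smul_mem _ _ hx⟩

/-- By linearity in `h` it suffices to compose with a tree monomial `δ`; then the occurrence in `α`
becomes one in `α ∘ δ`, and the result is the replacement for that occurrence. Wrong arities give
zero. -/
theorem comp_replace_left_mem (hG : ∀ g ∈ G, IsHomogeneous g) {n m i : ℕ} (σ : Shuffle n m i)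
    {g : FreeOperad K ar} (hg : g ∈ G) {α β : TreeMonomial ar} (hβ : leadTerm g = β)
    (o : Occurrence α β) (h : FreeOperad K ar) :
    comp σ (replace o g) h ∈ replaceSpan G univ := by
  have harity := (hG g hg).arity_eq hβ
  induction h using Finsupp.induction_linear with
  | zero => rw [comp_zero_right]; exact Submodule.zero_mem _
  | add h h' ih ih' => rw [comp_add_right]; exact Submodule.add_mem _ ih ih'
  | single δ a =>
    rw [← mul_one a, ← smul_eq_mul, ← Finsupp.smul_single, comp_smul_right]
    refine Submodule.smul_mem _ _ ?_
    by_cases hα : α.arity = n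
    · by_cases hδ : δ.arity = m
      · obtain ⟨ψ, hψ⟩ := exists_replacement o
        obtain ⟨o', ho'⟩ := o.exists_comp_left σ hα hδ
        obtain ⟨ψ', hψ'⟩ := exists_replacement o'
        rw [replace_eq_mapDomain o hψ harity, comp_mapDomain_single σ (ψ' := ψ') hδ,
          ← replace_eq_mapDomain o' hψ' harity]
        · exact replace_mem_replaceSpan hg hβ (mem_univ _) o'
        · intro γ hγ
          have h1 := harity γ hγ
          rw [hψ γ h1, hψ' γ h1, ho' γ h1]
          exact ⟨_, rfl⟩
      · rw [comp_eq_zero_right]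
        · exact Submodule.zero_mem _
        · exact component_eq_zero fun γ hγ => by
            rwa [Finset.mem_singleton.1 (Finsupp.support_single_subset hγ)]
    · rw [comp_eq_zero_left]
      · exact Submodule.zero_mem _
      · exact component_eq_zero fun γ hγ => by rwa [replace_homogeneous o harity γ hγ]

theorem comp_replace_right_mem (hG : ∀ g ∈ G, IsHomogeneous g) {n m i : ℕ} (σ : Shuffle n m i)
    {g : FreeOperad K ar} (hg : g ∈ G) {α β : TreeMonomial ar} (hβ : leadTerm g = β)
    (o : Occurrence α β) (h : FreeOperad K ar) :
    comp σ h (replace o g) ∈ replaceSpan G univ := by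
  have harity := (hG g hg).arity_eq hβ
  induction h using Finsupp.induction_linear with
  | zero => rw [comp_zero_left]; exact Submodule.zero_mem _
  | add h h' ih ih' => rw [comp_add_left]; exact Submodule.add_mem _ ih ih'
  | single δ a =>
    by_cases hα : α.arity = m
    · by_cases hδ : δ.arity = n
      · obtain ⟨ψ, hψ⟩ := exists_replacement o
        obtain ⟨o', ho'⟩ := o.exists_comp_right σ hδ hα
        obtain ⟨ψ', hψ'⟩ := exists_replacement o'
        rw [replace_eq_mapDomain o hψ harity, comp_single_mapDomain σ (ψ' := ψ') hδ,
          ← replace_eq_mapDomain o' hψ' harity]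
        · exact Submodule.smul_mem _ _ (replace_mem_replaceSpan hg hβ (mem_univ _) o')
        · intro γ hγ
          have h1 := harity γ hγ
          rw [hψ γ h1, hψ' γ h1, ho' γ h1]
          exact ⟨_, rfl⟩
      · rw [comp_eq_zero_left]
        · exact Submodule.zero_mem _
        · exact component_eq_zero fun γ hγ => by
            rwa [Finset.mem_singleton.1 (Finsupp.support_single_subset hγ)]
    · rw [comp_eq_zero_right]
      · exact Submodule.zero_mem _
      · exact component_eq_zero fun γ hγ => by rwa [replace_homogeneous o harity γ hγ]

theorem isIdeal_replaceSpan (hG : ∀ g ∈ G, IsHomogeneous g) : IsIdeal (replaceSpan G univ) where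
  component_mem n f hf := by
    induction hf using Submodule.span_induction with
    | mem x hx =>
      obtain ⟨g, hg, β, hβ, α, hα, o, rfl⟩ := hx
      have h := replace_homogeneous o ((hG g hg).arity_eq hβ)
      by_cases hn : α.arity = n
      · rw [component_eq_self fun γ hγ => (h γ hγ).trans hn]
        exact replace_mem_replaceSpan hg hβ hα o
      · rw [component_eq_zero fun γ hγ => by rwa [h γ hγ]]
        exact Submodule.zero_mem _
    | zero => rw [component_eq_zero (by simp)]; exact Submodule.zero_mem _
    | add x y _ _ hx hy => rw [component_add]; exact Submodule.add_mem _ hx hy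
    | smul a x _ hx => rw [component_smul]; exact Submodule.smul_mem _ _ hx
  comp_mem_left n m i σ f hf h := by
    induction hf using Submodule.span_induction with
    | mem x hx =>
      obtain ⟨g, hg, β, hβ, α, hα, o, rfl⟩ := hx
      exact comp_replace_left_mem hG σ hg hβ o h
    | zero => rw [comp_zero_left]; exact Submodule.zero_mem _
    | add x y _ _ hx hy => rw [comp_add_left]; exact Submodule.add_mem _ hx hy
    | smul a x _ hx => rw [comp_smul_left]; exact Submodule.smul_mem _ _ hx
  comp_mem_right n m i σ f hf h := by
    induction hf using Submodule.span_induction with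
    | mem x hx =>
      obtain ⟨g, hg, β, hβ, α, hα, o, rfl⟩ := hx
      exact comp_replace_right_mem hG σ hg hβ o h
    | zero => rw [comp_zero_right]; exact Submodule.zero_mem _
    | add x y _ _ hx hy => rw [comp_add_right]; exact Submodule.add_mem _ hx hy
    | smul a x _ hx => rw [comp_smul_right]; exact Submodule.smul_mem _ _ hx

/-- The span is an ideal, and it contains each nonzero `g` in `G` through the occurrence of `lt g`
in itself; minimality of `M` does the rest. -/
theorem le_replaceSpan (hG : ∀ g ∈ G, IsHomogeneous g) {M : Submodule K (FreeOperad K ar)}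
    (hM : IsGeneratedBy M G) : M ≤ replaceSpan G univ := by
  refine hM.2 ⟨isIdeal_replaceSpan hG, fun g hg => ?_⟩
  by_cases h0 : g = 0
  · rw [h0]; exact Submodule.zero_mem _
  · obtain ⟨β, hβ⟩ := exists_leadTerm h0
    obtain ⟨o, ho⟩ := Occurrence.exists_self β
    have h := replace_eq_mapDomain o (ψ := id) (fun γ hγ => (ho γ hγ).symm)
      ((hG g hg).arity_eq hβ)
    rw [Finsupp.mapDomain_id] at h
    rw [SetLike.mem_coe, ← h]
    exact replace_mem_replaceSpan hg hβ (mem_univ _) o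

/-- In the double sum, the terms with `μ = γ` form `g γ • replace o₁ f`. For each `μ < γ` the inner
sum is a multiple of a replacement by `f` with leading term `Φ β μ`, which is the result of putting
`μ` in place of `γ` in `α` and hence smaller than `α`. -/
theorem sub_mem_replaceSpan_of_independent (hord : IsAdmissible ar)
    {f g : FreeOperad K ar} (hf : f ∈ G) (hfh : IsHomogeneous f) (hgh : IsHomogeneous g)
    {α β γ : TreeMonomial ar} (hβ : leadTerm f = β) (hγ : leadTerm g = γ)
    (o₁ : Occurrence α β) (o₂ : Occurrence α γ)
    {Φ : TreeMonomial ar → TreeMonomial ar → TreeMonomial ar}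
    (h₁ : ∀ ν, ∀ hν : ν.arity = β.arity, Φ ν γ = o₁.replaceMonomial ν hν)
    (h₂ : ∀ μ, ∀ hμ : μ.arity = γ.arity, Φ β μ = o₂.replaceMonomial μ hμ)
    (h₃ : ∀ μ, μ.arity = γ.arity → ∃ o : Occurrence (Φ β μ) β,
      ∀ ν, ∀ hν : ν.arity = β.arity, o.replaceMonomial ν hν = Φ ν μ) :
    (g.sum fun μ b => f.sum fun ν a => Finsupp.single (Φ ν μ) (a * b)) - g γ • replace o₁ f ∈
      replaceSpan G (Iio α) := by
  have hfa := hfh.arity_eq hβ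
  have hga := hgh.arity_eq hγ
  have hg' := leadTerm_eq_coe.1 hγ
  have hγs := Finsupp.mem_support_iff.2 hg'.1
  have hmap : ∀ (μ : TreeMonomial ar) (b : K), (f.sum fun ν a =>
      (Finsupp.single (Φ ν μ) (a * b) : FreeOperad K ar)) = b • f.mapDomain fun ν => Φ ν μ := by
    intro μ b
    rw [Finsupp.mapDomain, Finsupp.smul_sum]
    exact Finsupp.sum_congr fun ν _ => by rw [Finsupp.smul_single, smul_eq_mul, mul_comm]
  simp only [hmap]
  rw [Finsupp.sum, ← Finset.add_sum_erase _ _ hγs,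
    replace_eq_mapDomain o₁ (ψ := fun ν => Φ ν γ) h₁ hfa, add_sub_cancel_left]
  refine Submodule.sum_mem _ fun μ hμ => Submodule.smul_mem _ _ ?_
  have hμs := Finset.mem_of_mem_erase hμ
  have hμa := hga μ hμs
  have hlt : μ < γ := lt_of_le_of_ne (hg'.2 hμs) (Finset.ne_of_mem_erase hμ)
  obtain ⟨o, ho⟩ := h₃ μ hμa
  rw [← replace_eq_mapDomain o (fun ν hν => (ho ν hν).symm) hfa]
  refine replace_mem_replaceSpan hf hβ ?_ o
  rw [mem_Iio, h₂ μ hμa]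
  have := o₂.replaceMonomial_strictMono hord hμa rfl hlt
  rwa [o₂.replaceMonomial_self] at this

/-- Each reduction subtracts a multiple of a replacement located at the current leading term, which
stays below `α`; the subtracted terms add up to `f`. -/
theorem mem_replaceSpan_of_reducesToZero (hord : IsAdmissible ar) (hG : ∀ g ∈ G, IsHomogeneous g)
    {α : TreeMonomial ar} {f : FreeOperad K ar} (h : ReducesToZero G f)
    (hf : SupportedOn (Iio α) f) : f ∈ replaceSpan G (Iio α) := by
  induction h using Relation.ReflTransGen.head_induction_on with
  | refl => exact Submodule.zero_mem _
  | @head f' _ h _ ih =>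
    obtain ⟨g, hg, α', β, hα', hβ, o, rfl⟩ := h
    have hlt : α' < α := hf (Finsupp.mem_support_iff.2 (leadTerm_eq_coe.1 hα').1)
    have h1 := Submodule.smul_mem _ (f' α' / g β) (replace_mem_replaceSpan hg hβ (mem_Iio.2 hlt) o)
    have h2 := ih (Submodule.sub_mem _ hf (supportedOn_of_mem_replaceSpan hord hG
      (fun μ hμ => Iic_subset_Iio.2 hμ) h1))
    have h3 := Submodule.add_mem _ h2 h1
    rwa [sub_add_cancel] at h3

/-- Occurrences compose, so replacing inside a replacement is again a replacement, and strict
monotonicity carries "below `γ`" to "below `α`". Generators of another arity are sent to zero. -/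
theorem replace_mem_replaceSpan_of_mem (hord : IsAdmissible ar) (hG : ∀ g ∈ G, IsHomogeneous g)
    {α γ : TreeMonomial ar} (o : Occurrence α γ) {f : FreeOperad K ar}
    (hf : f ∈ replaceSpan G (Iio γ)) : replace o f ∈ replaceSpan G (Iio α) := by
  have hle : replaceSpan G (Iio γ) ≤ (replaceSpan G (Iio α)).comap
      (⟨⟨replace o, fun _ _ => map_add _ _ _⟩, fun a f => replace_smul o a f⟩ :
        FreeOperad K ar →ₗ[K] FreeOperad K ar) := by
    refine Submodule.span_le.2 ?_
    rintro _ ⟨g, hg, β, hβ, γ', hγ', p, rfl⟩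
    change replace o (replace p g) ∈ replaceSpan G (Iio α)
    have hga := (hG g hg).arity_eq hβ
    by_cases h : γ'.arity = γ.arity
    · obtain ⟨q, hq⟩ := o.exists_trans h p
      have hlt := o.replaceMonomial_strictMono hord h rfl hγ'
      rw [o.replaceMonomial_self] at hlt
      rw [replace_replace o p h q (fun ν hν => (hq ν hν).symm) hga]
      exact replace_mem_replaceSpan hg hβ (mem_Iio.2 hlt) q
    · rw [replace_eq_zero o fun μ hμ => by rwa [replace_homogeneous p hga μ hμ]]
      exact Submodule.zero_mem _
  exact hle hf

/-- Two elements `m_{α, lt f}(f)` and `m_{α, lt g}(g)` with the same leading term agree up to a scalar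
and up to elements with smaller leading terms. -/
theorem smul_sub_smul_mem_replaceSpan (hord : IsAdmissible ar) (hG : ∀ g ∈ G, IsHomogeneous g)
    (hS : ∀ f ∈ G, ∀ g ∈ G, ∀ s, IsSPolynomial f g s → ReducesToZero G s)
    (hpos : ∀ g ∈ G, ∀ β : TreeMonomial ar, leadTerm g = β → 1 ≤ β.numVertices)
    {f g : FreeOperad K ar} (hf : f ∈ G) (hg : g ∈ G) {α β γ : TreeMonomial ar}
    (hβ : leadTerm f = β) (hγ : leadTerm g = γ) (o₁ : Occurrence α β) (o₂ : Occurrence α γ) :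
    g γ • replace o₁ f - f β • replace o₂ g ∈ replaceSpan G (Iio α) := by
  rcases o₁.isIndependent_or_isSmall o₂ (hpos f hf β hβ) (hpos g hg γ hγ) with
    ⟨Φ, h1, h2, h3, h4⟩ | ⟨δ, o, p₁, p₂, hlt, h1, h2⟩
  -- Disjoint case: both scaled replacements agree with the same double sum modulo smaller terms. It
  -- is summed once over `g` outside and once over `f` outside, and cancels in the difference.
  · have e1 := sub_mem_replaceSpan_of_independent (G := G) hord hf (hG f hf) (hG g hg) hβ hγ o₁ o₂
      h1 h2 h3
    have e2 := sub_mem_replaceSpan_of_independent (G := G) hord hg (hG g hg) (hG f hf) hγ hβ o₂ o₁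
      (Φ := fun ν μ => Φ μ ν) h2 h1 h4
    rw [Finsupp.sum_comm] at e2
    simp only [mul_comm] at e1 e2
    have := Submodule.sub_mem _ e2 e1
    rwa [sub_sub_sub_cancel_left] at this
  · have hg0 := (leadTerm_eq_coe.1 hγ).1
    have l1 := replace_leadTerm hord p₁ (hG f hf) hβ
    have l2 := replace_leadTerm hord p₂ (hG g hg) hγ
    -- Overlapping case: the coefficient at `δ` cancels in the S-polynomial, so its representation
    -- lies strictly below `δ`. Applying `m_{α,δ}` and clearing the denominator `g γ` gives the
    -- claim.
    have hs := mem_replaceSpan_of_reducesToZero (α := δ) hord hG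
      (hS f hf g hg _ ⟨β, γ, δ, hβ, hγ, hlt, p₁, p₂, rfl⟩)
      (SupportedOn.Iio_of_Iic (Submodule.sub_mem _ (leadTerm_eq_coe.1 l1.2).2
        (Submodule.smul_mem _ _ (leadTerm_eq_coe.1 l2.2).2)) (by
          rw [Finsupp.sub_apply, Finsupp.smul_apply, l1.1, l2.1, smul_eq_mul,
            div_mul_cancel₀ _ hg0, sub_self]))
    have h := Submodule.smul_mem _ (g γ) (replace_mem_replaceSpan_of_mem hord hG o hs)
    rwa [replace_sub, replace_smul, replace_replace o p₁ rfl o₁ h1 ((hG f hf).arity_eq hβ),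
      replace_replace o p₂ rfl o₂ h2 ((hG g hg).arity_eq hγ), smul_sub, smul_smul,
      mul_div_cancel₀ _ hg0] at h

theorem isGroebnerBasis_of_sPolynomials [WellFoundedLT (TreeMonomial ar)]
    (hord : IsAdmissible ar) (hG : ∀ g ∈ G, IsHomogeneous g) {M : Submodule K (FreeOperad K ar)}
    (hM : IsGeneratedBy M G)
    (hS : ∀ f ∈ G, ∀ g ∈ G, ∀ s, IsSPolynomial f g s → ReducesToZero G s) :
    IsGroebnerBasis G M := by
  intro f hfM hf0
  -- If some leading term has no vertex, it divides every tree monomial and there is nothing else to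
  -- prove.
  by_cases hpos : ∀ g ∈ G, ∀ β : TreeMonomial ar, leadTerm g = β → 1 ≤ β.numVertices
  · obtain ⟨α₀, -, hα₀⟩ := (exists_mem_replaceSpan_Iic (le_replaceSpan hG hM hfM)).resolve_left hf0
    obtain ⟨α, hα, hmin⟩ := WellFounded.has_min (wellFounded_lt (α := TreeMonomial ar))
      {α | f ∈ replaceSpan G (Iic α)} ⟨α₀, hα₀⟩
    have hnot : f ∉ replaceSpan G (Iio α) := fun h => by
      obtain ⟨α', hlt, hα'⟩ := (exists_mem_replaceSpan_Iic h).resolve_left hf0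
      exact hmin α' hα' hlt
    by_cases hex : ∃ g ∈ G, ∃ β : TreeMonomial ar, leadTerm g = β ∧ Nonempty (Occurrence α β)
    · obtain ⟨g, hg, β, hβ, ⟨o⟩⟩ := hex
      have hg0 := (leadTerm_eq_coe.1 hβ).1
      -- Modulo smaller terms, all generators located at `α` are multiples of the one chosen
      -- generator `replace o g`.
      have hle : replaceSpan G (Iic α) ≤
          Submodule.span K {replace o g} ⊔ replaceSpan G (Iio α) := by
        refine Submodule.span_le.2 ?_
        rintro _ ⟨g', hg', β', hβ', α', hα', o', rfl⟩
        rcases (show α' ≤ α from hα').lt_or_eq with h | rfl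
        · exact Submodule.mem_sup_right (replace_mem_replaceSpan hg' hβ' (mem_Iio.2 h) o')
        · refine Submodule.mem_sup.2 ⟨(g β)⁻¹ • g' β' • replace o g, Submodule.smul_mem _ _
            (Submodule.smul_mem _ _ (Submodule.mem_span_singleton_self _)), _,
            Submodule.smul_mem _ (g β)⁻¹
              (smul_sub_smul_mem_replaceSpan hord hG hS hpos hg' hg hβ' hβ o' o), ?_⟩
          rw [smul_sub, add_sub_cancel, inv_smul_smul₀ hg0]
      obtain ⟨x, hx, l, hl, rfl⟩ := Submodule.mem_sup.1 (hle hα)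
      obtain ⟨a, rfl⟩ := Submodule.mem_span_singleton.1 hx
      -- Otherwise `f` would have a representation strictly below the minimal `α`.
      have ha : a ≠ 0 := by
        rintro rfl
        rw [zero_smul, zero_add] at hnot
        exact hnot hl
      exact ⟨g, hg, α, β, leadTerm_add
        (leadTerm_smul (replace_leadTerm hord o (hG g hg) hβ).2 ha)
        (supportedOn_of_mem_replaceSpan hord hG (fun μ hμ => Iic_subset_Iio.2 hμ) hl), hβ, ⟨o⟩⟩
    -- If no leading term occurs in `α`, no generator is located at `α`, so the bound could be
    -- lowered.
    · refine absurd (Submodule.span_mono ?_ hα) hnot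
      rintro _ ⟨g, hg, β, hβ, α', hα', o, rfl⟩
      refine ⟨g, hg, β, hβ, α', lt_of_le_of_ne hα' ?_, o, rfl⟩
      rintro rfl
      exact hex ⟨g, hg, β, hβ, ⟨o⟩⟩
  · push Not at hpos
    obtain ⟨g, hg, β, hβ, h0⟩ := hpos
    obtain ⟨α, hα⟩ := exists_leadTerm hf0
    exact ⟨g, hg, α, β, hα, hβ, Occurrence.nonempty_of_numVertices_eq_zero (by omega)⟩

/-! ### Reductions, admissible representations and the remaining implications. -/

theorem replace_mem (hG : ∀ g ∈ G, IsHomogeneous g) {M : Submodule K (FreeOperad K ar)}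
    (hM : IsGeneratedBy M G) {g : FreeOperad K ar} (hg : g ∈ G) {α β : TreeMonomial ar}
    (hβ : leadTerm g = β) (o : Occurrence α β) : replace o g ∈ M :=
  hM.1.1.obtainedFrom_mem (hM.1.2 hg) (.replace o ((hG g hg).arity_eq hβ))

/-- One division step, in a form that serves both the reduction sequences and the admissible
representations: the subtracted `p` is at once a reduction term and a summand with the full leading
term. -/
theorem IsGroebnerBasis.exists_reduction (hord : IsAdmissible ar) (hG : ∀ g ∈ G, IsHomogeneous g)
    {M : Submodule K (FreeOperad K ar)} (hM : IsGeneratedBy M G) (h : IsGroebnerBasis G M)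
    {f : FreeOperad K ar} (hf : f ∈ M) (hf0 : f ≠ 0) :
    ∃ p, leadTerm p = leadTerm f ∧ (∃ g ∈ G, ObtainedFrom g p) ∧ IsReduction G f (f - p) ∧
      f - p ∈ M ∧ leadTerm (f - p) < leadTerm f := by
  obtain ⟨g, hg, α, β, hα, hβ, ⟨o⟩⟩ := h f hf hf0
  have hg0 := (leadTerm_eq_coe.1 hβ).1
  have hf' := leadTerm_eq_coe.1 hα
  have hl := replace_leadTerm hord o (hG g hg) hβ
  have harity := (hG g hg).arity_eq hβ
  refine ⟨(f α / g β) • replace o g, ?_, ⟨g, hg, (ObtainedFrom.replace o harity).smul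
    ⟨_, replace_homogeneous o harity⟩ _⟩, ⟨g, hg, α, β, hα, hβ, o, rfl⟩,
    Submodule.sub_mem _ hf (Submodule.smul_mem _ _ (replace_mem hG hM hg hβ o)), ?_⟩
  · rw [hα]
    exact leadTerm_smul hl.2 (div_ne_zero hf'.1 hg0)
  · rw [hα]
    refine leadTerm_lt (SupportedOn.Iio_of_Iic (Submodule.sub_mem _ hf'.2
      (Submodule.smul_mem _ _ (leadTerm_eq_coe.1 hl.2).2)) ?_)
    rw [Finsupp.sub_apply, Finsupp.smul_apply, hl.1, smul_eq_mul, div_mul_cancel₀ _ hg0, sub_self]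

theorem IsGroebnerBasis.reducesToZero [WellFoundedLT (TreeMonomial ar)] (hord : IsAdmissible ar)
    (hG : ∀ g ∈ G, IsHomogeneous g) {M : Submodule K (FreeOperad K ar)} (hM : IsGeneratedBy M G)
    (h : IsGroebnerBasis G M) {f : FreeOperad K ar} (hf : f ∈ M) : ReducesToZero G f := by
  induction hl : leadTerm f using WellFoundedLT.induction generalizing f with | ind l ih => ?_
  subst hl
  by_cases hf0 : f = 0
  · rw [hf0]; exact .refl
  · obtain ⟨p, -, -, h1, h2, h3⟩ := h.exists_reduction hord hG hM hf hf0
    exact .head h1 (ih _ h3 h2 rfl)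

theorem IsGroebnerBasis.hasAdmissibleRepresentation [WellFoundedLT (TreeMonomial ar)]
    (hord : IsAdmissible ar) (hG : ∀ g ∈ G, IsHomogeneous g) {M : Submodule K (FreeOperad K ar)}
    (hM : IsGeneratedBy M G) (h : IsGroebnerBasis G M) {f : FreeOperad K ar} (hf : f ∈ M) :
    HasAdmissibleRepresentation G f := by
  induction hl : leadTerm f using WellFoundedLT.induction generalizing f with | ind l ih => ?_
  subst hl
  by_cases hf0 : f = 0
  · exact ⟨0, Fin.elim0, fun k => k.elim0, by simpa using hf0, by simp [hf0, leadTerm_zero]⟩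
  · obtain ⟨p, hp, hpG, -, h2, h3⟩ := h.exists_reduction hord hG hM hf hf0
    obtain ⟨r, F, hF, hsum, hsup⟩ := ih _ h3 h2 rfl
    refine ⟨r + 1, Fin.cons p F, ?_, ?_, ?_⟩
    · intro k
      refine Fin.cases hpG (fun k => ?_) k
      simpa only [Fin.cons_succ] using hF k
    · rw [Fin.sum_univ_succ]
      simp only [Fin.cons_zero, Fin.cons_succ]
      rw [← hsum, add_sub_cancel]
    · rw [Fin.univ_succ, Finset.sup_cons, Finset.sup_map]
      simp only [Function.comp_def, Function.Embedding.coeFn_mk, Fin.cons_zero, Fin.cons_succ]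
      -- The new summand attains the maximum, since the remainder has a smaller leading term.
      rw [← hsup, hp, sup_of_le_left h3.le]

/-- Leading terms multiply under composition and occurrences survive it. The other factor need not
be homogeneous: only one of its components matters, and that one is nonzero if the composition is.
-/
theorem ObtainedFrom.homogeneous_and_divides (hord : IsAdmissible ar) {g f : FreeOperad K ar}
    (hg : IsHomogeneous g) (h : ObtainedFrom g f) : IsHomogeneous f ∧ (f ≠ 0 →
      ∃ α β : TreeMonomial ar, leadTerm f = α ∧ leadTerm g = β ∧ β.Divides α) := by
  induction h with
  | self =>
    refine ⟨hg, fun h0 => ?_⟩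
    obtain ⟨β, hβ⟩ := exists_leadTerm h0
    obtain ⟨o, -⟩ := Occurrence.exists_self β
    exact ⟨β, β, hβ, hβ, ⟨o⟩⟩
  | @comp_left n m i σ f h _ ih =>
    refine ⟨⟨_, comp_homogeneous σ f h⟩, fun h0 => ?_⟩
    have hf0 : f ≠ 0 := fun hf => h0 (by rw [hf, comp_zero_left])
    obtain ⟨α, β, hα, hβ, ⟨o⟩⟩ := ih.2 hf0
    have hfa := ih.1.arity_eq hα
    have hn : α.arity = n := by
      by_contra hn
      exact h0 (comp_eq_zero_left σ h (component_eq_zero fun γ hγ => by rwa [hfa γ hγ]))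
    obtain ⟨δ, hδ⟩ := exists_leadTerm fun h' => h0 (comp_eq_zero_right (m := m) σ f h')
    have hδm := component_apply_mem (Finsupp.mem_support_iff.2 (leadTerm_eq_coe.1 hδ).1)
    obtain ⟨o', -⟩ := o.exists_comp_left σ hn hδm
    exact ⟨_, β, comp_leadTerm hord σ hn hδm
      (by rwa [component_eq_self fun γ hγ => (hfa γ hγ).trans hn]) hδ, hβ, ⟨o'⟩⟩
  | @comp_right n m i σ f h _ ih =>
    refine ⟨⟨_, comp_homogeneous σ h f⟩, fun h0 => ?_⟩
    have hf0 : f ≠ 0 := fun hf => h0 (by rw [hf, comp_zero_right])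
    obtain ⟨α, β, hα, hβ, ⟨o⟩⟩ := ih.2 hf0
    have hfa := ih.1.arity_eq hα
    have hn : α.arity = m := by
      by_contra hn
      exact h0 (comp_eq_zero_right σ h (component_eq_zero fun γ hγ => by rwa [hfa γ hγ]))
    obtain ⟨δ, hδ⟩ := exists_leadTerm fun h' => h0 (comp_eq_zero_left (n := n) σ f h')
    have hδm := component_apply_mem (Finsupp.mem_support_iff.2 (leadTerm_eq_coe.1 hδ).1)
    obtain ⟨o', -⟩ := o.exists_comp_right σ hδm hn
    exact ⟨_, β, comp_leadTerm hord σ hδm hn hδ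
      (by rwa [component_eq_self fun γ hγ => (hfa γ hγ).trans hn]), hβ, ⟨o'⟩⟩

theorem HasAdmissibleRepresentation.exists_divides (hord : IsAdmissible ar)
    (hG : ∀ g ∈ G, IsHomogeneous g) {f : FreeOperad K ar} (h : HasAdmissibleRepresentation G f)
    (hf0 : f ≠ 0) : ∃ g ∈ G, ∃ α β : TreeMonomial ar,
      leadTerm f = α ∧ leadTerm g = β ∧ β.Divides α := by
  obtain ⟨r, F, hF, -, hsup⟩ := h
  obtain ⟨α, hα⟩ := exists_leadTerm hf0
  have hne : (Finset.univ : Finset (Fin r)).Nonempty := by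
    rw [Finset.nonempty_iff_ne_empty]
    intro he
    rw [he, Finset.sup_empty, hα] at hsup
    exact WithBot.coe_ne_bot hsup
  obtain ⟨k, -, hk⟩ := Finset.exists_mem_eq_sup _ hne fun k => leadTerm (F k)
  obtain ⟨g, hg, hgF⟩ := hF k
  rw [← hsup] at hk
  obtain ⟨α', β, hα', hβ, hdiv⟩ := (hgF.homogeneous_and_divides hord (hG g hg)).2
    (ne_zero_of_leadTerm (hk ▸ hα))
  exact ⟨g, hg, α', β, hk.trans hα', hβ, hdiv⟩

end FreeOperad

end ShuffleOperad

theorem mainTheorem1 {K : Type*} [Field K] {B : Type*} (ar : B → ℕ+)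
    [LinearOrder (ShuffleOperad.TreeMonomial ar)]
    [WellFoundedLT (ShuffleOperad.TreeMonomial ar)]
    (hord : ShuffleOperad.TreeMonomial.IsAdmissible ar)
    (M : Submodule K (ShuffleOperad.FreeOperad K ar))
    (G : Set (ShuffleOperad.FreeOperad K ar))
    (hG : ∀ g ∈ G, ShuffleOperad.FreeOperad.IsHomogeneous g)
    (hM : ShuffleOperad.FreeOperad.IsGeneratedBy M G) :
    [ShuffleOperad.FreeOperad.IsGroebnerBasis G M,
      ∀ f ∈ M, ShuffleOperad.FreeOperad.ReducesToZero G f,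
      ∀ f ∈ G, ∀ g ∈ G, ∀ s, ShuffleOperad.FreeOperad.IsSPolynomial f g s →
        ShuffleOperad.FreeOperad.ReducesToZero G s,
      ∀ f ∈ M, ShuffleOperad.FreeOperad.HasAdmissibleRepresentation G f].TFAE := by
  tfae_have 1 → 2 := fun h f hf => h.reducesToZero hord hG hM hf
  tfae_have 2 → 3 := by
    rintro h f hf g hg _ ⟨α, β, γ, hα, hβ, -, o₁, o₂, rfl⟩
    exact h _ (Submodule.sub_mem _ (ShuffleOperad.FreeOperad.replace_mem hG hM hf hα o₁)
      (Submodule.smul_mem _ _ (ShuffleOperad.FreeOperad.replace_mem hG hM hg hβ o₂)))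
  tfae_have 3 → 1 :=
    ShuffleOperad.FreeOperad.isGroebnerBasis_of_sPolynomials hord hG hM
  tfae_have 1 → 4 := fun h f hf => h.hasAdmissibleRepresentation hord hG hM hf
  tfae_have 4 → 1 := fun h f hf hf0 => (h f hf).exists_divides hord hG hf0
  tfae_finish
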